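/- \textbf{Setting.} Let $(\mathcal A,\Delta)$ be a complex Hopf $*$-algebra with co-inverse $\kappa$ and a positive Haar integral $h$, i.e. a linear functional with $h(1)=1$, $(\mathrm{id}\otimes h)\Delta(a)=(h\otimes\mathrm{id})\Delta(a)=h(a)1$ and $h(a^*a)\ge 0$ for all $a$ (as is the case for the Hopf $*$-algebra associated to a compact quantum group). Equip $\mathcal A$ with the inner product $\langle a,b\rangle=h(b^*a)$. An element of $\mathcal A$ is called homogeneous if it lies in the linear span $\mathcal A_\alpha$ of the matrix elements of some irreducible finite-dimensional unitary representation, where a unitary representation is a unitary matrix $U=(U_{jk})\in M_n(\mathcal A)$ with $\Delta(U_{jk})=\sum_r U_{jr}\otimes U_{rk}$, and it is irreducible if $n\geq 1$ and no subspace of $\mathbb C^n$ other than $0$ and $\mathbb C^n$ is invariant under all matrices $(\chi(U_{jk}))_{jk}$, $\chi$ a linear functional on $\mathcal A$. Let $(\Omega,d)$ be a $*$-differential calculus over $\mathcal A$: $\Omega=\bigoplus_{k\ge0}\Omega_k$ is a graded algebra with $\Omega_0=\mathcal A$ (as $*$-algebras), with a degree-zero conjugate-linear involution satisfying $(\omega\eta)^*=(-1)^{kl}\eta^*\omega^*$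 for $\omega\in\Omega_k$, $\eta\in\Omega_l$, and with a linear map $d$ of degree $1$ such that $d^2=0$, $d1=0$, $d(\omega^*)=(d\omega)^*$ and $d(\omega\eta)=(d\omega)\eta+(-1)^k\omega\,d\eta$ for $\omega\in\Omega_k$; for $k>0$, $\Omega_k$ is spanned by the products $a_0\,da_1\cdots da_k$, $a_j\in\mathcal A$; and there is an algebra homomorphism $\Delta_\Omega:\Omega\to\mathcal A\otimes\Omega$ extending $\Delta$ with $(\mathrm{id}\otimes d)\Delta_\Omega=\Delta_\Omega d$. Put $\Omega^{\mathrm{inv}}=\{\omega:\Delta_\Omega(\omega)=1\otimes\omega\}$ and $\Omega^{\mathrm{inv}}_k=\Omega_k\cap\Omega^{\mathrm{inv}}$. Assume that $\Omega^{\mathrm{inv}}$ is finite-dimensional; that $N$ is the dimension of the calculus ($\Omega_N\neq0$ and $\Omega_k=0$ for $k>N$); that $\dim\Omega^{\mathrm{inv}}_N=1$; that $d(\Omega^{\mathrm{inv}}_{N-1})=0$; and that the calculus is non-degenerate (if $0\le k\le N$, $\omega\in\Omega_k$ and $\omega'\omega=0$ for all $\omega'\in\Omega_{N-k}$, then $\omega=0$).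 Let $\theta=\theta^*$ be a nonzero element of $\Omega^{\mathrm{inv}}_N$, and let $\int:\Omega\to\mathbb C$ be the linear functional which vanishes on $\Omega_k$ for $k<N$ and satisfies $\int a\theta=h(a)$ for $a\in\mathcal A$. A function from $\mathbb C$ to a complex vector space $V$ is of finite exponential type if it has the form $z\mapsto\sum_{j=1}^n f_j(z)v_j$ with $v_j\in V$ and $f_j$ entire functions satisfying $|f_j(z)|\le M_je^{r_j|\operatorname{Im}z|}$ for some $M_j,r_j>0$. An exponential one-parameter group on an algebra $B$ with an involution (here $B=\mathcal A$ or $\Omega$) is a family $(\beta_z)_{z\in\mathbb C}$ of algebra automorphisms of $B$ with $\beta_{y+z}=\beta_y\beta_z$ and $\beta_z(b)^*=\beta_{\bar z}(b^*)$ for which each map $z\mapsto\beta_z(b)$ is of finite exponential type. \textbf{Theorem.} There is a unique exponential one-parameter group $\tau$ on $\mathcal A$ with $\tau_i=\kappa^{-2}$ (the scaling group), and a unique algebra automorphism $\sigma$ of $\Omega$ of degree zero with $\sigma d=d\sigma$ and $\int\omega'\omega=(-1)^{kl}\int\sigma(\omega)\omega'$ for all $\omega\in\Omega_k$, $\omega'\in\Omega_l$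 (the twist automorphism of $\int$). Suppose that $h(a^*\sigma(a))\ge0$ for all $a\in\mathcal A$. Then there is a unique exponential one-parameter group $\beta$ on $\Omega$ with $\beta_i=\sigma$. Moreover, there are a linear basis $(e_j)_{j\in J}$ of $\mathcal A$ that is orthonormal and consists of homogeneous elements, and positive numbers $(\lambda_j)_{j\in J}$, such that $\beta_z(e_j)=\lambda_j^{-iz}e_j$ for all $j\in J$, $z\in\mathbb C$. Furthermore, for every $z\in\mathbb C$: $\beta_z$ is of degree zero, $d\beta_z=\beta_zd$, $\int\beta_z(\omega)=\int\omega$ for all $\omega\in\Omega$, $(\tau_z\otimes\beta_z)\Delta_\Omega=\Delta_\Omega\beta_z$, and $\beta_z(\Omega^{\mathrm{inv}})=\Omega^{\mathrm{inv}}$. -/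

import Mathlib

open scoped TensorProduct ComplexOrder

universe u v

/-- A Hopf `*`-algebra over `ℂ`: a Hopf algebra which is a `*`-algebra and whose co-multiplication
is a `*`-homomorphism (the involution of `A ⊗ A` being `(a ⊗ b)* = a* ⊗ b*`). -/
class HopfStarAlgebra (A : Type u) [Ring A] [StarRing A] [HopfAlgebra ℂ A] [StarModule ℂ A] :
    Prop where
  comul_star : ∀ a : A, Coalgebra.comul (R := ℂ) (star a) = star (Coalgebra.comul (R := ℂ) a)

/-- `h` is a positive Haar integral: `h 1 = 1`, `(id ⊗ h) Δ a = h(a) 1 = (h ⊗ id) Δ a`,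
`h (a* a) ≥ 0`. -/
structure IsHaarIntegral {A : Type u} [Ring A] [StarRing A] [HopfAlgebra ℂ A]
    (h : A →ₗ[ℂ] ℂ) : Prop where
  map_one : h 1 = 1
  left_invariant : ∀ a : A,
    TensorProduct.rid ℂ A (h.lTensor A (Coalgebra.comul (R := ℂ) a)) = h a • (1 : A)
  right_invariant : ∀ a : A,
    TensorProduct.lid ℂ A (h.rTensor A (Coalgebra.comul (R := ℂ) a)) = h a • (1 : A)
  nonneg : ∀ a : A, 0 ≤ h (star a * a)

/-- A finite-dimensional unitary (matrix) representation of the quantum group with Hopf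
`*`-algebra `A`: a unitary matrix `U` over `A` with `Δ (U j k) = ∑ r, U j r ⊗ U r k`. -/
structure IsUnitaryRep {A : Type u} [Ring A] [StarRing A] [HopfAlgebra ℂ A] {n : ℕ}
    (U : Matrix (Fin n) (Fin n) A) : Prop where
  comul_apply : ∀ j k, Coalgebra.comul (R := ℂ) (U j k) = ∑ r, U j r ⊗ₜ[ℂ] U r k
  mem_unitary : U ∈ unitary (Matrix (Fin n) (Fin n) A)

/-- An irreducible unitary representation: the space `ℂⁿ` is nonzero, and its only subspaces
invariant under all the operators `(id ⊗ χ)(U)`, `χ` a linear functional on `A`, are `0` and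
`ℂⁿ`. -/
structure IsIrreducibleUnitaryRep {A : Type u} [Ring A] [StarRing A] [HopfAlgebra ℂ A] {n : ℕ}
    (U : Matrix (Fin n) (Fin n) A) : Prop extends IsUnitaryRep U where
  pos : 0 < n
  eq_bot_or_eq_top : ∀ W : Submodule ℂ (Fin n → ℂ),
    (∀ χ : A →ₗ[ℂ] ℂ, ∀ w ∈ W, (U.map χ).mulVec w ∈ W) → W = ⊥ ∨ W = ⊤

/-- `a` lies in one of the spaces `A_α`, the linear span of the matrix elements of an irreducible
unitary representation in the class `α`. -/
def IsHomogeneous {A : Type u} [Ring A] [StarRing A] [HopfAlgebra ℂ A] (a : A) : Prop :=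
  ∃ (n : ℕ) (U : Matrix (Fin n) (Fin n) A), IsIrreducibleUnitaryRep U ∧
    a ∈ Submodule.span ℂ (Set.range fun p : Fin n × Fin n => U p.1 p.2)

/-- An entire function `f` with `|f z| ≤ M e^{r |Im z|}`. -/
def IsExponentialType (f : ℂ → ℂ) : Prop :=
  Differentiable ℂ f ∧ ∃ M r : ℝ, 0 < M ∧ 0 < r ∧ ∀ z : ℂ, ‖f z‖ ≤ M * Real.exp (r * |z.im|)

/-- A vector-valued function that is a finite combination of vectors with coefficients of
exponential type. -/
def IsFiniteExponentialType {V : Type v} [AddCommGroup V] [Module ℂ V] (f : ℂ → V) : Prop :=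
  ∃ (n : ℕ) (w : Fin n → V) (g : Fin n → ℂ → ℂ), (∀ j, IsExponentialType (g j)) ∧
    ∀ z, f z = ∑ j, g j z • w j

/-- An exponential one-parameter group of automorphisms of an algebra `B` with involution `inv`. -/
structure IsExponentialOneParameterGroup {B : Type v} [Ring B] [Algebra ℂ B] (inv : B → B)
    (β : ℂ → B ≃ₐ[ℂ] B) : Prop where
  map_add : ∀ (y z : ℂ) (b : B), β (y + z) b = β y (β z b)
  map_inv : ∀ (z : ℂ) (b : B), inv (β z b) = β (starRingEnd ℂ z) (inv b)
  finiteExponentialType : ∀ b : B, IsFiniteExponentialType fun z => β z b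

/-- The scaling group of `A`: the exponential one-parameter group `τ` with `τ_i = κ⁻²`, where
`κ` is the co-inverse (antipode). -/
structure IsScalingGroup {A : Type u} [Ring A] [StarRing A] [HopfAlgebra ℂ A]
    (τ : ℂ → A ≃ₐ[ℂ] A) : Prop extends IsExponentialOneParameterGroup (star : A → A) τ where
  antipode_antipode : ∀ a : A,
    HopfAlgebra.antipode ℂ (HopfAlgebra.antipode ℂ (τ Complex.I a)) = a

/-- A (left-covariant) `*`-differential calculus over the Hopf `*`-algebra `A`, with algebra of
forms `Ω`. -/
structure StarDifferentialCalculus (A : Type u) (Ω : Type v) [Ring A] [StarRing A]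
    [HopfAlgebra ℂ A] [Ring Ω] [Algebra ℂ Ω] where
  /-- The space of `k`-forms. -/
  grading : ℕ → Submodule ℂ Ω
  isInternal : DirectSum.IsInternal grading
  mul_mem : ∀ {k l : ℕ} {ω η : Ω}, ω ∈ grading k → η ∈ grading l → ω * η ∈ grading (k + l)
  /-- The graded involution. -/
  inv : Ω →ₛₗ[starRingEnd ℂ] Ω
  inv_mem : ∀ {k : ℕ} {ω : Ω}, ω ∈ grading k → inv ω ∈ grading k
  inv_inv : ∀ ω : Ω, inv (inv ω) = ω
  inv_mul : ∀ {k l : ℕ} {ω η : Ω}, ω ∈ grading k → η ∈ grading l →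
    inv (ω * η) = (-1 : Ω) ^ (k * l) * (inv η * inv ω)
  /-- The differential. -/
  d : Ω →ₗ[ℂ] Ω
  d_mem : ∀ {k : ℕ} {ω : Ω}, ω ∈ grading k → d ω ∈ grading (k + 1)
  d_inv : ∀ ω : Ω, d (inv ω) = inv (d ω)
  d_mul : ∀ {k : ℕ} {ω : Ω}, ω ∈ grading k → ∀ η : Ω,
    d (ω * η) = d ω * η + (-1 : Ω) ^ k * (ω * d η)
  d_d : ∀ ω : Ω, d (d ω) = 0
  /-- The identification of `A` with the algebra of `0`-forms. -/
  ι : A →ₐ[ℂ] Ω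
  ι_injective : Function.Injective ι
  range_ι : LinearMap.range ι.toLinearMap = grading 0
  inv_ι : ∀ a : A, inv (ι a) = ι (star a)
  grading_eq_span : ∀ k : ℕ, 0 < k → grading k =
    Submodule.span ℂ (Set.range fun p : A × (Fin k → A) =>
      ι p.1 * (List.ofFn fun j => d (ι (p.2 j))).prod)
  /-- The left coaction `Δ_Ω`. -/
  coaction : Ω →ₐ[ℂ] A ⊗[ℂ] Ω
  coaction_ι : ∀ a : A, coaction (ι a) = ι.toLinearMap.lTensor A (Coalgebra.comul (R := ℂ) a)
  coaction_d : ∀ ω : Ω, coaction (d ω) = d.lTensor A (coaction ω)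
  d_one : d 1 = 0

namespace StarDifferentialCalculus

variable {A : Type u} {Ω : Type v} [Ring A] [StarRing A] [HopfAlgebra ℂ A] [Ring Ω] [Algebra ℂ Ω]

/-- The space of left-invariant forms, `Δ_Ω ω = 1 ⊗ ω`. -/
def invariants (C : StarDifferentialCalculus A Ω) : Submodule ℂ Ω where
  carrier := {ω | C.coaction ω = (1 : A) ⊗ₜ[ℂ] ω}
  add_mem' {x y} hx hy := by
    simp only [Set.mem_ofPred_eq] at hx hy ⊢
    rw [map_add, hx, hy, TensorProduct.tmul_add]
  zero_mem' := by simp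
  smul_mem' c x hx := by
    simp only [Set.mem_ofPred_eq] at hx ⊢
    rw [map_smul, hx, TensorProduct.tmul_smul]

/-- The space of left-invariant `k`-forms. -/
def invariantForms (C : StarDifferentialCalculus A Ω) (k : ℕ) : Submodule ℂ Ω :=
  C.grading k ⊓ C.invariants

/-- `N` is the dimension of the calculus: the largest degree in which there are nonzero forms. -/
def IsDimension (C : StarDifferentialCalculus A Ω) (N : ℕ) : Prop :=
  C.grading N ≠ ⊥ ∧ ∀ k, N < k → C.grading k = ⊥

/-- Non-degeneracy of a calculus of dimension `N`: a `k`-form `ω` with `ω' ω = 0` for all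
`(N - k)`-forms `ω'` is zero. -/
def IsNondegenerate (C : StarDifferentialCalculus A Ω) (N : ℕ) : Prop :=
  ∀ k l : ℕ, l + k = N → ∀ ω ∈ C.grading k, (∀ ω' ∈ C.grading l, ω' * ω = 0) → ω = 0

/-- The projection of `Ω = ⨁ Ω_k` onto `Ω_k`. -/
noncomputable def component (C : StarDifferentialCalculus A Ω) (k : ℕ) : Ω →ₗ[ℂ] Ω :=
  (C.grading k).subtype ∘ₗ DirectSum.component ℂ ℕ (fun j => C.grading j) k ∘ₗ
    (LinearEquiv.ofBijective (DirectSum.coeLinearMap C.grading) C.isInternal).symm.toLinearMap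

/-- The integral on `Ω` associated to a volume element `θ` of degree `N`: it vanishes on `k`-forms
with `k ≠ N`, and its value at the `N`-form `a θ` is `h a`. -/
noncomputable def integral (C : StarDifferentialCalculus A Ω) (h : A →ₗ[ℂ] ℂ) (N : ℕ) (θ : Ω) :
    Ω →ₗ[ℂ] ℂ :=
  h ∘ₗ (LinearMap.mulRight ℂ θ ∘ₗ C.ι.toLinearMap).leftInverse ∘ₗ C.component N

/-- `σ` is the twist automorphism of the functional `I` on `Ω`: it is an algebra automorphism of
degree zero, commutes with `d`, and `I (ω' ω) = (-1)^{kl} I (σ(ω) ω')` for `k`-forms `ω` and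
`l`-forms `ω'`. -/
structure IsTwistAutomorphism (C : StarDifferentialCalculus A Ω) (I : Ω →ₗ[ℂ] ℂ)
    (σ : Ω ≃ₐ[ℂ] Ω) : Prop where
  map_mem : ∀ {k : ℕ} {ω : Ω}, ω ∈ C.grading k → σ ω ∈ C.grading k
  map_d : ∀ ω : Ω, σ (C.d ω) = C.d (σ ω)
  twist : ∀ {k l : ℕ} {ω ω' : Ω}, ω ∈ C.grading k → ω' ∈ C.grading l →
    I (ω' * ω) = (-1) ^ (k * l) * I (σ ω * ω')

end StarDifferentialCalculus

/-!
The proof has three ingredients.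

*One-parameter groups are determined by eigenvectors.* A scalar function of exponential type that
is multiplied by `l > 0` under translation by `i` is a multiple of `z ↦ l ^ (-iz)`: the quotient is
entire, `i`-periodic and bounded, and Liouville's theorem applies
(`IsExponentialType.eq_cpow_mul`). If the eigenvectors of `β_i` with positive eigenvalues span the
algebra, it follows that `β` is determined by `β_i`, and that a linear map intertwining `β_i` with
the member `T_i` of another one-parameter family intertwines `β_z` with `T_z` for every `z`
(`IsExponentialOneParameterGroup.intertwine`). Conversely, an algebra map `T` with a spanning set of
such eigenvectors has complex powers, which are multiplicative because a product of eigenvectors is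
an eigenvector (`exists_isExponentialOneParameterGroup`).

*The structure of `A`.* The Haar integral is faithful (`IsHaarIntegral.eq_zero_of_apply_mul`), every
element lies in a finite-dimensional right coideal, and a minimal right coideal with an orthonormal
basis is an irreducible unitary representation; so the entries of these representations span `A`
(`IsHaarIntegral.span_irreducible`). In a suitable orthonormal basis of `ℂⁿ` a unitary
representation satisfies `Uᵀ Q Ū = Q` with a positive diagonal matrix `Q`
(`IsUnitaryRep.exists_isDiagonalRep`), and then `κ² (U i j) = (q i / q j) U i j`. This gives the
scaling group. The same matrices `Q` show that `b ↦ ∑ r, q r ^ 2 h (U r i* b U r j)` is left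
invariant, hence a multiple of `h`, and this is the modular property `h (b a) = h (s(a) b)` for an
explicit linear map `s` (`IsDiagonalRep.exists_modular`).

*The twist automorphism.* Every form is a combination of products of elements of `A` with invariant
forms; hence `Ω_N = A θ` freely, and the integral is closed since invariant `(N - 1)`-forms are.
With `θ a = ρ(a) θ`, the map `s ∘ ρ` is the twist automorphism on `A`. The pairs `(ω, η)` of
`k`-forms with `∫ ω' ω = ± ∫ η ω'` for all `ω'` are compatible with products and, because the
integral is closed, with `d`; as `Ω` is generated by `A` and `d A`, they form the graph of an
automorphism `σ`, unique by non-degeneracy and faithfulness. On the entries of a diagonal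
representation `σ` is, up to the factors `1 / q k`, multiplication by a scalar matrix on the right
(`twist_diagonal`). Hence `σ` preserves the coefficient spaces, and `Δ_Ω σ = (κ⁻² ⊗ σ) Δ_Ω`
holds on `A`, from where it extends to `Ω`.

If `h (a* σ(a)) ≥ 0`, then `σ` is a positive symmetric injective operator on `A` that preserves the
pairwise orthogonal finite-dimensional coefficient spaces, so that `A` has an orthonormal basis of
homogeneous eigenvectors with positive eigenvalues (`exists_homogeneous_eigenbasis`). Products and
differentials of eigenvectors being eigenvectors, the eigenvectors of `σ` with positive eigenvalues
span `Ω`. So `σ = β_i` for a unique exponential one-parameter group `β`; compatibility with the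
involution comes from `σ (σ(ω)*) = ω*`. All properties of `β_z` are inherited from those of `σ` by
intertwining, with the projections onto the `Ω_k`, with `d`, with the integral and with `Δ_Ω`.
-/

set_option linter.unusedSectionVars false

/-! ### Exponential one-parameter groups and positive eigenvectors -/

/-- An entire function of exponential type that is multiplied by `l > 0` under translation by `i`
is a multiple of `z ↦ l ^ (-iz)`: the quotient is `i`-periodic and bounded on a strip of height
one, hence constant by Liouville's theorem. -/
theorem IsExponentialType.eq_cpow_mul {f : ℂ → ℂ} (hf : IsExponentialType f) {l : ℝ} (hl : 0 < l)
    (hp : ∀ z, f (z + Complex.I) = l * f z) (z : ℂ) :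
    f z = (l : ℂ) ^ (-Complex.I * z) * f 0 := by
  obtain ⟨hd, M, r, hM, hr, hb⟩ := hf
  have hl0 : (l : ℂ) ≠ 0 := by exact_mod_cast hl.ne'
  set g : ℂ → ℂ := fun z => (l : ℂ) ^ (Complex.I * z) * f z with hg
  have hgd : Differentiable ℂ g := by
    refine Differentiable.mul ?_ hd
    intro z
    exact DifferentiableAt.const_cpow (by fun_prop) (Or.inl hl0)
  have hper : Function.Periodic g Complex.I := by
    intro z
    simp only [hg, hp, mul_add, Complex.I_mul_I, Complex.cpow_add _ _ hl0, Complex.cpow_neg_one]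
    field_simp
  have hbd : Bornology.IsBounded (Set.range g) := by
    rw [isBounded_iff_forall_norm_le]
    refine ⟨max 1 (l⁻¹) * (M * Real.exp r), ?_⟩
    rintro _ ⟨z, rfl⟩
    have h1 : g z = g (z - (⌊z.im⌋ : ℤ) * Complex.I) := by
      have := hper.sub_zsmul_eq (x := z) ⌊z.im⌋
      rw [← this]; simp
    rw [h1]
    set w : ℂ := z - (⌊z.im⌋ : ℤ) * Complex.I with hw
    have hwim : w.im = Int.fract z.im := by
      simp [hw, Int.self_sub_floor]
    have h0 : 0 ≤ w.im := by rw [hwim]; exact Int.fract_nonneg _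
    have h2 : w.im ≤ 1 := by rw [hwim]; exact (Int.fract_lt_one _).le
    rw [hg]
    simp only [norm_mul]
    refine mul_le_mul ?_ ((hb w).trans ?_) (norm_nonneg _) (by positivity)
    · rw [Complex.norm_cpow_eq_rpow_re_of_pos hl]
      simp only [Complex.mul_re, Complex.I_re, zero_mul, Complex.I_im, one_mul, zero_sub]
      rcases le_total 1 l with h | h
      · exact (Real.rpow_le_one_of_one_le_of_nonpos h (by linarith)).trans (le_max_left _ _)
      · refine le_trans ?_ (le_max_right _ _)
        rw [← Real.rpow_neg_one]
        exact Real.rpow_le_rpow_of_exponent_ge hl h (by linarith)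
    · rw [abs_of_nonneg h0]
      gcongr
      nlinarith
  have hc := hgd.apply_eq_apply_of_bounded hbd z 0
  simp only [hg, mul_zero, Complex.cpow_zero, one_mul] at hc
  rw [← hc, ← mul_assoc, ← Complex.cpow_add _ _ hl0]
  simp

theorem IsExponentialType.zero : IsExponentialType fun _ => 0 :=
  ⟨differentiable_const _, 1, 1, one_pos, one_pos, fun z => by simp; positivity⟩

theorem IsExponentialType.const_mul {f : ℂ → ℂ} (hf : IsExponentialType f) (c : ℂ) :
    IsExponentialType fun z => c * f z := by
  obtain ⟨hd, M, r, hM, hr, hb⟩ := hf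
  refine ⟨hd.const_mul c, (‖c‖ + 1) * M, r, by positivity, hr, fun z => ?_⟩
  rw [norm_mul, mul_assoc]
  exact mul_le_mul (by linarith) (hb z) (norm_nonneg _) (by positivity)

theorem IsExponentialType.add {f g : ℂ → ℂ} (hf : IsExponentialType f)
    (hg : IsExponentialType g) : IsExponentialType fun z => f z + g z := by
  obtain ⟨hd, M, r, hM, hr, hb⟩ := hf
  obtain ⟨hd', M', r', hM', hr', hb'⟩ := hg
  refine ⟨hd.add hd', M + M', r + r', by positivity, by positivity, fun z => ?_⟩
  refine (norm_add_le _ _).trans ?_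
  rw [add_mul]
  refine add_le_add ((hb z).trans ?_) ((hb' z).trans ?_)
  all_goals
    gcongr
    linarith

theorem IsExponentialType.mul {f g : ℂ → ℂ} (hf : IsExponentialType f)
    (hg : IsExponentialType g) : IsExponentialType fun z => f z * g z := by
  obtain ⟨hd, M, r, hM, hr, hb⟩ := hf
  obtain ⟨hd', M', r', hM', hr', hb'⟩ := hg
  refine ⟨hd.mul hd', M * M', r + r', by positivity, by positivity, fun z => ?_⟩
  rw [norm_mul, add_mul, Real.exp_add, mul_mul_mul_comm]
  exact mul_le_mul (hb z) (hb' z) (norm_nonneg _) (by positivity)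

theorem IsExponentialType.sum {ι : Type*} (s : Finset ι) {f : ι → ℂ → ℂ}
    (hf : ∀ i, IsExponentialType (f i)) : IsExponentialType fun z => ∑ i ∈ s, f i z := by
  classical
  induction s using Finset.induction_on with
  | empty => simpa using IsExponentialType.zero
  | insert a s ha ih => simpa [Finset.sum_insert ha] using (hf a).add ih

theorem isExponentialType_cpow {l : ℝ} (hl : 0 < l) :
    IsExponentialType fun z => (l : ℂ) ^ (-Complex.I * z) := by
  have hl0 : (l : ℂ) ≠ 0 := by exact_mod_cast hl.ne'
  refine ⟨fun z => DifferentiableAt.const_cpow (by fun_prop) (Or.inl hl0), 1, |Real.log l| + 1,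
    one_pos, by positivity, fun z => ?_⟩
  rw [Complex.norm_cpow_eq_rpow_re_of_pos hl, Real.rpow_def_of_pos hl, one_mul,
    Real.exp_le_exp]
  simp only [neg_mul, Complex.neg_re, Complex.mul_re, Complex.I_re, zero_mul, Complex.I_im, one_mul,
    zero_sub, neg_neg]
  calc Real.log l * z.im ≤ |Real.log l * z.im| := le_abs_self _
    _ = |Real.log l| * |z.im| := abs_mul _ _
    _ ≤ _ := by gcongr; linarith

section FiniteExponentialType

variable {V W X : Type*} [AddCommGroup V] [Module ℂ V] [AddCommGroup W] [Module ℂ W]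
  [AddCommGroup X] [Module ℂ X]

theorem isFiniteExponentialType_of_fintype {ι : Type*} [Fintype ι] (w : ι → V)
    (g : ι → ℂ → ℂ) (hg : ∀ i, IsExponentialType (g i)) :
    IsFiniteExponentialType fun z => ∑ i, g i z • w i :=
  ⟨Fintype.card ι, w ∘ (Fintype.equivFin ι).symm, fun j => g ((Fintype.equivFin ι).symm j),
    fun _ => hg _, fun z =>
      ((Fintype.equivFin ι).symm.sum_comp fun i => g i z • w i).symm⟩

theorem IsFiniteExponentialType.zero : IsFiniteExponentialType fun _ => (0 : V) :=
  ⟨0, Fin.elim0, Fin.elim0, fun j => j.elim0, fun _ => by simp⟩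

theorem IsFiniteExponentialType.add {f g : ℂ → V} (hf : IsFiniteExponentialType f)
    (hg : IsFiniteExponentialType g) : IsFiniteExponentialType fun z => f z + g z := by
  obtain ⟨n, w, c, hc, h⟩ := hf
  obtain ⟨n', w', c', hc', h'⟩ := hg
  have := isFiniteExponentialType_of_fintype (Sum.elim w w') (Sum.elim c c')
    (by rintro (i | i); exacts [hc i, hc' i])
  simpa [h, h'] using this

theorem IsFiniteExponentialType.map {f : ℂ → V} (hf : IsFiniteExponentialType f) (B : V →ₗ[ℂ] W) :
    IsFiniteExponentialType fun z => B (f z) := by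
  obtain ⟨n, w, c, hc, h⟩ := hf
  exact ⟨n, fun j => B (w j), c, hc, fun z => by simp [h]⟩

/-- A bilinear combination of two functions of finite exponential type is of finite exponential
type. -/
theorem IsFiniteExponentialType.map₂ {f : ℂ → V} {g : ℂ → W} (hf : IsFiniteExponentialType f)
    (hg : IsFiniteExponentialType g) (B : V →ₗ[ℂ] W →ₗ[ℂ] X) :
    IsFiniteExponentialType fun z => B (f z) (g z) := by
  obtain ⟨n, w, c, hc, h⟩ := hf
  obtain ⟨n', w', c', hc', h'⟩ := hg
  have := isFiniteExponentialType_of_fintype (fun p : Fin n × Fin n' => B (w p.1) (w' p.2))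
    (fun p z => c p.1 z * c' p.2 z) (fun p => (hc p.1).mul (hc' p.2))
  refine (funext fun z => ?_ : (fun z => B (f z) (g z)) = _) ▸ this
  simp only [h, h', map_sum, map_smul, LinearMap.sum_apply, LinearMap.smul_apply,
    Fintype.sum_prod_type, mul_smul, Finset.smul_sum]
  rw [Finset.sum_comm]
  exact Finset.sum_congr rfl fun i _ => Finset.sum_congr rfl fun j _ => smul_comm _ _ _

/-- A vector-valued function of finite exponential type that is multiplied by `l > 0` under
translation by `i` is a multiple of `z ↦ l ^ (-iz)`. -/
theorem IsFiniteExponentialType.eq_cpow_smul {f : ℂ → V} (hf : IsFiniteExponentialType f) {l : ℝ}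
    (hl : 0 < l) (hp : ∀ z, f (z + Complex.I) = (l : ℂ) • f z) (z : ℂ) :
    f z = (l : ℂ) ^ (-Complex.I * z) • f 0 := by
  rw [← sub_eq_zero, ← Module.forall_dual_apply_eq_zero_iff ℂ]
  intro φ
  obtain ⟨n, w, c, hc, h⟩ := hf
  have h1 : IsExponentialType fun z => φ (f z) := by
    have := IsExponentialType.sum Finset.univ (f := fun j z => φ (w j) * c j z)
      (fun j => (hc j).const_mul _)
    refine (funext fun z => ?_ : (fun z => φ (f z)) = _) ▸ this
    simp [h, mul_comm]
  have := h1.eq_cpow_mul hl (fun z => by simp [hp]) z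
  rw [map_sub, map_smul, this, smul_eq_mul, sub_self]

end FiniteExponentialType

section Group

variable {B : Type v} [Ring B] [Algebra ℂ B] {inv : B → B}

/-- The linear span of the eigenvectors of `T` with positive eigenvalues. -/
def positiveEigenspan {V : Type*} [AddCommGroup V] [Module ℂ V] (T : V → V) : Submodule ℂ V :=
  Submodule.span ℂ {v | ∃ l : ℝ, 0 < l ∧ T v = (l : ℂ) • v}

theorem IsExponentialOneParameterGroup.map_zero {β : ℂ → B ≃ₐ[ℂ] B}
    (hβ : IsExponentialOneParameterGroup inv β) (b : B) : β 0 b = b :=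
  (β 0).injective (by rw [← hβ.map_add, add_zero])

/-- If `β_i` multiplies a vector by `l > 0`, then `β_z` multiplies it by `l ^ (-iz)`. -/
theorem IsExponentialOneParameterGroup.apply_of_eigenvector {β : ℂ → B ≃ₐ[ℂ] B}
    (hβ : IsExponentialOneParameterGroup inv β) {l : ℝ} (hl : 0 < l) {b : B}
    (hb : β Complex.I b = (l : ℂ) • b) (z : ℂ) :
    β z b = (l : ℂ) ^ (-Complex.I * z) • b := by
  have := (hβ.finiteExponentialType b).eq_cpow_smul hl
    (fun z => by rw [hβ.map_add, hb, map_smul]) z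
  rwa [hβ.map_zero] at this

theorem IsExponentialOneParameterGroup.eq_of_apply_I {β β' : ℂ → B ≃ₐ[ℂ] B}
    (hβ : IsExponentialOneParameterGroup inv β) (hβ' : IsExponentialOneParameterGroup inv β')
    (hI : ∀ b, β Complex.I b = β' Complex.I b)
    (hspan : positiveEigenspan (β Complex.I) = ⊤) : β = β' := by
  funext z
  have : (β z).toLinearMap = (β' z).toLinearMap := by
    refine LinearMap.ext_on hspan ?_
    rintro b ⟨l, hl, hb⟩
    simp [hβ.apply_of_eigenvector hl hb, hβ'.apply_of_eigenvector hl ((hI b).symm.trans hb)]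
  ext b
  exact LinearMap.congr_fun this b

/-- A linear map that intertwines `β_i` with an operator `T` intertwines `β_z` with the members
`T_z` of any one-parameter family of finite exponential type with `T_i = T`. -/
theorem IsExponentialOneParameterGroup.intertwine {β : ℂ → B ≃ₐ[ℂ] B}
    (hβ : IsExponentialOneParameterGroup inv β)
    (hspan : positiveEigenspan (β Complex.I) = ⊤)
    {V : Type*} [AddCommGroup V] [Module ℂ V] (T : ℂ → V →ₗ[ℂ] V)
    (hadd : ∀ y z v, T (y + z) v = T y (T z v)) (h0 : ∀ v, T 0 v = v)
    (hT : ∀ v, IsFiniteExponentialType fun z => T z v)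
    (f : B →ₗ[ℂ] V) (hf : ∀ b, f (β Complex.I b) = T Complex.I (f b)) (z : ℂ) (b : B) :
    f (β z b) = T z (f b) := by
  have : f ∘ₗ (β z).toLinearMap = T z ∘ₗ f := by
    refine LinearMap.ext_on hspan ?_
    rintro b ⟨l, hl, hb⟩
    have h1 : T Complex.I (f b) = (l : ℂ) • f b := by rw [← hf, hb, map_smul]
    have h2 := (hT (f b)).eq_cpow_smul hl (fun z => by rw [hadd, h1, map_smul]) z
    rw [h0] at h2
    simp [hβ.apply_of_eigenvector hl hb, h2]
  exact LinearMap.congr_fun this b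

/-- An algebra endomorphism `T` whose eigenvectors with positive eigenvalues span the algebra, and
which is turned into its inverse by the involution, is the value at `i` of an exponential
one-parameter group. -/
theorem exists_isExponentialOneParameterGroup (T : B →ₐ[ℂ] B)
    (hspan : positiveEigenspan T = ⊤)
    (hadd : ∀ x y, inv (x + y) = inv x + inv y)
    (hsmul : ∀ (c : ℂ) x, inv (c • x) = starRingEnd ℂ c • inv x)
    (hinv : ∀ (l : ℝ) (b : B), 0 < l → T b = (l : ℂ) • b → T (inv b) = ((l⁻¹ : ℝ) : ℂ) • inv b) :
    ∃ β : ℂ → B ≃ₐ[ℂ] B, IsExponentialOneParameterGroup inv β ∧ ∀ b, β Complex.I b = T b := by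
  classical
  set s : Set B := {v | ∃ l : ℝ, 0 < l ∧ T v = (l : ℂ) • v}
  let e := Module.Basis.ofSpan (K := ℂ) (s := s) hspan.ge
  have he : ∀ j, ∃ l : ℝ, 0 < l ∧ T (e j) = (l : ℂ) • e j := fun j =>
    Module.Basis.ofSpan_subset (K := ℂ) (s := s) hspan.ge ⟨j, rfl⟩
  choose l hl hTe using he
  have hl0 : ∀ j, (l j : ℂ) ≠ 0 := fun j => by exact_mod_cast (hl j).ne'
  let G : ℂ → B →ₗ[ℂ] B := fun z =>
    e.constr ℂ fun j => (l j : ℂ) ^ (-Complex.I * z) • e j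
  have hG : ∀ z j, G z (e j) = (l j : ℂ) ^ (-Complex.I * z) • e j := fun z j =>
    e.constr_basis ℂ _ j
  have hGI : ∀ b, G Complex.I b = T b := by
    intro b
    have : G Complex.I = T.toLinearMap := e.ext fun j => by
      rw [hG]; simp [hTe]
    exact LinearMap.congr_fun this b
  have hG0 : ∀ b, G 0 b = b := by
    intro b
    have : G 0 = LinearMap.id := e.ext fun j => by rw [hG]; simp
    exact LinearMap.congr_fun this b
  have hGadd : ∀ y z b, G (y + z) b = G y (G z b) := by
    intro y z b
    have : G (y + z) = G y ∘ₗ G z := e.ext fun j => by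
      simp only [LinearMap.comp_apply, hG, map_smul, smul_smul]
      rw [mul_add, Complex.cpow_add _ _ (hl0 j), mul_comm]
    exact LinearMap.congr_fun this b
  have hGexp : ∀ b, IsFiniteExponentialType fun z => G z b := by
    intro b
    induction e.mem_span b using Submodule.span_induction with
    | mem x hx =>
      obtain ⟨j, rfl⟩ := hx
      simpa [hG] using isFiniteExponentialType_of_fintype (fun _ : Unit => e j)
        (fun _ z => (l j : ℂ) ^ (-Complex.I * z)) (fun _ => isExponentialType_cpow (hl j))
    | zero => simpa using IsFiniteExponentialType.zero
    | add x y _ _ hx hy => simpa using hx.add hy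
    | smul c x _ hx =>
      simp only [map_smul]
      exact hx.map (LinearMap.lsmul ℂ B c)
  have hGeig : ∀ (m : ℝ) (b : B), 0 < m → T b = (m : ℂ) • b → ∀ z,
      G z b = (m : ℂ) ^ (-Complex.I * z) • b := by
    intro m b hm hb z
    have := (hGexp b).eq_cpow_smul hm (fun z => by rw [hGadd, hGI, hb, map_smul]) z
    rwa [hG0] at this
  have hG1 : ∀ z, G z 1 = 1 := fun z => by
    simpa using hGeig 1 1 one_pos (by simp) z
  have hGmul : ∀ z x y, G z (x * y) = G z x * G z y := by
    intro z x y
    have : (LinearMap.mul ℂ B).compr₂ (G z) = (LinearMap.mul ℂ B).compl₁₂ (G z) (G z) := by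
      refine e.ext fun j => e.ext fun k => ?_
      have h1 : T (e j * e k) = ((l j * l k : ℝ) : ℂ) • (e j * e k) := by
        rw [map_mul, hTe, hTe, smul_mul_smul_comm]; push_cast; rfl
      simp only [LinearMap.compr₂_apply, LinearMap.mul_apply', LinearMap.compl₁₂_apply, hG]
      rw [hGeig _ _ (mul_pos (hl j) (hl k)) h1, smul_mul_smul_comm, Complex.ofReal_mul,
        Complex.mul_cpow_ofReal_nonneg (hl j).le (hl k).le]
    exact LinearMap.congr_fun₂ this x y
  have hGinv : ∀ z b, G z (G (-z) b) = b := fun z b => by rw [← hGadd, add_neg_cancel, hG0]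
  let β : ℂ → B ≃ₐ[ℂ] B := fun z =>
    AlgEquiv.ofAlgHom (AlgHom.ofLinearMap (G z) (hG1 z) (hGmul z))
      (AlgHom.ofLinearMap (G (-z)) (hG1 _) (hGmul _))
      (by ext b; exact hGinv z b) (by ext b; simpa using hGinv (-z) b)
  have hβ : ∀ z b, β z b = G z b := fun z b => rfl
  refine ⟨β, ⟨fun y z b => hGadd y z b, fun z b => ?_, hGexp⟩, hGI⟩
  rw [hβ, hβ]
  induction e.mem_span b using Submodule.span_induction with
  | zero =>
    have : inv 0 = 0 := by simpa using hsmul 0 0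
    simp [this]
  | add x y _ _ hx hy => simp [hadd, hx, hy]
  | smul c x _ hx => simp [hsmul, hx]
  | mem x hx =>
    obtain ⟨j, rfl⟩ := hx
    rw [hG, hsmul, hGeig _ _ (inv_pos.2 (hl j)) (hinv _ _ (hl j) (hTe j))]
    congr 1
    have harg : (l j : ℂ).arg ≠ Real.pi := by
      rw [Complex.arg_ofReal_of_nonneg (hl j).le]; exact Real.pi_ne_zero.symm
    have h1 := Complex.cpow_conj (l j : ℂ) (-Complex.I * z) harg
    simp only [Complex.conj_ofReal] at h1
    rw [← h1, Complex.ofReal_inv, Complex.inv_cpow _ _ harg, ← Complex.cpow_neg]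
    congr 1
    simp

end Group

/-! ### Slice maps -/

section Slice

variable {V W X Y : Type*} [AddCommGroup V] [Module ℂ V] [AddCommGroup W] [Module ℂ W]
  [AddCommGroup X] [Module ℂ X] [AddCommGroup Y] [Module ℂ Y]

/-- The slice map `φ ⊗ id : V ⊗ W → W`. -/
noncomputable def leftSlice (φ : V →ₗ[ℂ] ℂ) : V ⊗[ℂ] W →ₗ[ℂ] W :=
  (TensorProduct.lid ℂ W).toLinearMap ∘ₗ φ.rTensor W

/-- The slice map `id ⊗ χ : V ⊗ W → V`. -/
noncomputable def rightSlice (χ : W →ₗ[ℂ] ℂ) : V ⊗[ℂ] W →ₗ[ℂ] V :=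
  (TensorProduct.rid ℂ V).toLinearMap ∘ₗ χ.lTensor V

@[simp] theorem leftSlice_tmul (φ : V →ₗ[ℂ] ℂ) (v : V) (w : W) :
    leftSlice φ (v ⊗ₜ[ℂ] w) = φ v • w := by simp [leftSlice]

@[simp] theorem rightSlice_tmul (χ : W →ₗ[ℂ] ℂ) (v : V) (w : W) :
    rightSlice χ (v ⊗ₜ[ℂ] w) = χ w • v := by simp [rightSlice]

theorem apply_rightSlice (φ : V →ₗ[ℂ] ℂ) (χ : W →ₗ[ℂ] ℂ) (t : V ⊗[ℂ] W) :
    φ (rightSlice χ t) = χ (leftSlice φ t) := by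
  induction t using TensorProduct.induction_on with
  | zero => simp
  | tmul x y => simp [mul_comm]
  | add x y hx hy => simp [hx, hy]

theorem map_rightSlice (f : V →ₗ[ℂ] X) (χ : W →ₗ[ℂ] ℂ) (t : V ⊗[ℂ] W) :
    f (rightSlice χ t) = rightSlice χ (f.rTensor W t) := by
  induction t using TensorProduct.induction_on with
  | zero => simp
  | tmul x y => simp
  | add x y hx hy => simp [hx, hy]

theorem map_leftSlice (f : W →ₗ[ℂ] X) (φ : V →ₗ[ℂ] ℂ) (t : V ⊗[ℂ] W) :
    f (leftSlice φ t) = leftSlice φ (f.lTensor V t) := by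
  induction t using TensorProduct.induction_on with
  | zero => simp
  | tmul x y => simp
  | add x y hx hy => simp [hx, hy]

theorem rightSlice_lTensor (f : W →ₗ[ℂ] X) (χ : X →ₗ[ℂ] ℂ) (t : V ⊗[ℂ] W) :
    rightSlice χ (f.lTensor V t) = rightSlice (χ ∘ₗ f) t := by
  induction t using TensorProduct.induction_on with
  | zero => simp
  | tmul x y => simp
  | add x y hx hy => simp [hx, hy]

/-- Over a field the right slice maps separate the points of a tensor product. -/
theorem ext_rightSlice {s t : V ⊗[ℂ] W} (h : ∀ χ : W →ₗ[ℂ] ℂ, rightSlice χ s = rightSlice χ t) :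
    s = t := by
  classical
  let b := Module.Basis.ofVectorSpace ℂ W
  apply (TensorProduct.equivFinsuppOfBasisRight (M := V) b).injective
  ext i
  rw [TensorProduct.equivFinsuppOfBasisRight_apply, TensorProduct.equivFinsuppOfBasisRight_apply]
  exact h (b.coord i)

theorem finiteDimensional_span_rightSlice (t : V ⊗[ℂ] W) :
    FiniteDimensional ℂ (Submodule.span ℂ (Set.range fun χ : W →ₗ[ℂ] ℂ => rightSlice χ t)) := by
  have : ∃ S : Submodule ℂ V, FiniteDimensional ℂ S ∧ ∀ χ : W →ₗ[ℂ] ℂ, rightSlice χ t ∈ S := by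
    induction t using TensorProduct.induction_on with
    | zero => exact ⟨⊥, inferInstance, by simp⟩
    | tmul x y =>
      exact ⟨Submodule.span ℂ {x}, inferInstance, fun χ => by
        simpa using Submodule.smul_mem _ _ (Submodule.mem_span_singleton_self x)⟩
    | add x y hx hy =>
      obtain ⟨S, hS, hx⟩ := hx
      obtain ⟨S', hS', hy⟩ := hy
      exact ⟨S ⊔ S', inferInstance, fun χ => by
        rw [map_add]
        exact Submodule.add_mem_sup (hx χ) (hy χ)⟩
  obtain ⟨S, hS, h⟩ := this
  exact Submodule.finiteDimensional_of_le (S₂ := S)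
    (Submodule.span_le.2 (by rintro _ ⟨χ, rfl⟩; exact h χ))

end Slice

section SliceAlgebra

variable {A B : Type*} [Ring A] [Algebra ℂ A] [Ring B] [Algebra ℂ B]

theorem leftSlice_mul_tmul (φ : A →ₗ[ℂ] ℂ) (t : A ⊗[ℂ] B) (a : A) (b : B) :
    leftSlice φ (t * (a ⊗ₜ[ℂ] b)) = leftSlice φ (t * (a ⊗ₜ[ℂ] 1)) * b := by
  induction t using TensorProduct.induction_on with
  | zero => simp
  | tmul x y => simp
  | add x y hx hy => simp only [add_mul, map_add, hx, hy]

theorem apply_leftSlice_mul_tmul_one (φ : A →ₗ[ℂ] ℂ) (χ : B →ₗ[ℂ] ℂ) (t : A ⊗[ℂ] B) (a : A) :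
    χ (leftSlice φ (t * (a ⊗ₜ[ℂ] 1))) = φ (rightSlice χ t * a) := by
  induction t using TensorProduct.induction_on with
  | zero => simp
  | tmul x y => simp [mul_comm]
  | add x y hx hy => simp only [add_mul, map_add, hx, hy]

end SliceAlgebra

/-! ### Matrix corepresentations and right coideals -/

section Corep

variable {A : Type u} [Ring A] [HopfAlgebra ℂ A]

/-- A matrix corepresentation: `Δ (w i j) = ∑ r, w i r ⊗ w r j` and `ε (w i j) = δ i j`. -/
structure IsCorep {ι : Type*} [Fintype ι] [DecidableEq ι] (w : Matrix ι ι A) : Prop where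
  comul_apply : ∀ i j, Coalgebra.comul (R := ℂ) (w i j) = ∑ r, w i r ⊗ₜ[ℂ] w r j
  counit_apply : ∀ i j, Coalgebra.counit (R := ℂ) (w i j) = if i = j then 1 else 0

theorem IsCorep.antipode_mul {ι : Type*} [Fintype ι] [DecidableEq ι] {w : Matrix ι ι A}
    (hw : IsCorep w) : w.map (HopfAlgebra.antipode ℂ) * w = 1 := by
  ext i j
  have := HopfAlgebra.mul_antipode_rTensor_comul_apply (R := ℂ) (w i j)
  rw [hw.comul_apply, hw.counit_apply] at this
  simp only [map_sum, LinearMap.rTensor_tmul, LinearMap.mul'_apply] at this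
  rw [Matrix.mul_apply, Matrix.one_apply]
  simp only [Matrix.map_apply, this]
  split_ifs <;> simp

theorem IsCorep.mul_antipode {ι : Type*} [Fintype ι] [DecidableEq ι] {w : Matrix ι ι A}
    (hw : IsCorep w) : w * w.map (HopfAlgebra.antipode ℂ) = 1 := by
  ext i j
  have := HopfAlgebra.mul_antipode_lTensor_comul_apply (R := ℂ) (w i j)
  rw [hw.comul_apply, hw.counit_apply] at this
  simp only [map_sum, LinearMap.lTensor_tmul, LinearMap.mul'_apply] at this
  rw [Matrix.mul_apply, Matrix.one_apply]
  simp only [Matrix.map_apply, this]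
  split_ifs <;> simp

/-- A subspace `V` with `Δ V ⊆ V ⊗ A`, expressed through the slice maps. -/
def IsRightCoideal (V : Submodule ℂ A) : Prop :=
  ∀ (χ : A →ₗ[ℂ] ℂ), ∀ a ∈ V, rightSlice χ (Coalgebra.comul (R := ℂ) a) ∈ V

theorem rightSlice_counit (a : A) :
    rightSlice Coalgebra.counit (Coalgebra.comul (R := ℂ) a) = a := by
  simp [rightSlice]

theorem leftSlice_counit (a : A) :
    leftSlice Coalgebra.counit (Coalgebra.comul (R := ℂ) a) = a := by
  simp [leftSlice]

/-- The operators `(id ⊗ χ) Δ` form an algebra, by coassociativity. -/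
theorem rightSlice_comul_rightSlice_comul (χ ψ : A →ₗ[ℂ] ℂ) (a : A) :
    rightSlice χ (Coalgebra.comul (R := ℂ) (rightSlice ψ (Coalgebra.comul (R := ℂ) a))) =
      rightSlice (LinearMap.mul' ℂ ℂ ∘ₗ TensorProduct.map χ ψ ∘ₗ Coalgebra.comul)
        (Coalgebra.comul (R := ℂ) a) := by
  have key : ∀ s : (A ⊗[ℂ] A) ⊗[ℂ] A,
      rightSlice χ (rightSlice ψ s) =
        rightSlice (LinearMap.mul' ℂ ℂ ∘ₗ TensorProduct.map χ ψ)
          (TensorProduct.assoc ℂ A A A s) := by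
    intro s
    have : rightSlice χ ∘ₗ rightSlice ψ =
        rightSlice (LinearMap.mul' ℂ ℂ ∘ₗ TensorProduct.map χ ψ) ∘ₗ
          (TensorProduct.assoc ℂ A A A).toLinearMap := by
      ext x y z
      simp [smul_smul, mul_comm]
    exact LinearMap.congr_fun this s
  rw [map_rightSlice, key, Coalgebra.coassoc_apply, rightSlice_lTensor, LinearMap.comp_assoc]

/-- Every element `a` lies in a finite-dimensional right coideal, namely the space of all
`(id ⊗ χ) (Δ a)`. -/
theorem exists_isRightCoideal (a : A) :
    ∃ V : Submodule ℂ A, FiniteDimensional ℂ V ∧ IsRightCoideal V ∧ a ∈ V ∧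
      ∀ x ∈ V, ∃ χ : A →ₗ[ℂ] ℂ, x = rightSlice χ (Coalgebra.comul (R := ℂ) a) := by
  let L : (A →ₗ[ℂ] ℂ) →ₗ[ℂ] A :=
    { toFun := fun χ => rightSlice χ (Coalgebra.comul (R := ℂ) a)
      map_add' := fun χ ψ => by simp [rightSlice, LinearMap.lTensor_add]
      map_smul' := fun c χ => by simp [rightSlice, LinearMap.lTensor_smul] }
  refine ⟨LinearMap.range L, ?_, ?_, ⟨Coalgebra.counit, rightSlice_counit a⟩, ?_⟩
  · have := finiteDimensional_span_rightSlice (Coalgebra.comul (R := ℂ) a)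
    exact Submodule.finiteDimensional_of_le
      (S₂ := Submodule.span ℂ (Set.range fun χ : A →ₗ[ℂ] ℂ =>
        rightSlice χ (Coalgebra.comul (R := ℂ) a)))
      (by rintro _ ⟨χ, rfl⟩; exact Submodule.subset_span ⟨χ, rfl⟩)
  · rintro χ _ ⟨ψ, rfl⟩
    exact ⟨_, (rightSlice_comul_rightSlice_comul χ ψ a).symm⟩
  · rintro _ ⟨χ, rfl⟩
    exact ⟨χ, rfl⟩

/-- The comultiplication of a right coideal with basis `v`, on which the functionals `f` restrict
to the dual basis, is given by the matrix corepresentation `(f i ⊗ id) Δ (v j)`. -/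
theorem IsRightCoideal.exists_corep {V : Submodule ℂ A} (hV : IsRightCoideal V)
    {ι : Type*} [Fintype ι] [DecidableEq ι] (v : ι → A) (f : ι → A →ₗ[ℂ] ℂ) (hv : ∀ i, v i ∈ V)
    (hf : ∀ a ∈ V, a = ∑ i, f i a • v i) (hfv : ∀ i j, f i (v j) = if i = j then 1 else 0) :
    ∃ w : Matrix ι ι A, IsCorep w ∧
      ∀ j, Coalgebra.comul (R := ℂ) (v j) = ∑ i, v i ⊗ₜ[ℂ] w i j := by
  let w : Matrix ι ι A := fun i j => leftSlice (f i) (Coalgebra.comul (R := ℂ) (v j))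
  have hw : ∀ j, Coalgebra.comul (R := ℂ) (v j) = ∑ i, v i ⊗ₜ[ℂ] w i j := by
    intro j
    refine ext_rightSlice fun χ => ?_
    rw [hf _ (hV χ _ (hv j))]
    simp [w, apply_rightSlice]
  refine ⟨w, ⟨fun i j => ?_, fun i j => ?_⟩, hw⟩
  · have h1 : Coalgebra.comul (R := ℂ) (w i j) =
        leftSlice (f i) ((Coalgebra.comul (R := ℂ)).lTensor A (Coalgebra.comul (R := ℂ) (v j))) :=
      map_leftSlice _ _ _
    rw [h1, ← Coalgebra.coassoc_apply, hw j]
    simp [map_sum, LinearMap.rTensor_tmul, hw, TensorProduct.sum_tmul, hfv]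
  · have h1 := rightSlice_counit (v j)
    rw [hw j] at h1
    have h2 := congrArg (f i) h1
    simpa [hfv] using h2

theorem IsRightCoideal.exists_basis_corep {V : Submodule ℂ A} [FiniteDimensional ℂ V]
    (hV : IsRightCoideal V) : ∃ (n : ℕ) (v : Fin n → A) (w : Matrix (Fin n) (Fin n) A),
      IsCorep w ∧ (∀ j, Coalgebra.comul (R := ℂ) (v j) = ∑ i, v i ⊗ₜ[ℂ] w i j) ∧
      (∀ i, v i ∈ V) ∧ ∀ a ∈ V, ∃ c : Fin n → ℂ, a = ∑ i, c i • v i := by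
  let b := Module.finBasis ℂ V
  have hext : ∀ i, ∃ g : A →ₗ[ℂ] ℂ, g ∘ₗ V.subtype = b.coord i := fun i =>
    LinearMap.exists_extend _
  choose f hf using hext
  have hf' : ∀ i (x : V), f i x = b.repr x i := fun i x => LinearMap.congr_fun (hf i) x
  have hsum : ∀ a ∈ V, a = ∑ i, f i a • (b i : A) := by
    intro a ha
    have := congrArg Subtype.val (b.sum_repr ⟨a, ha⟩)
    simp only [Submodule.coe_sum, Submodule.coe_smul] at this
    rw [← this]
    refine Finset.sum_congr rfl fun i _ => ?_
    rw [this, ← hf' i ⟨a, ha⟩]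
  obtain ⟨w, hw, hv⟩ := hV.exists_corep (fun i => (b i : A)) f (fun i => (b i).2) hsum
    (fun i j => by rw [hf']; simp [Finsupp.single_apply, eq_comm])
  exact ⟨_, _, w, hw, hv, fun i => (b i).2, fun a ha => ⟨_, hsum a ha⟩⟩

theorem eq_sum_counit_smul {ι : Type*} [Fintype ι] {v : ι → A} {y : ι → A} {a : A}
    (h : Coalgebra.comul (R := ℂ) a = ∑ i, v i ⊗ₜ[ℂ] y i) :
    a = ∑ i, Coalgebra.counit (R := ℂ) (v i) • y i := by
  have := leftSlice_counit a
  rw [h] at this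
  simpa using this.symm

/-- The algebra is spanned by the entries of matrix corepresentations. -/
theorem span_corep_entries : Submodule.span ℂ {a : A | ∃ (n : ℕ) (w : Matrix (Fin n) (Fin n) A),
    IsCorep w ∧ ∃ i j, a = w i j} = ⊤ := by
  rw [eq_top_iff]
  rintro a -
  obtain ⟨V, hfd, hV, ha, -⟩ := exists_isRightCoideal a
  obtain ⟨n, v, w, hw, hv, -, hspan⟩ := hV.exists_basis_corep
  obtain ⟨c, rfl⟩ := hspan a ha
  refine Submodule.sum_mem _ fun j _ => Submodule.smul_mem _ _ ?_
  rw [eq_sum_counit_smul (hv j)]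
  exact Submodule.sum_mem _ fun i _ => Submodule.smul_mem _ _
    (Submodule.subset_span ⟨n, w, hw, i, j, rfl⟩)

end Corep

/-! ### The involution and the antipode -/

section Star

variable {A : Type u} [Ring A] [StarRing A] [HopfAlgebra ℂ A] [StarModule ℂ A]

/-- The functional `x ↦ conj (χ (x*))`. -/
def conjFunctional (χ : A →ₗ[ℂ] ℂ) : A →ₗ[ℂ] ℂ where
  toFun x := starRingEnd ℂ (χ (star x))
  map_add' x y := by simp
  map_smul' c x := by simp

theorem rightSlice_star (χ : A →ₗ[ℂ] ℂ) (t : A ⊗[ℂ] A) :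
    rightSlice χ (star t) = star (rightSlice (conjFunctional χ) t) := by
  induction t using TensorProduct.induction_on with
  | zero => simp
  | tmul x y => simp [conjFunctional]
  | add x y hx hy => simp [hx, hy]

variable [HopfStarAlgebra A]

theorem counit_star (a : A) :
    Coalgebra.counit (R := ℂ) (star a) = starRingEnd ℂ (Coalgebra.counit (R := ℂ) a) := by
  have h1 := rightSlice_counit (star a)
  rw [HopfStarAlgebra.comul_star, rightSlice_star, star_inj] at h1
  have h2 := congrArg (Coalgebra.counit (R := ℂ)) h1
  rw [apply_rightSlice, leftSlice_counit] at h2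
  rw [← h2]
  simp [conjFunctional]

theorem IsCorep.star {ι : Type*} [Fintype ι] [DecidableEq ι] {w : Matrix ι ι A}
    (hw : IsCorep w) : IsCorep (w.map star) where
  comul_apply i j := by
    simp only [Matrix.map_apply, HopfStarAlgebra.comul_star, hw.comul_apply, star_sum,
      TensorProduct.star_tmul]
  counit_apply i j := by
    simp only [Matrix.map_apply, counit_star, hw.counit_apply]
    split_ifs <;> simp

/-- The map `a ↦ S (a*)` is an involution: for a matrix corepresentation `w`, both `w` and
`S (S (w*)*)` are inverse to `S (w)`. -/
theorem antipode_star_antipode_star (a : A) :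
    HopfAlgebra.antipode ℂ (star (HopfAlgebra.antipode ℂ (star a))) = a := by
  let F : A →ₗ[ℂ] A :=
    { toFun := fun a => HopfAlgebra.antipode ℂ (star (HopfAlgebra.antipode ℂ (star a)))
      map_add' := fun x y => by simp
      map_smul' := fun c x => by simp }
  suffices F = LinearMap.id from LinearMap.congr_fun this a
  refine LinearMap.ext_on span_corep_entries ?_
  rintro _ ⟨n, w, hw, i, j, rfl⟩
  have h1 : w.map F * w.map (HopfAlgebra.antipode ℂ) = 1 := by
    ext i j
    have := congrFun (congrFun hw.star.antipode_mul i) j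
    have h2 := congrArg (fun x => HopfAlgebra.antipode ℂ (Star.star x)) this
    simp only [Matrix.mul_apply, Matrix.map_apply, star_sum, star_mul, star_star, map_sum,
      HopfAlgebra.antipode_mul_antidistrib] at h2
    simp only [Matrix.mul_apply, Matrix.map_apply]
    refine Eq.trans ?_ (h2.trans ?_)
    · rfl
    · rw [Matrix.one_apply]
      split_ifs <;> simp
  have h3 : w.map F = w := by
    calc w.map F = w.map F * (w.map (HopfAlgebra.antipode ℂ) * w) := by
          rw [hw.antipode_mul, Matrix.mul_one]
      _ = w := by rw [← Matrix.mul_assoc, h1, Matrix.one_mul]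
  exact congrFun (congrFun h3 i) j

theorem antipode_injective : Function.Injective (HopfAlgebra.antipode ℂ : A → A) := by
  have h : Function.LeftInverse (fun a : A => star (HopfAlgebra.antipode ℂ (star a)))
      (HopfAlgebra.antipode ℂ) := fun a => by
    have := antipode_star_antipode_star (star a)
    rw [star_star] at this
    show star _ = a
    rw [this, star_star]
  exact h.injective

end Star

/-! ### The inner product of the Haar integral -/

section Haar

variable {A : Type u} [Ring A] [StarRing A] [HopfAlgebra ℂ A] [StarModule ℂ A]

/-- A sesquilinear form `(x, y) ↦ h (x* f y)` that is positive on the diagonal is hermitian, by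
polarization. -/
theorem hermitian_of_nonneg (h : A →ₗ[ℂ] ℂ) (f : A →ₗ[ℂ] A)
    (hf : ∀ a, 0 ≤ h (star a * f a)) (x y : A) :
    starRingEnd ℂ (h (star x * f y)) = h (star y * f x) := by
  have im0 : ∀ a, (h (star a * f a)).im = 0 := fun a => ((Complex.nonneg_iff.1 (hf a)).2).symm
  have h1 := im0 (x + y)
  have h2 := im0 (x + Complex.I • y)
  simp only [star_add, map_add, add_mul, mul_add, star_smul, map_smul, smul_mul_assoc,
    mul_smul_comm, smul_eq_mul, Complex.add_im, im0, Complex.mul_im, Complex.mul_re,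
    RCLike.star_def, Complex.conj_I, Complex.neg_re, Complex.neg_im, Complex.I_re,
    Complex.I_im] at h1 h2
  apply Complex.ext
  · rw [Complex.conj_re]; linarith
  · rw [Complex.conj_im]; linarith

variable {h : A →ₗ[ℂ] ℂ}

namespace IsHaarIntegral

theorem star_mul_symm (hh : IsHaarIntegral h) (x y : A) :
    starRingEnd ℂ (h (star x * y)) = h (star y * x) :=
  hermitian_of_nonneg h LinearMap.id hh.nonneg x y

theorem map_star (hh : IsHaarIntegral h) (x : A) : h (star x) = starRingEnd ℂ (h x) := by
  have := hh.star_mul_symm 1 x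
  simpa using this.symm

theorem rightSlice_comul (hh : IsHaarIntegral h) (a : A) :
    rightSlice h (Coalgebra.comul (R := ℂ) a) = h a • (1 : A) := hh.left_invariant a

theorem leftSlice_comul (hh : IsHaarIntegral h) (a : A) :
    leftSlice h (Coalgebra.comul (R := ℂ) a) = h a • (1 : A) := hh.right_invariant a

/-- A functional `φ` with `(id ⊗ φ) Δ = φ(·) 1` is a multiple of the Haar integral. -/
theorem eq_of_rightSlice_comul (hh : IsHaarIntegral h) (φ : A →ₗ[ℂ] ℂ)
    (hφ : ∀ a, rightSlice φ (Coalgebra.comul (R := ℂ) a) = φ a • (1 : A)) (a : A) :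
    φ a = φ 1 * h a := by
  have h1 := congrArg h (hφ a)
  rw [apply_rightSlice, hh.leftSlice_comul] at h1
  simpa [hh.map_one, mul_comm] using h1.symm

/-- The Cauchy-Schwarz inequality in the degenerate case. -/
theorem apply_mul_eq_zero (hh : IsHaarIntegral h) {a : A} (ha : h (star a * a) = 0) (x : A) :
    h (x * a) = 0 := by
  let c : PreInnerProductSpace.Core ℂ A :=
    { inner := fun x y => h (star x * y)
      conj_inner_symm := fun x y => hh.star_mul_symm y x
      re_inner_nonneg := fun x => (Complex.nonneg_iff.1 (hh.nonneg x)).1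
      add_left := fun x y z => by simp [add_mul]
      smul_left := fun x y r => by simp }
  have := @InnerProductSpace.Core.inner_mul_inner_self_le ℂ A _ _ _ c (star x) a
  have h1 : ‖h (star (star x) * a)‖ * ‖h (star a * star x)‖ ≤
      RCLike.re (h (star (star x) * star x)) * RCLike.re (h (star a * a)) := this
  rw [ha, ← hh.star_mul_symm (star x) a, star_star, RCLike.norm_conj] at h1
  simp only [map_zero, mul_zero] at h1
  have h2 : ‖h (x * a)‖ = 0 := by nlinarith [norm_nonneg (h (x * a))]
  exact norm_eq_zero.1 h2

variable [HopfStarAlgebra A]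

/-- The strong right invariance of the Haar integral, `h(x c₁) S(c₂) = h(x₁ c) x₂`, for an element
`c` of a right coideal. -/
theorem sum_smul_antipode (hh : IsHaarIntegral h) {n : ℕ} {v : Fin n → A}
    {w : Matrix (Fin n) (Fin n) A} (hw : IsCorep w)
    (hv : ∀ j, Coalgebra.comul (R := ℂ) (v j) = ∑ i, v i ⊗ₜ[ℂ] w i j) (x : A) (j : Fin n) :
    ∑ i, h (x * v i) • HopfAlgebra.antipode ℂ (w i j) =
      leftSlice h (Coalgebra.comul (R := ℂ) x * (v j ⊗ₜ[ℂ] 1)) := by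
  have h1 : ∀ i, h (x * v i) • HopfAlgebra.antipode ℂ (w i j) =
      ∑ k, leftSlice h (Coalgebra.comul (R := ℂ) x * (v k ⊗ₜ[ℂ] 1)) *
        (w k i * HopfAlgebra.antipode ℂ (w i j)) := by
    intro i
    have := hh.leftSlice_comul (x * v i)
    rw [Bialgebra.comul_mul, hv, Finset.mul_sum, map_sum] at this
    rw [← one_mul (HopfAlgebra.antipode ℂ (w i j)), ← smul_mul_assoc, ← this, Finset.sum_mul]
    refine Finset.sum_congr rfl fun k _ => ?_
    rw [leftSlice_mul_tmul, one_mul, mul_assoc]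
  simp only [h1]
  rw [Finset.sum_comm]
  simp only [← Finset.mul_sum]
  have h2 : ∀ k, ∑ i, w k i * HopfAlgebra.antipode ℂ (w i j) = if k = j then 1 else 0 := by
    intro k
    have := congrFun (congrFun hw.mul_antipode k) j
    simpa [Matrix.mul_apply, Matrix.one_apply] using this
  simp [h2]

/-- If all `h(x' b)`, with `x'` in the right coideal generated by `x`, vanish, then so do all
`h(x b')`, with `b'` in the right coideal generated by `b`. -/
theorem apply_mul_rightSlice_eq_zero (hh : IsHaarIntegral h) {x b : A}
    (hx : ∀ χ : A →ₗ[ℂ] ℂ, h (rightSlice χ (Coalgebra.comul (R := ℂ) x) * b) = 0)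
    (χ : A →ₗ[ℂ] ℂ) : h (x * rightSlice χ (Coalgebra.comul (R := ℂ) b)) = 0 := by
  obtain ⟨V, hfd, hV, hb, -⟩ := exists_isRightCoideal b
  obtain ⟨n, v, w, hw, hv, -, hspan⟩ := hV.exists_basis_corep
  obtain ⟨c, rfl⟩ := hspan b hb
  have h1 : HopfAlgebra.antipode ℂ (∑ i, h (x * v i) • ∑ j, c j • w i j) = 0 := by
    have h2 : HopfAlgebra.antipode ℂ (∑ i, h (x * v i) • ∑ j, c j • w i j) =
        ∑ j, c j • ∑ i, h (x * v i) • HopfAlgebra.antipode ℂ (w i j) := by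
      simp only [map_sum, map_smul, Finset.smul_sum]
      rw [Finset.sum_comm]
      exact Finset.sum_congr rfl fun i _ => Finset.sum_congr rfl fun j _ => smul_comm _ _ _
    rw [h2]
    simp only [hh.sum_smul_antipode hw hv]
    rw [← Module.forall_dual_apply_eq_zero_iff ℂ]
    intro ψ
    rw [← hx ψ]
    simp only [map_sum, map_smul, apply_leftSlice_mul_tmul_one, Finset.mul_sum, mul_smul_comm]
  rw [map_eq_zero_iff _ antipode_injective] at h1
  have h3 := congrArg χ h1
  simp only [map_sum, map_smul, map_zero, hv, rightSlice_tmul, Finset.smul_sum, smul_eq_mul,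
    Finset.mul_sum, mul_smul_comm] at h3 ⊢
  rw [← h3, Finset.sum_comm]
  exact Finset.sum_congr rfl fun i _ => Finset.sum_congr rfl fun j _ => by ring

/-- The Haar integral is faithful. The left kernel of the inner product is a right coideal, and
`a = 0` as soon as `ε` vanishes on the right coideal generated by `a`; but `ε(a) 1` is a
combination of products of elements of this coideal with elements of `A`. -/
theorem eq_zero_of_apply_mul (hh : IsHaarIntegral h) {a : A} (ha : ∀ x, h (x * a) = 0) :
    a = 0 := by
  obtain ⟨V, hfd, hV, haV, hgen⟩ := exists_isRightCoideal a
  have hVN : ∀ b ∈ V, ∀ x, h (x * b) = 0 := by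
    intro b hb x
    obtain ⟨χ, rfl⟩ := hgen b hb
    exact hh.apply_mul_rightSlice_eq_zero (fun _ => ha _) χ
  obtain ⟨n, v, w, hw, hv, hvV, hspan⟩ := hV.exists_basis_corep
  have hcounit : ∀ j, Coalgebra.counit (R := ℂ) (v j) = 0 := by
    intro j
    have h1 := HopfAlgebra.mul_antipode_lTensor_comul_apply (R := ℂ) (star (v j))
    rw [HopfStarAlgebra.comul_star, hv] at h1
    simp only [star_sum, TensorProduct.star_tmul, map_sum, LinearMap.lTensor_tmul,
      LinearMap.mul'_apply] at h1
    have h2 := congrArg h h1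
    rw [map_sum, Finset.sum_eq_zero, counit_star, Algebra.algebraMap_eq_smul_one, map_smul,
      hh.map_one] at h2
    · simpa using h2.symm
    · intro i _
      have := hh.star_mul_symm (HopfAlgebra.antipode ℂ (star (w i j))) (v i)
      rw [hVN _ (hvV i), map_zero] at this
      exact this.symm
  have hv0 : ∀ j, v j = 0 := fun j => by
    rw [eq_sum_counit_smul (hv j)]
    simp [hcounit]
  obtain ⟨c, rfl⟩ := hspan a haV
  simp [hv0]

theorem eq_zero_of_star_mul_self (hh : IsHaarIntegral h) {a : A} (ha : h (star a * a) = 0) :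
    a = 0 :=
  hh.eq_zero_of_apply_mul (hh.apply_mul_eq_zero ha)

theorem eq_zero_of_mul_apply (hh : IsHaarIntegral h) {a : A} (ha : ∀ x, h (a * x) = 0) :
    a = 0 := by
  have : star a = 0 := hh.eq_zero_of_apply_mul fun x => by
    have := hh.map_star (a * star x)
    rw [star_mul, star_star, ha, map_zero] at this
    exact this
  simpa using this

/-- The inner product `⟪x, y⟫ = h (x* y)`. -/
@[reducible]
def innerCore (hh : IsHaarIntegral h) : InnerProductSpace.Core ℂ A where
  inner x y := h (star x * y)
  conj_inner_symm x y := hh.star_mul_symm y x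
  re_inner_nonneg x := (Complex.nonneg_iff.1 (hh.nonneg x)).1
  add_left x y z := by simp [add_mul]
  smul_left x y r := by simp
  definite _ hx := hh.eq_zero_of_star_mul_self hx

end IsHaarIntegral

end Haar

/-! ### Unitary representations -/

section UnitaryRep

variable {A : Type u} [Ring A] [StarRing A] [HopfAlgebra ℂ A]

/-- The linear span of the entries of a matrix. -/
def coeffSpace {n : ℕ} (U : Matrix (Fin n) (Fin n) A) : Submodule ℂ A :=
  Submodule.span ℂ (Set.range fun p : Fin n × Fin n => U p.1 p.2)

theorem mem_coeffSpace {n : ℕ} (U : Matrix (Fin n) (Fin n) A) (i j : Fin n) :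
    U i j ∈ coeffSpace U := Submodule.subset_span ⟨(i, j), rfl⟩

theorem coeffSpace_le {n : ℕ} {U : Matrix (Fin n) (Fin n) A} {S : Submodule ℂ A}
    (h : ∀ i j, U i j ∈ S) : coeffSpace U ≤ S :=
  Submodule.span_le.2 (by rintro _ ⟨p, rfl⟩; exact h _ _)

instance {n : ℕ} (U : Matrix (Fin n) (Fin n) A) : FiniteDimensional ℂ (coeffSpace U) :=
  FiniteDimensional.span_of_finite ℂ (Set.finite_range _)

/-- The matrix over the algebra `B` with the scalar entries of `M`. -/
def scalarMatrix (B : Type*) [Ring B] [Algebra ℂ B] {n : ℕ} (M : Matrix (Fin n) (Fin n) ℂ) :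
    Matrix (Fin n) (Fin n) B := M.map (algebraMap ℂ B)

section Scalar

variable {B B' : Type*} [Ring B] [Algebra ℂ B] [Ring B'] [Algebra ℂ B'] {n : ℕ}

theorem scalarMatrix_mul (M M' : Matrix (Fin n) (Fin n) ℂ) :
    scalarMatrix B (M * M') = scalarMatrix B M * scalarMatrix B M' :=
  Matrix.map_mul

theorem scalarMatrix_one : scalarMatrix B (1 : Matrix (Fin n) (Fin n) ℂ) = 1 := by
  simp [scalarMatrix]

theorem scalarMatrix_mul_mul_map (φ : B →ₗ[ℂ] B') (M M' : Matrix (Fin n) (Fin n) ℂ)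
    (X : Matrix (Fin n) (Fin n) B) :
    (scalarMatrix B M * X * scalarMatrix B M').map φ =
      scalarMatrix B' M * X.map φ * scalarMatrix B' M' := by
  ext i j
  simp only [Matrix.mul_apply, scalarMatrix, Matrix.map_apply, map_sum,
    ← Algebra.commutes (M' _ j), ← Algebra.smul_def, map_smul]

theorem star_scalarMatrix [StarRing B] [StarModule ℂ B] (M : Matrix (Fin n) (Fin n) ℂ) :
    star (scalarMatrix B M) = scalarMatrix B (star M) := by
  ext i j
  exact (algebraMap_star_comm (M j i)).symm

end Scalar

/-- `Δ U = (U ⊗ 1) (1 ⊗ U)` as matrices over `A ⊗ A`. -/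
theorem comul_matrix_iff {n : ℕ} (U : Matrix (Fin n) (Fin n) A) :
    (∀ j k, Coalgebra.comul (R := ℂ) (U j k) = ∑ r, U j r ⊗ₜ[ℂ] U r k) ↔
      U.map (Coalgebra.comul (R := ℂ)) =
        U.map (Algebra.TensorProduct.includeLeft (R := ℂ) (S := ℂ) (A := A) (B := A)).toLinearMap *
        U.map (Algebra.TensorProduct.includeRight (R := ℂ) (A := A) (B := A)).toLinearMap := by
  simp [← Matrix.ext_iff, Matrix.mul_apply]

variable [StarModule ℂ A]

theorem IsUnitaryRep.conj {n : ℕ} {U : Matrix (Fin n) (Fin n) A} (hU : IsUnitaryRep U)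
    {W : Matrix (Fin n) (Fin n) ℂ} (hW : W ∈ unitary (Matrix (Fin n) (Fin n) ℂ)) :
    IsUnitaryRep (scalarMatrix A (star W) * U * scalarMatrix A W) where
  comul_apply := by
    rw [comul_matrix_iff, scalarMatrix_mul_mul_map, scalarMatrix_mul_mul_map,
      scalarMatrix_mul_mul_map, (comul_matrix_iff U).1 hU.comul_apply]
    have := congrArg (scalarMatrix (A ⊗[ℂ] A)) (Unitary.mul_star_self_of_mem hW)
    rw [scalarMatrix_mul, scalarMatrix_one] at this
    simp only [Matrix.mul_assoc]
    rw [← Matrix.mul_assoc (scalarMatrix _ W) (scalarMatrix _ (star W)), this, Matrix.one_mul]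
  mem_unitary := by
    have h1 : scalarMatrix A W ∈ unitary (Matrix (Fin n) (Fin n) A) := by
      rw [Unitary.mem_iff, star_scalarMatrix, ← scalarMatrix_mul, ← scalarMatrix_mul,
        Unitary.star_mul_self_of_mem hW, Unitary.mul_star_self_of_mem hW]
      exact ⟨scalarMatrix_one, scalarMatrix_one⟩
    rw [← star_scalarMatrix]
    exact mul_mem (mul_mem (Unitary.star_mem h1) hU.mem_unitary) h1

theorem coeffSpace_conj_le {n : ℕ} (U : Matrix (Fin n) (Fin n) A)
    (M M' : Matrix (Fin n) (Fin n) ℂ) :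
    coeffSpace (scalarMatrix A M * U * scalarMatrix A M') ≤ coeffSpace U := by
  refine coeffSpace_le fun i j => ?_
  simp only [Matrix.mul_apply, scalarMatrix, Matrix.map_apply,
    ← Algebra.commutes (M' _ j), ← Algebra.smul_def]
  exact Submodule.sum_mem _ fun a _ => Submodule.smul_mem _ _ (Submodule.sum_mem _ fun b _ =>
    Submodule.smul_mem _ _ (mem_coeffSpace U _ _))

theorem coeffSpace_conj {n : ℕ} (U : Matrix (Fin n) (Fin n) A)
    {M M' N N' : Matrix (Fin n) (Fin n) ℂ} (h : N * M = 1) (h' : M' * N' = 1) :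
    coeffSpace (scalarMatrix A M * U * scalarMatrix A M') = coeffSpace U := by
  refine le_antisymm (coeffSpace_conj_le _ _ _) ?_
  have := coeffSpace_conj_le (scalarMatrix A M * U * scalarMatrix A M') N N'
  refine le_trans (le_of_eq ?_) this
  congr 1
  simp only [← Matrix.mul_assoc]
  rw [← scalarMatrix_mul, h, scalarMatrix_one, Matrix.one_mul, Matrix.mul_assoc,
    ← scalarMatrix_mul, h', scalarMatrix_one, Matrix.mul_one]

theorem IsUnitaryRep.isCorep {n : ℕ} {U : Matrix (Fin n) (Fin n) A} (hU : IsUnitaryRep U) :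
    IsCorep U where
  comul_apply := hU.comul_apply
  counit_apply := by
    have h1 : U * scalarMatrix A (U.map (Coalgebra.counit (R := ℂ))) = U := by
      ext i j
      have := rightSlice_counit (U i j)
      rw [hU.comul_apply] at this
      simp only [map_sum, rightSlice_tmul] at this
      simpa [Matrix.mul_apply, scalarMatrix, ← Algebra.commutes, ← Algebra.smul_def] using this
    have h2 : scalarMatrix A (U.map (Coalgebra.counit (R := ℂ))) = 1 := by
      have := congrArg (fun X => star U * X) h1
      simpa only [← Matrix.mul_assoc, Unitary.star_mul_self_of_mem hU.mem_unitary,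
        Matrix.one_mul] using this
    intro i j
    have h3 := congrArg (Coalgebra.counit (R := ℂ)) (congrFun (congrFun h2 i) j)
    simp only [scalarMatrix, Matrix.map_apply, Bialgebra.counit_algebraMap, Matrix.one_apply] at h3
    rw [h3]
    split_ifs <;> simp

theorem IsUnitaryRep.antipode_apply {n : ℕ} {U : Matrix (Fin n) (Fin n) A} (hU : IsUnitaryRep U)
    (i j : Fin n) : HopfAlgebra.antipode ℂ (U i j) = star (U j i) := by
  have h : U.map (HopfAlgebra.antipode ℂ) = star U :=
    left_inv_eq_right_inv hU.isCorep.antipode_mul (Unitary.mul_star_self_of_mem hU.mem_unitary)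
  exact congrFun (congrFun h i) j

theorem IsUnitaryRep.sum_mul_star {n : ℕ} {U : Matrix (Fin n) (Fin n) A} (hU : IsUnitaryRep U)
    (i j : Fin n) : ∑ r, U i r * star (U j r) = if i = j then 1 else 0 := by
  have h1 := (Unitary.mem_iff.1 hU.mem_unitary).2
  have := congrFun (congrFun h1 i) j
  simpa [Matrix.mul_apply, Matrix.star_apply, Matrix.one_apply] using this

variable [HopfStarAlgebra A] {h : A →ₗ[ℂ] ℂ}

theorem IsHaarIntegral.exists_orthonormalBasis (hh : IsHaarIntegral h) (V : Submodule ℂ A)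
    [FiniteDimensional ℂ V] : ∃ (n : ℕ) (v : Fin n → A), (∀ i, v i ∈ V) ∧
      (∀ i j, h (star (v i) * v j) = if i = j then 1 else 0) ∧
      ∀ a ∈ V, a = ∑ i, h (star (v i) * a) • v i := by
  let _ : NormedAddCommGroup A := hh.innerCore.toNormedAddCommGroup
  let _ : InnerProductSpace ℂ A := InnerProductSpace.ofCore hh.innerCore.toCore
  let b := stdOrthonormalBasis ℂ V
  refine ⟨_, fun i => b i, fun i => (b i).2, fun i j => ?_, fun a ha => ?_⟩
  · exact orthonormal_iff_ite.1 b.orthonormal i j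
  · have := congrArg Subtype.val (b.sum_repr' ⟨a, ha⟩)
    simp only [Submodule.coe_sum, Submodule.coe_smul] at this
    exact this.symm

/-- An orthonormal basis `v` of a finite-dimensional right coideal gives a unitary representation,
by invariance of the Haar integral. -/
theorem IsRightCoideal.exists_unitaryRep (hh : IsHaarIntegral h) {V : Submodule ℂ A}
    (hV : IsRightCoideal V) {n : ℕ} {v : Fin n → A} (hv : ∀ i, v i ∈ V)
    (hon : ∀ i j, h (star (v i) * v j) = if i = j then 1 else 0)
    (hspan : ∀ a ∈ V, a = ∑ i, h (star (v i) * a) • v i) :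
    ∃ U : Matrix (Fin n) (Fin n) A, IsUnitaryRep U ∧
      ∀ j, Coalgebra.comul (R := ℂ) (v j) = ∑ i, v i ⊗ₜ[ℂ] U i j := by
  obtain ⟨U, hU, hvU⟩ := hV.exists_corep v (fun i => h ∘ₗ LinearMap.mulLeft ℂ (star (v i)))
    hv hspan hon
  refine ⟨U, ⟨hU.comul_apply, ?_⟩, hvU⟩
  have h1 : star U * U = 1 := by
    ext k j
    have := hh.leftSlice_comul (star (v k) * v j)
    rw [Bialgebra.comul_mul, HopfStarAlgebra.comul_star, hvU, hvU] at this
    simp only [star_sum, TensorProduct.star_tmul, Finset.sum_mul, Finset.mul_sum,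
      Algebra.TensorProduct.tmul_mul_tmul, map_sum, leftSlice_tmul, hon] at this
    simp only [ite_smul, one_smul, zero_smul, Finset.sum_ite_eq',
      Finset.mem_univ, if_true] at this
    rw [Matrix.mul_apply, Matrix.one_apply]
    simpa [Matrix.star_apply] using this
  have h2 : star U = U.map (HopfAlgebra.antipode ℂ) :=
    left_inv_eq_right_inv h1 hU.mul_antipode
  exact Unitary.mem_iff.2 ⟨h1, by rw [h2, hU.mul_antipode]⟩

/-- The unitary representation on a minimal right coideal is irreducible. -/
theorem isIrreducibleUnitaryRep_of_minimal {V : Submodule ℂ A} (hV0 : V ≠ ⊥)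
    (hmin : ∀ V' : Submodule ℂ A, IsRightCoideal V' → V' ≤ V → V' = ⊥ ∨ V' = V)
    {n : ℕ} {v : Fin n → A} (hv : ∀ i, v i ∈ V)
    (hon : ∀ i j, h (star (v i) * v j) = if i = j then 1 else 0)
    (hspan : ∀ a ∈ V, a = ∑ i, h (star (v i) * a) • v i)
    {U : Matrix (Fin n) (Fin n) A} (hU : IsUnitaryRep U)
    (hvU : ∀ j, Coalgebra.comul (R := ℂ) (v j) = ∑ i, v i ⊗ₜ[ℂ] U i j) :
    IsIrreducibleUnitaryRep U := by
  refine ⟨hU, ?_, fun W hW => ?_⟩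
  · rcases Nat.eq_zero_or_pos n with rfl | hn
    · exact absurd ((Submodule.eq_bot_iff _).2 fun a ha => by rw [hspan a ha]; simp) hV0
    · exact hn
  · let L : (Fin n → ℂ) →ₗ[ℂ] A := Fintype.linearCombination ℂ v
    have hL : ∀ c, L c = ∑ i, c i • v i := fun c => rfl
    have hLV : ∀ c, L c ∈ V := fun c => by
      rw [hL]
      exact Submodule.sum_mem _ fun i _ => Submodule.smul_mem _ _ (hv i)
    have hLc : ∀ c i, h (star (v i) * L c) = c i := by
      intro c i
      simp [hL, Finset.mul_sum, hon]
    have hLinj : Function.Injective L := fun c c' hc => by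
      funext i
      rw [← hLc c i, hc, hLc]
    have hco : IsRightCoideal (W.map L) := by
      rintro χ _ ⟨c, hc, rfl⟩
      refine ⟨_, hW χ c hc, ?_⟩
      simp only [hL, map_sum, map_smul, hvU, rightSlice_tmul, Matrix.mulVec, dotProduct,
        Matrix.map_apply, Finset.sum_smul, Finset.smul_sum, smul_smul]
      rw [Finset.sum_comm]
      exact Finset.sum_congr rfl fun i _ => Finset.sum_congr rfl fun j _ => by rw [mul_comm]
    have hle : W.map L ≤ V := by
      rintro _ ⟨c, -, rfl⟩
      exact hLV c
    rcases hmin _ hco hle with h0 | h1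
    · left
      rw [Submodule.eq_bot_iff] at h0 ⊢
      exact fun c hc => hLinj ((h0 _ ⟨c, hc, rfl⟩).trans (map_zero L).symm)
    · right
      rw [eq_top_iff]
      rintro c -
      have : L c ∈ W.map L := by
        rw [h1]
        exact hLV c
      obtain ⟨c', hc', h'⟩ := this
      rwa [← hLinj h']

/-- The orthogonal complement of a right coideal in a right coideal is a right coideal. -/
theorem IsRightCoideal.orthogonal (hh : IsHaarIntegral h) {V V' : Submodule ℂ A}
    (hV : IsRightCoideal V) (hV' : IsRightCoideal V') :
    ∃ V'' : Submodule ℂ A, IsRightCoideal V'' ∧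
      ∀ b, b ∈ V'' ↔ b ∈ V ∧ ∀ a ∈ V', h (star a * b) = 0 := by
  refine ⟨V ⊓ ⨅ a ∈ V', LinearMap.ker (h ∘ₗ LinearMap.mulLeft ℂ (star a)), ?_, ?_⟩
  · rintro χ b ⟨hbV, hb⟩
    refine ⟨hV χ b hbV, ?_⟩
    simp only [SetLike.mem_coe, Submodule.mem_iInf, LinearMap.mem_ker, LinearMap.comp_apply,
      LinearMap.mulLeft_apply] at hb ⊢
    intro a ha
    refine hh.apply_mul_rightSlice_eq_zero (fun ψ => ?_) χ
    rw [HopfStarAlgebra.comul_star, rightSlice_star]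
    exact hb _ (hV' _ a ha)
  · intro b
    simp

/-- Every finite-dimensional right coideal is an orthogonal sum of minimal ones, so that it is
spanned by entries of irreducible unitary representations. -/
theorem IsRightCoideal.le_span_irreducible (hh : IsHaarIntegral h) (d : ℕ) :
    ∀ (V : Submodule ℂ A) [FiniteDimensional ℂ V], IsRightCoideal V → Module.finrank ℂ V = d →
      V ≤ Submodule.span ℂ {a | ∃ (n : ℕ) (U : Matrix (Fin n) (Fin n) A),
        IsIrreducibleUnitaryRep U ∧ ∃ i j, a = U i j} := by
  induction d using Nat.strong_induction_on with
  | _ d ih =>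
    intro V hfd hV hd
    by_cases hV0 : V = ⊥
    · rw [hV0]; exact bot_le
    by_cases hmin : ∀ V' : Submodule ℂ A, IsRightCoideal V' → V' ≤ V → V' = ⊥ ∨ V' = V
    · obtain ⟨n, v, hv, hon, hspan⟩ := hh.exists_orthonormalBasis V
      obtain ⟨U, hU, hvU⟩ := hV.exists_unitaryRep hh hv hon hspan
      have hirr := isIrreducibleUnitaryRep_of_minimal hV0 hmin hv hon hspan hU hvU
      intro a ha
      rw [hspan a ha]
      refine Submodule.sum_mem _ fun j _ => Submodule.smul_mem _ _ ?_
      rw [eq_sum_counit_smul (hvU j)]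
      exact Submodule.sum_mem _ fun i _ => Submodule.smul_mem _ _
        (Submodule.subset_span ⟨n, U, hirr, i, j, rfl⟩)
    · push Not at hmin
      obtain ⟨V', hV', hle, hne, hne'⟩ := hmin
      have : FiniteDimensional ℂ V' := Submodule.finiteDimensional_of_le hle
      obtain ⟨V'', hV'', hmem⟩ := hV.orthogonal hh hV'
      have hle'' : V'' ≤ V := fun b hb => ((hmem b).1 hb).1
      have : FiniteDimensional ℂ V'' := Submodule.finiteDimensional_of_le hle''
      have hlt : V'' < V := by
        refine lt_of_le_of_ne hle'' fun heq => hne ((Submodule.eq_bot_iff _).2 fun a ha => ?_)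
        exact hh.eq_zero_of_star_mul_self (((hmem a).1 (heq ▸ hle ha)).2 a ha)
      have h1 := ih _ (hd ▸ Submodule.finrank_lt_finrank_of_lt (lt_of_le_of_ne hle hne')) V' hV' rfl
      have h2 := ih _ (hd ▸ Submodule.finrank_lt_finrank_of_lt hlt) V'' hV'' rfl
      intro x hx
      obtain ⟨n, v, hv, hon, hspan⟩ := hh.exists_orthonormalBasis V'
      set p := ∑ i, h (star (v i) * x) • v i with hp
      have hpV : p ∈ V' := Submodule.sum_mem _ fun i _ => Submodule.smul_mem _ _ (hv i)
      have hq : x - p ∈ V'' := by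
        refine (hmem _).2 ⟨Submodule.sub_mem _ hx (hle hpV), fun a ha => ?_⟩
        have hvq : ∀ i, h (star (v i) * (x - p)) = 0 := by
          intro i
          rw [mul_sub, map_sub, sub_eq_zero, hp]
          simp [Finset.mul_sum, hon]
        rw [hspan a ha]
        simp [Finset.sum_mul, hvq]
      have : x = p + (x - p) := by abel
      rw [this]
      exact Submodule.add_mem _ (h1 hpV) (h2 hq)

/-- The algebra is spanned by the entries of irreducible unitary representations. -/
theorem IsHaarIntegral.span_irreducible (hh : IsHaarIntegral h) :
    Submodule.span ℂ {a : A | ∃ (n : ℕ) (U : Matrix (Fin n) (Fin n) A),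
      IsIrreducibleUnitaryRep U ∧ ∃ i j, a = U i j} = ⊤ := by
  rw [eq_top_iff]
  rintro a -
  obtain ⟨V, hfd, hV, ha, -⟩ := exists_isRightCoideal a
  exact hV.le_span_irreducible hh _ V rfl ha

/-- Schur's lemma: the coefficient spaces of two irreducible unitary representations are equal or
orthogonal. If they are not orthogonal, then the Haar integral supplies a nonzero intertwiner,
which is invertible by irreducibility. -/
theorem IsIrreducibleUnitaryRep.coeffSpace_eq_or_orthogonal (hh : IsHaarIntegral h) {n m : ℕ}
    {U : Matrix (Fin n) (Fin n) A} {V : Matrix (Fin m) (Fin m) A}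
    (hU : IsIrreducibleUnitaryRep U) (hV : IsIrreducibleUnitaryRep V) :
    coeffSpace U = coeffSpace V ∨
      ∀ a ∈ coeffSpace U, ∀ b ∈ coeffSpace V, h (star b * a) = 0 := by
  by_cases hz : ∀ k l i j, h (star (V k l) * U i j) = 0
  · right
    intro a ha b hb
    induction ha using Submodule.span_induction with
    | zero => simp
    | add x y _ _ hx hy => simp [mul_add, hx, hy]
    | smul c x _ hx => simp [hx]
    | mem x hx =>
      obtain ⟨⟨i, j⟩, rfl⟩ := hx
      induction hb using Submodule.span_induction with
      | zero => simp
      | add x y _ _ hx hy => simp [add_mul, hx, hy]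
      | smul c x _ hx => simp [hx]
      | mem x hx =>
        obtain ⟨⟨k, l⟩, rfl⟩ := hx
        exact hz k l i j
  · left
    push Not at hz
    obtain ⟨k, l₀, i, j₀, hne⟩ := hz
    let T : Matrix (Fin m) (Fin n) ℂ := fun r s => h (star (V k r) * U i s)
    have hT0 : T ≠ 0 := fun h0 => hne (congrFun (congrFun h0 l₀) j₀)
    have h1 : ∀ l j, T l j • (1 : A) = ∑ r, ∑ s, T r s • (star (V r l) * U s j) := by
      intro l j
      have := hh.leftSlice_comul (star (V k l) * U i j)
      rw [Bialgebra.comul_mul, HopfStarAlgebra.comul_star, hV.comul_apply, hU.comul_apply] at this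
      simp only [star_sum, TensorProduct.star_tmul, Finset.sum_mul, Finset.mul_sum,
        Algebra.TensorProduct.tmul_mul_tmul, map_sum, leftSlice_tmul] at this
      rw [← this, Finset.sum_comm]
    have h2 : ∀ r j, ∑ l, T l j • V r l = ∑ s, T r s • U s j := by
      intro r j
      calc ∑ l, T l j • V r l = ∑ l, V r l * (T l j • 1) := by simp
        _ = ∑ l, ∑ r', ∑ s, T r' s • (V r l * star (V r' l) * U s j) := by
          simp only [h1, Finset.mul_sum, mul_smul_comm, mul_assoc]
        _ = ∑ r', ∑ s, T r' s • ((∑ l, V r l * star (V r' l)) * U s j) := by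
          rw [Finset.sum_comm]
          refine Finset.sum_congr rfl fun r' _ => ?_
          rw [Finset.sum_comm]
          simp only [Finset.sum_mul, Finset.smul_sum]
        _ = ∑ s, T r s • U s j := by
          simp [hV.sum_mul_star]
    have h3 : ∀ χ : A →ₗ[ℂ] ℂ, V.map χ * T = T * U.map χ := by
      intro χ
      ext r j
      have := congrArg χ (h2 r j)
      simpa [Matrix.mul_apply, mul_comm] using this
    have hker : LinearMap.ker T.mulVecLin = ⊥ := by
      refine (hU.eq_bot_or_eq_top _ fun χ w hw => ?_).resolve_right fun htop => hT0 ?_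
      · simp only [LinearMap.mem_ker, Matrix.mulVecLin_apply] at hw ⊢
        rw [Matrix.mulVec_mulVec, ← h3, ← Matrix.mulVec_mulVec, hw, Matrix.mulVec_zero]
      · rw [LinearMap.ker_eq_top] at htop
        ext r j
        simpa using congrFun (LinearMap.congr_fun htop (Pi.single j 1)) r
    have hran : LinearMap.range T.mulVecLin = ⊤ := by
      refine (hV.eq_bot_or_eq_top _ ?_).resolve_left fun hbot => hT0 ?_
      · rintro χ _ ⟨w, rfl⟩
        refine ⟨(U.map χ).mulVec w, ?_⟩
        simp only [Matrix.mulVecLin_apply, Matrix.mulVec_mulVec, h3]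
      · rw [LinearMap.range_eq_bot] at hbot
        ext r j
        simpa using congrFun (LinearMap.congr_fun hbot (Pi.single j 1)) r
    let e := LinearEquiv.ofBijective T.mulVecLin
      ⟨LinearMap.ker_eq_bot.1 hker, LinearMap.range_eq_top.1 hran⟩
    have hnm : n = m := by simpa using e.finrank_eq
    subst hnm
    have hunit : IsUnit T := by
      rw [← Matrix.mulVec_injective_iff_isUnit]
      exact LinearMap.ker_eq_bot.1 hker
    obtain ⟨T', hT'⟩ := hunit
    rw [← hT'] at h2
    have h4 : V * scalarMatrix A (T' : Matrix _ _ ℂ) = scalarMatrix A T' * U := by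
      ext r j
      have := h2 r j
      simpa only [Matrix.mul_apply, scalarMatrix, Matrix.map_apply, ← Algebra.commutes,
        ← Algebra.smul_def] using this
    have h5 :
        scalarMatrix A (T'⁻¹ : (Matrix (Fin n) (Fin n) ℂ)ˣ).1 * V * scalarMatrix A T' = U := by
      rw [Matrix.mul_assoc, h4, ← Matrix.mul_assoc, ← scalarMatrix_mul, Units.inv_mul,
        scalarMatrix_one, Matrix.one_mul]
    rw [← h5]
    exact coeffSpace_conj V (Units.mul_inv T') (Units.mul_inv T')

end UnitaryRep

/-! ### Diagonal unitary representations and the square of the antipode -/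

section Diagonal

variable {A : Type u} [Ring A] [StarRing A] [HopfAlgebra ℂ A]

/-- A unitary representation `U` together with positive numbers `q` such that
`Uᵀ Q Ū = Q` for `Q = diag q`: the contragredient representation is unitary for the inner product
given by `Q`, and `Q` is diagonal in the standard basis. -/
structure IsDiagonalRep {n : ℕ} (U : Matrix (Fin n) (Fin n) A) (q : Fin n → ℝ) : Prop
    extends IsUnitaryRep U where
  pos : ∀ i, 0 < q i
  sum_smul_mul_star : ∀ k l, ∑ r, (q r : ℂ) • (U r k * star (U r l)) =
    if k = l then (q k : ℂ) • (1 : A) else 0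

variable [StarModule ℂ A] [HopfStarAlgebra A] {h : A →ₗ[ℂ] ℂ}

/-- The relation `Uᵀ P Ū = P` for the matrix `P k l = ∑ i, h (U i k * (U i l)*)`, a consequence of
the invariance of the Haar integral. -/
theorem IsUnitaryRep.sum_haar_smul (hh : IsHaarIntegral h) {n : ℕ}
    {U : Matrix (Fin n) (Fin n) A} (hU : IsUnitaryRep U) (k l : Fin n) :
    ∑ r, ∑ s, h (∑ i, U i r * star (U i s)) • (U r k * star (U s l)) =
      h (∑ i, U i k * star (U i l)) • (1 : A) := by
  rw [← hh.leftSlice_comul]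
  simp only [map_sum, Bialgebra.comul_mul, HopfStarAlgebra.comul_star, hU.comul_apply, star_sum,
    TensorProduct.star_tmul, Finset.sum_mul, Finset.mul_sum,
    Algebra.TensorProduct.tmul_mul_tmul, leftSlice_tmul, Finset.sum_smul]
  rw [Finset.sum_comm' (t' := Finset.univ) (s' := fun _ => Finset.univ) (by simp)]
  rw [Finset.sum_comm]
  refine (Finset.sum_congr rfl fun r _ => Finset.sum_comm).trans ?_
  rw [Finset.sum_comm]
  refine Finset.sum_congr rfl fun i _ => ?_
  rw [Finset.sum_comm]

/-- Every unitary representation is unitarily equivalent to a diagonal one. The spectral theorem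
diagonalizes the matrix `∑ i, h (U i k * (U i l)*)`, which is hermitian, and its eigenvalues
`∑ i, h (U i k * (U i k)*)` are positive because `h` is faithful. -/
theorem IsUnitaryRep.exists_isDiagonalRep (hh : IsHaarIntegral h) {n : ℕ}
    {U : Matrix (Fin n) (Fin n) A} (hU : IsUnitaryRep U) :
    ∃ (U' : Matrix (Fin n) (Fin n) A) (q : Fin n → ℝ), IsDiagonalRep U' q ∧
      coeffSpace U' = coeffSpace U := by
  let op : A →ₗ[ℂ] Aᵐᵒᵖ := (MulOpposite.opLinearEquiv ℂ).toLinearMap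
  let hop : Aᵐᵒᵖ →ₗ[ℂ] ℂ := h ∘ₗ (MulOpposite.opLinearEquiv ℂ).symm.toLinearMap
  -- Over the opposite algebra the matrix of interest is `star U * U`, so that it transforms
  -- like an operator under a unitary change of basis.
  let P : Matrix (Fin n) (Fin n) A → Matrix (Fin n) (Fin n) ℂ := fun X =>
    (star (X.map op) * X.map op).map hop
  have hP : ∀ X l k, P X l k = h (∑ i, X i k * star (X i l)) := by
    intro X l k
    simp [P, op, hop, Matrix.mul_apply, Matrix.star_apply]
  have hherm : (P U).IsHermitian := by
    ext l k
    rw [Matrix.conjTranspose_apply, hP, hP, RCLike.star_def, ← hh.map_star]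
    simp
  let W := hherm.eigenvectorUnitary
  have hW : (W : Matrix (Fin n) (Fin n) ℂ) ∈ unitary (Matrix (Fin n) (Fin n) ℂ) := W.2
  let U' := scalarMatrix A (star (W : Matrix (Fin n) (Fin n) ℂ)) * U *
    scalarMatrix A (W : Matrix (Fin n) (Fin n) ℂ)
  have hU' : IsUnitaryRep U' := hU.conj hW
  have hPU' : P U' = star (W : Matrix (Fin n) (Fin n) ℂ) * P U * W := by
    have h1 : U'.map op = scalarMatrix _ (star (W : Matrix (Fin n) (Fin n) ℂ)) * U.map op *
      scalarMatrix _ (W : Matrix (Fin n) (Fin n) ℂ) := scalarMatrix_mul_mul_map op _ _ _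
    have h2 : star (U'.map op) * U'.map op =
        scalarMatrix _ (star (W : Matrix (Fin n) (Fin n) ℂ)) * (star (U.map op) * U.map op) *
          scalarMatrix _ (W : Matrix (Fin n) (Fin n) ℂ) := by
      have h3 := congrArg (scalarMatrix Aᵐᵒᵖ) (Unitary.mul_star_self_of_mem hW)
      rw [scalarMatrix_mul, scalarMatrix_one] at h3
      rw [h1, star_mul, star_mul, star_scalarMatrix, star_scalarMatrix, star_star]
      simp only [Matrix.mul_assoc]
      rw [← Matrix.mul_assoc (scalarMatrix _ (W : Matrix (Fin n) (Fin n) ℂ)) (scalarMatrix _ _),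
        h3, Matrix.one_mul]
    have h4 : ∀ M : Matrix (Fin n) (Fin n) ℂ, scalarMatrix ℂ M = M := fun M => by
      ext i j; simp [scalarMatrix]
    simp only [P, h2, scalarMatrix_mul_mul_map, h4]
  have hdiag : P U' = Matrix.diagonal (fun i => (hherm.eigenvalues i : ℂ)) := by
    have h1 := hherm.spectral_theorem
    rw [Unitary.conjStarAlgAut_apply] at h1
    rw [hPU']
    conv_lhs => rw [h1]
    have h2 : star (W : Matrix (Fin n) (Fin n) ℂ) * (W : Matrix (Fin n) (Fin n) ℂ) = 1 :=
      (Unitary.mem_iff.1 hW).1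
    simp only [Matrix.mul_assoc]
    rw [show star (hherm.eigenvectorUnitary : Matrix (Fin n) (Fin n) ℂ) *
        (W : Matrix (Fin n) (Fin n) ℂ) = 1 from h2, Matrix.mul_one, ← Matrix.mul_assoc,
      show star (W : Matrix (Fin n) (Fin n) ℂ) * (hherm.eigenvectorUnitary : Matrix _ _ ℂ) = 1
      from h2, Matrix.one_mul]
    rfl
  have hentry : ∀ k l, h (∑ i, U' i k * star (U' i l)) =
      if k = l then (hherm.eigenvalues k : ℂ) else 0 := by
    intro k l
    rw [← hP, hdiag, Matrix.diagonal_apply]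
    by_cases hkl : k = l
    · subst hkl; simp
    · rw [if_neg hkl, if_neg (Ne.symm hkl)]
  refine ⟨U', hherm.eigenvalues, ⟨hU', fun k => ?_, fun k l => ?_⟩, ?_⟩
  · have h1 := hentry k k
    rw [if_pos rfl, map_sum] at h1
    have h2 : ∀ i, 0 ≤ h (U' i k * star (U' i k)) := fun i => by
      simpa using hh.nonneg (star (U' i k))
    have h3 : (0 : ℂ) < ∑ i, h (U' i k * star (U' i k)) := by
      refine Finset.sum_pos' (fun i _ => h2 i) ⟨k, Finset.mem_univ _, lt_of_le_of_ne (h2 k) ?_⟩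
      intro h0
      have h4 : star (U' k k) = 0 := hh.eq_zero_of_star_mul_self (by simpa using h0.symm)
      have h5 := hU'.isCorep.counit_apply k k
      rw [star_eq_zero.1 h4] at h5
      simp at h5
    rw [h1] at h3
    exact_mod_cast h3
  · have := hU'.sum_haar_smul hh k l
    simp only [hentry, ite_smul, zero_smul, Finset.sum_ite_eq, Finset.mem_univ, if_true] at this
    exact this
  · exact coeffSpace_conj U (Unitary.mul_star_self_of_mem hW) (Unitary.mul_star_self_of_mem hW)

namespace IsDiagonalRep

variable {n : ℕ} {U : Matrix (Fin n) (Fin n) A} {q : Fin n → ℝ}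

theorem ne_zero (hU : IsDiagonalRep U q) (i : Fin n) : (q i : ℂ) ≠ 0 := by
  exact_mod_cast (hU.pos i).ne'

/-- The antipode of the conjugate representation `Ū` is `Q⁻¹ Uᵀ Q`, since both are inverses
of `Ū`. -/
theorem antipode_star (hU : IsDiagonalRep U q) (i j : Fin n) :
    HopfAlgebra.antipode ℂ (star (U i j)) = ((q i : ℂ)⁻¹ * q j) • U j i := by
  let Z : Matrix (Fin n) (Fin n) A := Matrix.of fun i j => ((q i : ℂ)⁻¹ * q j) • U j i
  have h1 : Z * U.map star = 1 := by
    ext i j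
    have h2 := congrArg (fun x => (q i : ℂ)⁻¹ • x) (hU.sum_smul_mul_star i j)
    simp only [Finset.smul_sum, smul_smul] at h2
    simp only [Matrix.mul_apply, Z, Matrix.of_apply, Matrix.map_apply, smul_mul_assoc, h2,
      Matrix.one_apply]
    split_ifs
    · rw [smul_smul, inv_mul_cancel₀ (hU.ne_zero i), one_smul]
    · simp
  have h2 : Z = (U.map star).map (HopfAlgebra.antipode ℂ) :=
    left_inv_eq_right_inv h1 hU.isCorep.star.mul_antipode
  exact (congrFun (congrFun h2 i) j).symm

theorem antipode_antipode (hU : IsDiagonalRep U q) (i j : Fin n) :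
    HopfAlgebra.antipode ℂ (HopfAlgebra.antipode ℂ (U i j)) =
      ((q i * (q j)⁻¹ : ℝ) : ℂ) • U i j := by
  rw [hU.antipode_apply, hU.antipode_star]
  push_cast
  rw [mul_comm]

/-- The relation `Ū Q⁻¹ Uᵀ = Q⁻¹`. -/
theorem sum_inv_smul_star_mul (hU : IsDiagonalRep U q) (i j : Fin n) :
    ∑ r, (q r : ℂ)⁻¹ • (star (U i r) * U j r) = if i = j then (q i : ℂ)⁻¹ • (1 : A) else 0 := by
  have h1 := congrFun (congrFun hU.isCorep.star.mul_antipode i) j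
  simp only [Matrix.mul_apply, Matrix.map_apply, hU.antipode_star, Matrix.one_apply,
    mul_smul_comm] at h1
  have h2 := congrArg (fun x => (q j : ℂ)⁻¹ • x) h1
  simp only [Finset.smul_sum, smul_smul] at h2
  rw [smul_ite, smul_zero] at h2
  calc _ = ∑ r, ((q j : ℂ)⁻¹ * ((q r : ℂ)⁻¹ * q j)) • (star (U i r) * U j r) := by
        refine Finset.sum_congr rfl fun r _ => ?_
        congr 1
        field_simp [hU.ne_zero j]
    _ = _ := by
        rw [h2]
        split_ifs with hij
        · rw [hij]
        · rfl

end IsDiagonalRep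

theorem IsHaarIntegral.span_diagonal (hh : IsHaarIntegral h) :
    Submodule.span ℂ {a : A | ∃ (n : ℕ) (U : Matrix (Fin n) (Fin n) A) (q : Fin n → ℝ),
      IsDiagonalRep U q ∧ ∃ i j, a = U i j} = ⊤ := by
  rw [eq_top_iff, ← hh.span_irreducible, Submodule.span_le]
  rintro _ ⟨n, U, hU, i, j, rfl⟩
  obtain ⟨U', q, hU', hspan⟩ := hU.toIsUnitaryRep.exists_isDiagonalRep hh
  have : U i j ∈ coeffSpace U' := hspan ▸ mem_coeffSpace U i j
  exact coeffSpace_le (S := Submodule.span ℂ {a : A | ∃ (n : ℕ) (U : Matrix (Fin n) (Fin n) A)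
    (q : Fin n → ℝ), IsDiagonalRep U q ∧ ∃ i j, a = U i j})
    (fun i j => Submodule.subset_span ⟨n, U', q, hU', i, j, rfl⟩) this

/-! ### The scaling group -/

/-- The square of the antipode, as an algebra endomorphism. -/
noncomputable def antipodeSq (A : Type u) [Ring A] [HopfAlgebra ℂ A] : A →ₐ[ℂ] A :=
  AlgHom.ofLinearMap (HopfAlgebra.antipode ℂ ∘ₗ HopfAlgebra.antipode ℂ) (by simp)
    (fun a b => by simp [HopfAlgebra.antipode_mul_antidistrib])

theorem antipodeSq_apply (a : A) :
    antipodeSq A a = HopfAlgebra.antipode ℂ (HopfAlgebra.antipode ℂ a) := rfl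

theorem IsHaarIntegral.positiveEigenspan_antipodeSq (hh : IsHaarIntegral h) :
    positiveEigenspan (antipodeSq A) = ⊤ := by
  rw [eq_top_iff, ← hh.span_diagonal]
  refine Submodule.span_mono ?_
  rintro _ ⟨n, U, q, hU, i, j, rfl⟩
  exact ⟨_, mul_pos (hU.pos i) (inv_pos.2 (hU.pos j)), hU.antipode_antipode i j⟩

theorem antipode_star_antipode (a : A) :
    HopfAlgebra.antipode ℂ (star (HopfAlgebra.antipode ℂ a)) = star a := by
  have := antipode_star_antipode_star (star a)
  rwa [star_star] at this

theorem antipodeSq_star_antipodeSq (a : A) :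
    antipodeSq A (star (antipodeSq A a)) = star a := by
  rw [antipodeSq_apply, antipodeSq_apply, antipode_star_antipode, antipode_star_antipode]

/-- If `z ↦ γ z` is the exponential one-parameter group with `γ_i = κ²`, then `z ↦ γ (-z)` is the
scaling group. -/
theorem IsHaarIntegral.exists_isScalingGroup (hh : IsHaarIntegral h) :
    ∃ τ : ℂ → A ≃ₐ[ℂ] A, IsScalingGroup τ := by
  obtain ⟨γ, hγ, hI⟩ := exists_isExponentialOneParameterGroup (inv := (star : A → A))
    (antipodeSq A) hh.positiveEigenspan_antipodeSq star_add
    (fun c x => by simp) (fun l b hl hb => by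
      have h1 := antipodeSq_star_antipodeSq b
      have hl0 : (l : ℂ) ≠ 0 := by exact_mod_cast hl.ne'
      rw [hb, star_smul, map_smul, RCLike.star_def, Complex.conj_ofReal] at h1
      rw [← h1, smul_smul, Complex.ofReal_inv, inv_mul_cancel₀ hl0, one_smul, h1])
  refine ⟨fun z => γ (-z), ⟨⟨fun y z b => ?_, fun z b => ?_, fun b => ?_⟩, fun a => ?_⟩⟩
  · rw [neg_add, hγ.map_add]
  · rw [hγ.map_inv, map_neg]
  · obtain ⟨n, w, g, hg, hw⟩ := hγ.finiteExponentialType b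
    refine ⟨n, w, fun j z => g j (-z), fun j => ?_, fun z => hw (-z)⟩
    obtain ⟨hd, M, r, hM, hr, hb⟩ := hg j
    exact ⟨hd.comp differentiable_neg, M, r, hM, hr, fun z => by simpa using hb (-z)⟩
  · rw [← antipodeSq_apply, ← hI, ← hγ.map_add, add_neg_cancel, hγ.map_zero]

theorem IsScalingGroup.apply_I_of_antipodeSq {τ : ℂ → A ≃ₐ[ℂ] A} (hτ : IsScalingGroup τ) {a : A}
    {l : ℝ} (hl : 0 < l) (ha : antipodeSq A a = (l : ℂ) • a) :
    τ Complex.I a = ((l⁻¹ : ℝ) : ℂ) • a := by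
  have hl0 : (l : ℂ) ≠ 0 := by exact_mod_cast hl.ne'
  have hinj : Function.Injective (antipodeSq A) := antipode_injective.comp antipode_injective
  apply hinj
  rw [map_smul, ha, smul_smul, Complex.ofReal_inv, inv_mul_cancel₀ hl0, one_smul]
  exact hτ.antipode_antipode a

theorem IsScalingGroup.positiveEigenspan_eq_top (hh : IsHaarIntegral h) {τ : ℂ → A ≃ₐ[ℂ] A}
    (hτ : IsScalingGroup τ) : positiveEigenspan (τ Complex.I) = ⊤ := by
  rw [eq_top_iff, ← hh.positiveEigenspan_antipodeSq]
  refine Submodule.span_mono ?_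
  rintro a ⟨l, hl, ha⟩
  exact ⟨l⁻¹, inv_pos.2 hl, hτ.apply_I_of_antipodeSq hl ha⟩

theorem IsScalingGroup.eq (hh : IsHaarIntegral h) {τ τ' : ℂ → A ≃ₐ[ℂ] A}
    (hτ : IsScalingGroup τ) (hτ' : IsScalingGroup τ') : τ = τ' := by
  have hinj : Function.Injective (antipodeSq A) := antipode_injective.comp antipode_injective
  refine hτ.toIsExponentialOneParameterGroup.eq_of_apply_I hτ'.toIsExponentialOneParameterGroup
    (fun b => hinj ?_) (hτ.positiveEigenspan_eq_top hh)
  exact (hτ.antipode_antipode b).trans (hτ'.antipode_antipode b).symm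

theorem IsScalingGroup.apply_I_diagonal {τ : ℂ → A ≃ₐ[ℂ] A} (hτ : IsScalingGroup τ) {n : ℕ}
    {U : Matrix (Fin n) (Fin n) A} {q : Fin n → ℝ} (hU : IsDiagonalRep U q) (i j : Fin n) :
    τ Complex.I (U i j) = ((q i : ℂ)⁻¹ * q j) • U i j := by
  rw [hτ.apply_I_of_antipodeSq (mul_pos (hU.pos i) (inv_pos.2 (hU.pos j)))
    (hU.antipode_antipode i j)]
  push_cast
  rw [mul_inv, inv_inv]

/-! ### The modular automorphism of the Haar integral -/

/-- The functional `b ↦ ∑ r, q r ^ 2 h (U r i* b U r j)` is left invariant. In matrix notation,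
put `X s t = (id ⊗ h) ((1 ⊗ U s i*) Δ b (1 ⊗ U t j))` and `Y r r' = h (U r i* b U r' j)`. The
invariance of `h` says `Y = Ū X Uᵀ`, so that `Q X Q = Uᵀ Q Y Q Ū`, and the sum of the diagonal
entries of this matrix is that of `Q Y Q`, as `U` is unitary. -/
theorem IsDiagonalRep.sum_sq_mul_haar (hh : IsHaarIntegral h) {n : ℕ}
    {U : Matrix (Fin n) (Fin n) A} {q : Fin n → ℝ} (hU : IsDiagonalRep U q) (i j : Fin n) (b : A) :
    ∑ r, (q r : ℂ) ^ 2 * h (star (U r i) * b * U r j) =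
      (∑ r, (q r : ℂ) ^ 2 * h (star (U r i) * U r j)) * h b := by
  let g : Fin n → Fin n → A →ₗ[ℂ] ℂ := fun s t =>
    h ∘ₗ LinearMap.mulRight ℂ (U t j) ∘ₗ LinearMap.mulLeft ℂ (star (U s i))
  have hg : ∀ s t x, g s t x = h (star (U s i) * x * U t j) := fun s t x => rfl
  let φ : A →ₗ[ℂ] ℂ := ∑ r, (q r : ℂ) ^ 2 • g r r
  have hφ : ∀ x, φ x = ∑ r, (q r : ℂ) ^ 2 * h (star (U r i) * x * U r j) := by
    intro x
    simp [φ, hg]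
  suffices hinv : ∀ a, rightSlice φ (Coalgebra.comul (R := ℂ) a) = φ a • (1 : A) by
    have := hh.eq_of_rightSlice_comul φ hinv b
    rw [hφ, hφ] at this
    simpa using this
  intro a
  let X : Fin n → Fin n → A := fun s t => rightSlice (g s t) (Coalgebra.comul (R := ℂ) a)
  have hslice : ∀ (x y : A) (s t : Fin n) (T : A ⊗[ℂ] A),
      rightSlice h ((x ⊗ₜ[ℂ] star (U s i)) * T * (y ⊗ₜ[ℂ] U t j)) =
        x * rightSlice (g s t) T * y := by
    intro x y s t T
    induction T using TensorProduct.induction_on with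
    | zero => simp
    | tmul c d => simp [hg]
    | add c d hc hd => simp only [mul_add, add_mul, map_add, hc, hd]
  have hY : ∀ r r', g r r' a • (1 : A) = ∑ s, ∑ t, star (U r s) * X s t * U r' t := by
    intro r r'
    rw [hg, ← hh.rightSlice_comul, Bialgebra.comul_mul, Bialgebra.comul_mul,
      HopfStarAlgebra.comul_star, hU.comul_apply, hU.comul_apply]
    simp only [star_sum, TensorProduct.star_tmul, Finset.sum_mul, Finset.mul_sum, map_sum, hslice]
    rw [Finset.sum_comm]
  have hX : ∀ s t, ((q s : ℂ) * q t) • X s t =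
      ∑ r, ∑ r', ((q r : ℂ) * q r' * g r r' a) • (U r s * star (U r' t)) := by
    intro s t
    symm
    calc ∑ r, ∑ r', ((q r : ℂ) * q r' * g r r' a) • (U r s * star (U r' t))
        = ∑ r, ∑ r', ((q r : ℂ) • U r s) * (g r r' a • (1 : A)) * ((q r' : ℂ) • star (U r' t)) := by
          refine Finset.sum_congr rfl fun r _ => Finset.sum_congr rfl fun r' _ => ?_
          simp only [smul_mul_assoc, mul_smul_comm, mul_one, smul_smul]
          congr 1
          ring
      _ = ∑ r, ∑ r', ∑ c, ∑ d, ((q r : ℂ) • (U r s * star (U r c))) * X c d *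
            ((q r' : ℂ) • (U r' d * star (U r' t))) := by
          simp only [hY, Finset.mul_sum, Finset.sum_mul, Finset.smul_sum, smul_mul_assoc,
            mul_smul_comm, mul_assoc]
      _ = ∑ c, ∑ d, (∑ r, (q r : ℂ) • (U r s * star (U r c))) * X c d *
            (∑ r', (q r' : ℂ) • (U r' d * star (U r' t))) := by
          simp only [Finset.sum_mul, Finset.mul_sum]
          refine (Finset.sum_congr rfl fun r _ => Finset.sum_comm).trans ?_
          rw [Finset.sum_comm]
          refine Finset.sum_congr rfl fun c _ => ?_
          refine (Finset.sum_congr rfl fun r _ => Finset.sum_comm).trans ?_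
          rw [Finset.sum_comm]
          refine Finset.sum_congr rfl fun d _ => ?_
          rw [Finset.sum_comm]
      _ = ((q s : ℂ) * q t) • X s t := by
          simp only [hU.sum_smul_mul_star, ite_mul, mul_ite, zero_mul, mul_zero,
            Finset.sum_ite_eq, Finset.sum_ite_eq', Finset.mem_univ, if_true]
          rw [smul_mul_assoc, one_mul, mul_smul_comm, mul_one, smul_smul, mul_comm]
  have hsl : rightSlice φ (Coalgebra.comul (R := ℂ) a) = ∑ s, ((q s : ℂ) * q s) • X s s := by
    have : ∀ T : A ⊗[ℂ] A, rightSlice φ T = ∑ s, ((q s : ℂ) * q s) • rightSlice (g s s) T := by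
      intro T
      induction T using TensorProduct.induction_on with
      | zero => simp
      | tmul c d => simp [φ, Finset.sum_smul, smul_smul, sq]
      | add c d hc hd => simp only [map_add, hc, hd, smul_add, Finset.sum_add_distrib]
    exact this _
  rw [hsl]
  simp only [hX]
  rw [Finset.sum_comm]
  have h1 : ∀ r, ∑ s, ∑ r', ((q r : ℂ) * q r' * g r r' a) • (U r s * star (U r' s)) =
      ((q r : ℂ) ^ 2 * g r r a) • (1 : A) := by
    intro r
    rw [Finset.sum_comm]
    simp only [← Finset.smul_sum, hU.sum_mul_star, smul_ite, smul_zero, Finset.sum_ite_eq,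
      Finset.mem_univ, if_true, sq]
  simp only [h1, ← Finset.sum_smul]
  simp [φ]

/-- On the entries of a diagonal representation the modular automorphism acts, up to the factors
`q k⁻¹`, by a scalar matrix on the right. -/
theorem IsDiagonalRep.exists_modular (hh : IsHaarIntegral h) {n : ℕ}
    {U : Matrix (Fin n) (Fin n) A} {q : Fin n → ℝ} (hU : IsDiagonalRep U q) :
    ∃ m : Matrix (Fin n) (Fin n) ℂ, ∀ (k j : Fin n) (b : A),
      h (b * U k j) = h ((∑ i, ((q k : ℂ)⁻¹ * m i j) • U k i) * b) := by
  refine ⟨fun i j => (q i : ℂ)⁻¹ * ∑ r, (q r : ℂ) ^ 2 * h (star (U r i) * U r j), fun k j b => ?_⟩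
  have h1 : ∑ i, ∑ r, (q r : ℂ) ^ 2 * h (star (U r i) * ((q i : ℂ)⁻¹ • (U k i * b)) * U r j) =
      (q k : ℂ) * h (b * U k j) := by
    rw [Finset.sum_comm]
    have : ∀ r, ∑ i, (q r : ℂ) ^ 2 * h (star (U r i) * ((q i : ℂ)⁻¹ • (U k i * b)) * U r j) =
        if r = k then (q k : ℂ) * h (b * U k j) else 0 := by
      intro r
      have h2 : ∑ i, star (U r i) * ((q i : ℂ)⁻¹ • (U k i * b)) * U r j =
          (∑ i, (q i : ℂ)⁻¹ • (star (U r i) * U k i)) * (b * U r j) := by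
        simp only [Finset.sum_mul, smul_mul_assoc, mul_smul_comm, mul_assoc]
      rw [← Finset.mul_sum, ← map_sum, h2, hU.sum_inv_smul_star_mul]
      split_ifs with hrk
      · subst hrk
        rw [smul_mul_assoc, one_mul, map_smul, smul_eq_mul, ← mul_assoc]
        congr 1
        field_simp [hU.ne_zero r]
      · simp
    rw [Finset.sum_congr rfl fun r _ => this r]
    simp
  have h3 : h (b * U k j) = (q k : ℂ)⁻¹ * ((q k : ℂ) * h (b * U k j)) := by
    rw [inv_mul_cancel_left₀ (hU.ne_zero k)]
  rw [h3, ← h1]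
  simp only [hU.sum_sq_mul_haar hh, Finset.sum_mul, map_sum, smul_mul_assoc, map_smul, smul_eq_mul,
    Finset.mul_sum]
  refine Finset.sum_congr rfl fun i _ => ?_
  refine Finset.sum_congr rfl fun r _ => ?_
  ring

/-- Existence of the modular map of the Haar integral: a linear surjection `s` of `A` with
`h (b a) = h (s(a) b)`. -/
theorem IsHaarIntegral.exists_modular (hh : IsHaarIntegral h) :
    ∃ s : A →ₗ[ℂ] A, Function.Surjective s ∧ ∀ a b, h (b * a) = h (s a * b) := by
  have huniq : ∀ c c' : A, (∀ b, h (c * b) = h (c' * b)) → c = c' := fun c c' hc =>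
    sub_eq_zero.1 (hh.eq_zero_of_mul_apply fun x => by rw [sub_mul, map_sub, hc, sub_self])
  have hex : ∀ a : A, ∃ c, ∀ b, h (b * a) = h (c * b) := by
    intro a
    have ha : a ∈ (⊤ : Submodule ℂ A) := trivial
    rw [← hh.span_diagonal] at ha
    induction ha using Submodule.span_induction with
    | zero => exact ⟨0, by simp⟩
    | add x y _ _ hx hy =>
      obtain ⟨c, hc⟩ := hx
      obtain ⟨d, hd⟩ := hy
      exact ⟨c + d, fun b => by rw [mul_add, map_add, hc, hd, add_mul, map_add]⟩
    | smul r x _ hx =>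
      obtain ⟨c, hc⟩ := hx
      exact ⟨r • c, fun b => by rw [mul_smul_comm, map_smul, hc, smul_mul_assoc, map_smul]⟩
    | mem x hx =>
      obtain ⟨n, U, q, hU, k, j, rfl⟩ := hx
      obtain ⟨m, hm⟩ := hU.exists_modular hh
      exact ⟨_, hm k j⟩
  choose s hs using hex
  let S : A →ₗ[ℂ] A :=
    { toFun := s
      map_add' := fun x y => huniq _ _ fun b => by
        rw [← hs, add_mul, map_add, ← hs, ← hs, mul_add, map_add]
      map_smul' := fun r x => huniq _ _ fun b => by
        rw [← hs, RingHom.id_apply, smul_mul_assoc, map_smul, ← hs, mul_smul_comm, map_smul] }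
  refine ⟨S, fun a => ⟨star (s (star a)), ?_⟩, hs⟩
  refine huniq _ _ fun b => ?_
  have h1 := hs (star a) (star b)
  rw [← star_mul, hh.map_star] at h1
  have h2 : h (s (star a) * star b) = starRingEnd ℂ (h (b * star (s (star a)))) := by
    rw [← hh.map_star, star_mul, star_star]
  rw [h2] at h1
  exact (hs _ b).symm.trans ((starRingEnd ℂ).injective h1).symm

end Diagonal

/-! ### Graded structure of a differential calculus -/

theorem neg_one_pow_mul_eq_smul {Ω : Type*} [Ring Ω] [Algebra ℂ Ω] (k : ℕ) (x : Ω) :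
    (-1 : Ω) ^ k * x = ((-1 : ℂ) ^ k) • x := by
  rcases neg_one_pow_eq_or ℂ k with h | h <;> rcases Nat.even_or_odd k with hk | hk <;>
    simp [hk.neg_one_pow]

namespace StarDifferentialCalculus

section Grading

variable {A : Type u} {Ω : Type v} [Ring A] [StarRing A] [HopfAlgebra ℂ A] [Ring Ω] [Algebra ℂ Ω]
  (C : StarDifferentialCalculus A Ω)

theorem ι_mem (a : A) : C.ι a ∈ C.grading 0 := by
  rw [← C.range_ι]
  exact ⟨a, rfl⟩

theorem homogeneous_induction {p : Ω → Prop} (hadd : ∀ x y, p x → p y → p (x + y))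
    (hom : ∀ k, ∀ ω ∈ C.grading k, p ω) (ω : Ω) : p ω := by
  have hω : ω ∈ ⨆ k, C.grading k := by
    rw [C.isInternal.submodule_iSup_eq_top]
    trivial
  exact Submodule.iSup_induction _ (motive := p) hω hom (hom 0 0 (Submodule.zero_mem _)) hadd

theorem component_of_mem {k : ℕ} {ω : Ω} (hω : ω ∈ C.grading k) (l : ℕ) :
    C.component l ω = if k = l then ω else 0 := by
  have h1 : (LinearEquiv.ofBijective (DirectSum.coeLinearMap C.grading) C.isInternal).symm ω =
      DirectSum.lof ℂ ℕ (fun j => C.grading j) k ⟨ω, hω⟩ := by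
    rw [LinearEquiv.symm_apply_eq]
    exact (DirectSum.coeLinearMap_lof C.grading k ⟨ω, hω⟩).symm
  simp only [component, LinearMap.comp_apply, LinearEquiv.coe_coe, h1]
  split_ifs with hkl
  · subst hkl
    rw [DirectSum.component.lof_self]
    rfl
  · rw [DirectSum.component.of, dif_neg hkl]
    rfl

theorem component_mem (k : ℕ) (ω : Ω) : C.component k ω ∈ C.grading k := by
  simp only [component, LinearMap.comp_apply]
  exact Subtype.prop _

theorem eq_zero_of_component (ω : Ω) (h : ∀ k, C.component k ω = 0) : ω = 0 := by
  set e := LinearEquiv.ofBijective (DirectSum.coeLinearMap C.grading) C.isInternal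
  have h1 : e.symm ω = 0 := by
    refine DirectSum.ext_component ℂ fun k => ?_
    rw [map_zero]
    exact Subtype.ext (h k)
  simpa using h1

/-- Every family of subspaces that contains `A` in degree zero and is compatible with products and
with the differential contains the graded pieces of `Ω`, as `Ω` is generated by `A` and `d A`. -/
theorem grading_le (M : ℕ → Submodule ℂ Ω) (hι : ∀ a, C.ι a ∈ M 0)
    (hmul : ∀ {k l x y}, x ∈ M k → y ∈ M l → x * y ∈ M (k + l))
    (hd : ∀ {k x}, x ∈ M k → C.d x ∈ M (k + 1)) (k : ℕ) : C.grading k ≤ M k := by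
  rcases Nat.eq_zero_or_pos k with rfl | hk
  · rw [← C.range_ι]
    rintro _ ⟨a, rfl⟩
    exact hι a
  · have hprod : ∀ (m : ℕ) (p : Fin m → A), (List.ofFn fun j => C.d (C.ι (p j))).prod ∈ M m := by
      intro m
      induction m with
      | zero =>
        intro p
        simpa using hι 1
      | succ m ih =>
        intro p
        have h1 := hmul (hd (hι (p 0))) (ih fun i => p i.succ)
        rw [zero_add, add_comm] at h1
        rwa [List.ofFn_succ, List.prod_cons]
    rw [C.grading_eq_span k hk, Submodule.span_le]
    rintro _ ⟨p, rfl⟩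
    simpa using hmul (hι p.1) (hprod k p.2)

theorem eq_top_of_generators (S : Submodule ℂ Ω) (hι : ∀ a, C.ι a ∈ S)
    (hmul : ∀ {x y}, x ∈ S → y ∈ S → x * y ∈ S) (hd : ∀ {x}, x ∈ S → C.d x ∈ S) : S = ⊤ := by
  rw [eq_top_iff, ← C.isInternal.submodule_iSup_eq_top]
  exact iSup_le fun k => C.grading_le (fun _ => S) hι hmul hd k

/-! ### Left-invariant forms -/

/-- The span of the components of covariant tuples of `k`-forms: tuples `η` with
`Δ_Ω (η i) = ∑ r, w i r ⊗ η r` for a matrix corepresentation `w`. -/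
def covariantSpan (k : ℕ) : Submodule ℂ Ω :=
  Submodule.span ℂ {ω | ∃ (κ : Type) (_ : Fintype κ) (_ : DecidableEq κ) (w : Matrix κ κ A)
    (η : κ → Ω), IsCorep w ∧ (∀ i, η i ∈ C.grading k) ∧
      (∀ i, C.coaction (η i) = ∑ r, w i r ⊗ₜ[ℂ] η r) ∧ ∃ i, ω = η i}

theorem grading_le_covariantSpan (k : ℕ) : C.grading k ≤ C.covariantSpan k := by
  refine C.grading_le C.covariantSpan (fun a => ?_) (fun {k l x y} hx hy => ?_)
    (fun {k x} hx => ?_) k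
  · have ha : a ∈ (⊤ : Submodule ℂ A) := trivial
    rw [← span_corep_entries] at ha
    induction ha using Submodule.span_induction with
    | zero => simp
    | add x y _ _ hx hy => simpa using Submodule.add_mem _ hx hy
    | smul c x _ hx => simpa using Submodule.smul_mem _ c hx
    | mem x hx =>
      obtain ⟨n, w, hw, i, j, rfl⟩ := hx
      refine Submodule.subset_span ⟨Fin n, inferInstance, inferInstance, w, fun i => C.ι (w i j),
        hw, fun i => C.ι_mem _, fun i => ?_, i, rfl⟩
      rw [C.coaction_ι, hw.comul_apply]
      simp
  · induction hx using Submodule.span_induction with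
    | zero => simp
    | add x z _ _ hx hz => rw [add_mul]; exact Submodule.add_mem _ hx hz
    | smul c x _ hx => rw [smul_mul_assoc]; exact Submodule.smul_mem _ c hx
    | mem x hx =>
      induction hy using Submodule.span_induction with
      | zero => simp
      | add y z _ _ hy hz => rw [mul_add]; exact Submodule.add_mem _ hy hz
      | smul c y _ hy => rw [mul_smul_comm]; exact Submodule.smul_mem _ c hy
      | mem y hy =>
        obtain ⟨κ, _, _, w, η, hw, hη, hcη, i, rfl⟩ := hx
        obtain ⟨κ', _, _, w', η', hw', hη', hcη', i', rfl⟩ := hy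
        refine Submodule.subset_span ⟨κ × κ', inferInstance, inferInstance,
          fun p r => w p.1 r.1 * w' p.2 r.2, fun p => η p.1 * η' p.2,
          ⟨fun p r => ?_, fun p r => ?_⟩,
          fun p => C.mul_mem (hη _) (hη' _), fun p => ?_, (i, i'), rfl⟩
        · rw [Bialgebra.comul_mul, hw.comul_apply, hw'.comul_apply]
          simp only [Finset.sum_mul, Finset.mul_sum, Algebra.TensorProduct.tmul_mul_tmul,
            Fintype.sum_prod_type]
          rw [Finset.sum_comm]
        · rw [Bialgebra.counit_mul, hw.counit_apply, hw'.counit_apply]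
          by_cases h1 : p.1 = r.1 <;> by_cases h2 : p.2 = r.2 <;> simp [h1, h2, Prod.ext_iff]
        · rw [map_mul, hcη, hcη']
          simp only [Finset.sum_mul, Finset.mul_sum, Algebra.TensorProduct.tmul_mul_tmul,
            Fintype.sum_prod_type]
          rw [Finset.sum_comm]
  · induction hx using Submodule.span_induction with
    | zero => simp
    | add x z _ _ hx hz => rw [map_add]; exact Submodule.add_mem _ hx hz
    | smul c x _ hx => rw [map_smul]; exact Submodule.smul_mem _ c hx
    | mem x hx =>
      obtain ⟨κ, _, _, w, η, hw, hη, hcη, i, rfl⟩ := hx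
      refine Submodule.subset_span ⟨κ, inferInstance, inferInstance, w, fun i => C.d (η i), hw,
        fun i => C.d_mem (hη i), fun i => ?_, i, rfl⟩
      rw [C.coaction_d, hcη]
      simp

/-- The `k`-forms are spanned by the products of elements of `A` and left-invariant `k`-forms: if
`Δ_Ω (η i) = ∑ r, w i r ⊗ η r`, then `P = S(w) η` is invariant, and `η = w P`. -/
theorem grading_le_span_invariantForms (k : ℕ) :
    C.grading k ≤ Submodule.span ℂ {ω | ∃ a : A, ∃ P ∈ C.invariantForms k, ω = C.ι a * P} := by
  refine (C.grading_le_covariantSpan k).trans (Submodule.span_le.2 ?_)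
  rintro _ ⟨κ, _, _, w, η, hw, hη, hcη, i₀, rfl⟩
  let P : κ → Ω := fun j => ∑ r, C.ι (HopfAlgebra.antipode ℂ (w j r)) * η r
  have hwS : ∀ i j, ∑ r, w i r * HopfAlgebra.antipode ℂ (w r j) = if i = j then 1 else 0 := by
    intro i j
    have h1 := congrFun (congrFun hw.mul_antipode i) j
    simpa [Matrix.mul_apply, Matrix.one_apply] using h1
  have hSw : ∀ i j, ∑ r, HopfAlgebra.antipode ℂ (w i r) * w r j = if i = j then 1 else 0 := by
    intro i j
    have h1 := congrFun (congrFun hw.antipode_mul i) j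
    simpa [Matrix.mul_apply, Matrix.one_apply] using h1
  have hηP : ∀ i, η i = ∑ r, C.ι (w i r) * P r := by
    intro i
    simp only [P, Finset.mul_sum, ← mul_assoc, ← map_mul]
    rw [Finset.sum_comm]
    simp only [← Finset.sum_mul, ← map_sum, hwS]
    simp [apply_ite]
  have hinv : ∀ j, C.coaction (P j) = 1 ⊗ₜ[ℂ] P j := by
    -- Both families satisfy `∑ j, Δ_Ω (w i j) X j = Δ_Ω (η i)`, and the matrix `Δ_Ω (w i j)` has
    -- the left inverse `Δ_Ω (S (w i j))`.
    have hcancel : ∀ X : κ → A ⊗[ℂ] Ω,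
        (∀ i, ∑ j, C.coaction (C.ι (w i j)) * X j = C.coaction (η i)) →
        ∀ k, X k = ∑ i, C.coaction (C.ι (HopfAlgebra.antipode ℂ (w k i))) * C.coaction (η i) := by
      intro X hX k
      simp only [← hX, Finset.mul_sum, ← mul_assoc, ← map_mul]
      rw [Finset.sum_comm]
      simp only [← Finset.sum_mul, ← map_sum, hSw]
      simp [apply_ite]
    intro j
    rw [hcancel (fun j => C.coaction (P j)) (fun i => ?_) j,
      hcancel (fun j => (1 : A) ⊗ₜ[ℂ] P j) (fun i => ?_) j]
    · simp only [C.coaction_ι, hw.comul_apply, map_sum, LinearMap.lTensor_tmul, Finset.sum_mul,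
        Algebra.TensorProduct.tmul_mul_tmul, mul_one]
      rw [Finset.sum_comm, hcη]
      refine Finset.sum_congr rfl fun r _ => ?_
      rw [← TensorProduct.tmul_sum, hηP r]
      rfl
    · simp only [← map_mul, ← map_sum]
      rw [← hηP]
  rw [hηP i₀]
  refine Submodule.sum_mem _ fun r _ => Submodule.subset_span ⟨w i₀ r, P r, ⟨?_, hinv r⟩, rfl⟩
  refine Submodule.sum_mem _ fun s _ => ?_
  simpa using C.mul_mem (C.ι_mem _) (hη s)

/-- A linear map `f : A → Ω` that is covariant remains so after right multiplication by an
invariant form. -/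
theorem coaction_mul_invariant (f : A →ₗ[ℂ] Ω)
    (hf : ∀ a, C.coaction (f a) = f.lTensor A (Coalgebra.comul (R := ℂ) a)) {P : Ω}
    (hP : P ∈ C.invariants) (a : A) :
    C.coaction (f a * P) =
      (LinearMap.mulRight ℂ P ∘ₗ f).lTensor A (Coalgebra.comul (R := ℂ) a) := by
  have hP' : C.coaction P = 1 ⊗ₜ[ℂ] P := hP
  rw [map_mul, hf, hP']
  generalize Coalgebra.comul (R := ℂ) a = t
  induction t using TensorProduct.induction_on with
  | zero => simp
  | tmul x y => simp
  | add x y hx hy => simp only [map_add, add_mul, hx, hy]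

theorem coaction_ι_mul_invariant {P : Ω} (hP : P ∈ C.invariants) (a : A) :
    C.coaction (C.ι a * P) =
      (LinearMap.mulRight ℂ P ∘ₗ C.ι.toLinearMap).lTensor A (Coalgebra.comul (R := ℂ) a) :=
  C.coaction_mul_invariant C.ι.toLinearMap C.coaction_ι hP a

/-- A nonzero invariant form is left-cancellable: `a P = 0` implies `(χ ⊗ id)(Δ a) P = 0` for every
functional `χ`, and also `ε(a) P = S(a₁) a₂ P = 0`. -/
theorem ι_mul_invariant_eq_zero {P : Ω} (hP : P ∈ C.invariants) (hP0 : P ≠ 0) {a : A}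
    (ha : C.ι a * P = 0) : a = 0 := by
  have hcounit : ∀ b, C.ι b * P = 0 → Coalgebra.counit (R := ℂ) b = 0 := by
    intro b hb
    let m : A ⊗[ℂ] Ω →ₗ[ℂ] Ω := TensorProduct.lift
      ((LinearMap.mul ℂ Ω).comp (C.ι.toLinearMap ∘ₗ HopfAlgebra.antipode ℂ))
    have h1 : ∀ t : A ⊗[ℂ] A,
        m ((LinearMap.mulRight ℂ P ∘ₗ C.ι.toLinearMap).lTensor A t) =
          C.ι (LinearMap.mul' ℂ A ((HopfAlgebra.antipode ℂ).rTensor A t)) * P := by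
      intro t
      induction t using TensorProduct.induction_on with
      | zero => simp
      | tmul x y => simp [m, mul_assoc]
      | add x y hx hy => simp only [map_add, add_mul, hx, hy]
    have h2 := h1 (Coalgebra.comul (R := ℂ) b)
    rw [← C.coaction_ι_mul_invariant hP, hb, map_zero, map_zero,
      HopfAlgebra.mul_antipode_rTensor_comul_apply, AlgHom.commutes, ← Algebra.smul_def] at h2
    exact (smul_eq_zero.1 h2.symm).resolve_right hP0
  rw [← Module.forall_dual_apply_eq_zero_iff ℂ]
  intro χ
  have h1 : C.ι (leftSlice χ (Coalgebra.comul (R := ℂ) a)) * P = 0 := by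
    have h2 := map_leftSlice (LinearMap.mulRight ℂ P ∘ₗ C.ι.toLinearMap) χ
      (Coalgebra.comul (R := ℂ) a)
    rw [← C.coaction_ι_mul_invariant hP, ha, map_zero, map_zero] at h2
    exact h2
  have h3 := hcounit _ h1
  rwa [← apply_rightSlice, rightSlice_counit] at h3

end Grading

/-! ### Volume forms and the integral -/

section Volume

variable {A : Type u} {Ω : Type v} [Ring A] [StarRing A] [HopfAlgebra ℂ A] [StarModule ℂ A]
  [HopfStarAlgebra A] [Ring Ω] [Algebra ℂ Ω]
  (C : StarDifferentialCalculus A Ω) {h : A →ₗ[ℂ] ℂ} {N : ℕ} {θ : Ω}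

/-- The standing assumptions on the volume form `θ`: it is a nonzero self-adjoint element of the
one-dimensional space of invariant forms of the top degree `N`, invariant forms of degree `N - 1`
are closed, and the calculus is non-degenerate. -/
structure IsVolumeForm (N : ℕ) (θ : Ω) : Prop where
  dimension : C.IsDimension N
  nondegenerate : C.IsNondegenerate N
  finrank_eq_one : Module.finrank ℂ (C.invariantForms N) = 1
  d_eq_zero : ∀ k, k + 1 = N → ∀ ω ∈ C.invariantForms k, C.d ω = 0
  mem : θ ∈ C.invariantForms N
  inv_eq : C.inv θ = θ
  ne_zero : θ ≠ 0

namespace IsVolumeForm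

variable {C}

theorem ι_mul_mem (hθ : C.IsVolumeForm N θ) (a : A) : C.ι a * θ ∈ C.grading N := by
  simpa using C.mul_mem (C.ι_mem a) hθ.mem.1

theorem exists_eq_ι_mul (hθ : C.IsVolumeForm N θ) {ω : Ω} (hω : ω ∈ C.grading N) :
    ∃ a, ω = C.ι a * θ := by
  have h1 := C.grading_le_span_invariantForms N hω
  clear hω
  induction h1 using Submodule.span_induction with
  | zero => exact ⟨0, by simp⟩
  | add x y _ _ hx hy =>
    obtain ⟨a, rfl⟩ := hx
    obtain ⟨b, rfl⟩ := hy
    exact ⟨a + b, by rw [map_add, add_mul]⟩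
  | smul c x _ hx =>
    obtain ⟨a, rfl⟩ := hx
    exact ⟨c • a, by rw [map_smul, smul_mul_assoc]⟩
  | mem x hx =>
    obtain ⟨a, P, hP, rfl⟩ := hx
    obtain ⟨c, hc⟩ := (finrank_eq_one_iff_of_nonzero' (⟨θ, hθ.mem⟩ : C.invariantForms N)
      (by simpa [Subtype.ext_iff] using hθ.ne_zero)).1 hθ.finrank_eq_one ⟨P, hP⟩
    have hc' : c • θ = P := congrArg Subtype.val hc
    exact ⟨c • a, by rw [← hc', map_smul, smul_mul_assoc, mul_smul_comm]⟩

theorem ι_mul_injective (hθ : C.IsVolumeForm N θ) {a b : A} (hab : C.ι a * θ = C.ι b * θ) :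
    a = b := by
  rw [← sub_eq_zero, ← sub_mul, ← map_sub] at hab
  exact sub_eq_zero.1 (C.ι_mul_invariant_eq_zero hθ.mem.2 hθ.ne_zero hab)

theorem integral_ι_mul (hθ : C.IsVolumeForm N θ) (a : A) :
    C.integral h N θ (C.ι a * θ) = h a := by
  have hinj : LinearMap.ker (LinearMap.mulRight ℂ θ ∘ₗ C.ι.toLinearMap) = ⊥ :=
    LinearMap.ker_eq_bot.2 fun a b hab => hθ.ι_mul_injective hab
  simp only [integral, LinearMap.comp_apply]
  rw [C.component_of_mem (hθ.ι_mul_mem a), if_pos rfl]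
  exact congrArg h (LinearMap.leftInverse_apply_of_inj hinj a)

end IsVolumeForm

theorem integral_of_mem {k : ℕ} (hk : k ≠ N) {ω : Ω} (hω : ω ∈ C.grading k) :
    C.integral h N θ ω = 0 := by
  simp only [integral, LinearMap.comp_apply]
  rw [C.component_of_mem hω, if_neg hk]
  simp

namespace IsVolumeForm

variable {C}

/-- A `k`-form is determined by the integrals of its products from the left with `l`-forms,
`l + k = N`. -/
theorem eq_zero_of_integral_mul (hθ : C.IsVolumeForm N θ)
    (hh : IsHaarIntegral h) {k l : ℕ} (hkl : l + k = N) {ω : Ω} (hω : ω ∈ C.grading k)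
    (hz : ∀ ω' ∈ C.grading l, C.integral h N θ (ω' * ω) = 0) : ω = 0 := by
  refine hθ.nondegenerate k l hkl ω hω fun ω' hω' => ?_
  have h1 : ω' * ω ∈ C.grading N := hkl ▸ C.mul_mem hω' hω
  obtain ⟨b, hb⟩ := hθ.exists_eq_ι_mul h1
  have : b = 0 := by
    refine hh.eq_zero_of_apply_mul fun a => ?_
    rw [← hθ.integral_ι_mul (C := C), map_mul C.ι, mul_assoc, ← hb, ← mul_assoc]
    exact hz _ (by simpa using C.mul_mem (C.ι_mem a) hω')
  rw [hb, this]
  simp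

/-- Right multiplication by elements of `A` on the volume form: `θ a = ρ(a) θ`, where `ρ` is a
linear surjection with `Δ ρ(a) = a₁ ⊗ ρ(a₂)` and `h ∘ ρ = h`. -/
theorem exists_mul_ι (hθ : C.IsVolumeForm N θ) (hh : IsHaarIntegral h) :
    ∃ ρ : A →ₗ[ℂ] A, (∀ a, θ * C.ι a = C.ι (ρ a) * θ) ∧ Function.Surjective ρ ∧
      (∀ a, Coalgebra.comul (R := ℂ) (ρ a) = ρ.lTensor A (Coalgebra.comul (R := ℂ) a)) ∧
      ∀ a, h (ρ a) = h a := by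
  have hex : ∀ a, ∃ b, θ * C.ι a = C.ι b * θ := fun a =>
    hθ.exists_eq_ι_mul (by simpa using C.mul_mem hθ.mem.1 (C.ι_mem a))
  choose r hr using hex
  let ρ : A →ₗ[ℂ] A :=
    { toFun := r
      map_add' := fun x y => hθ.ι_mul_injective (by
        rw [← hr, map_add, map_add, mul_add, add_mul, hr, hr])
      map_smul' := fun c x => hθ.ι_mul_injective (by
        rw [← hr, map_smul, RingHom.id_apply, map_smul, mul_smul_comm, smul_mul_assoc, hr]) }
  have hρ : ∀ a, θ * C.ι a = C.ι (ρ a) * θ := hr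
  have hcomul : ∀ a, Coalgebra.comul (R := ℂ) (ρ a) =
      ρ.lTensor A (Coalgebra.comul (R := ℂ) a) := by
    intro a
    let G : A →ₗ[ℂ] Ω := LinearMap.mulRight ℂ θ ∘ₗ C.ι.toLinearMap
    have hG : Function.Injective (G.lTensor A) :=
      Module.Flat.lTensor_preserves_injective_linearMap G fun a b hab => hθ.ι_mul_injective hab
    apply hG
    rw [← C.coaction_ι_mul_invariant hθ.mem.2, ← hρ, map_mul,
      show C.coaction θ = 1 ⊗ₜ[ℂ] θ from hθ.mem.2, C.coaction_ι]
    generalize Coalgebra.comul (R := ℂ) a = t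
    induction t using TensorProduct.induction_on with
    | zero => simp
    | tmul x y => simp [G, hρ]
    | add x y hx hy => simp only [map_add, mul_add, hx, hy]
  have hρ1 : ρ 1 = 1 := hθ.ι_mul_injective (by rw [← hρ]; simp)
  refine ⟨ρ, hρ, fun a => ?_, hcomul, fun a => ?_⟩
  · -- Apply the involution to `θ a* = ρ(a*) θ`.
    have h1 : C.ι a * θ ∈ C.grading N := hθ.ι_mul_mem a
    obtain ⟨b, hb⟩ := hθ.exists_eq_ι_mul (C.inv_mem h1)
    refine ⟨star b, hθ.ι_mul_injective ?_⟩
    have h2 := congrArg C.inv hb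
    rw [C.inv_inv, C.inv_mul (C.ι_mem b) hθ.mem.1, hθ.inv_eq, C.inv_ι, hρ] at h2
    simpa using h2.symm
  · have h1 := hh.leftSlice_comul (ρ a)
    rw [hcomul, ← map_leftSlice, hh.leftSlice_comul, map_smul, hρ1] at h1
    have h2 := congrArg h h1
    simpa [hh.map_one] using h2.symm

theorem integral_inv (hθ : C.IsVolumeForm N θ) (hh : IsHaarIntegral h) (ω : Ω) :
    C.integral h N θ (C.inv ω) = starRingEnd ℂ (C.integral h N θ ω) := by
  induction ω using C.homogeneous_induction with
  | hadd x y hx hy => simp [hx, hy]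
  | hom k ω hω =>
    by_cases hk : k = N
    · subst hk
      obtain ⟨a, rfl⟩ := hθ.exists_eq_ι_mul hω
      obtain ⟨ρ, hρ, -, -, hhρ⟩ := hθ.exists_mul_ι hh
      rw [C.inv_mul (C.ι_mem a) hθ.mem.1, hθ.inv_eq, C.inv_ι, hρ, zero_mul, pow_zero, one_mul,
        hθ.integral_ι_mul, hθ.integral_ι_mul, hhρ, hh.map_star]
    · rw [C.integral_of_mem hk hω, C.integral_of_mem hk (C.inv_mem hω), map_zero]

/-- A `k`-form is determined by the integrals of its products from the right with `l`-forms,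
`l + k = N`. -/
theorem eq_zero_of_integral_mul' (hθ : C.IsVolumeForm N θ)
    (hh : IsHaarIntegral h) {k l : ℕ} (hkl : l + k = N) {ω : Ω} (hω : ω ∈ C.grading k)
    (hz : ∀ ω' ∈ C.grading l, C.integral h N θ (ω * ω') = 0) : ω = 0 := by
  have h1 : C.inv ω = 0 := by
    refine hθ.eq_zero_of_integral_mul hh hkl (C.inv_mem hω) fun ω' hω' => ?_
    have h2 := hθ.integral_inv hh (ω * C.inv ω')
    rw [C.inv_mul hω (C.inv_mem hω'), C.inv_inv, hz _ (C.inv_mem hω'), map_zero,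
      neg_one_pow_mul_eq_smul, map_smul, smul_eq_zero] at h2
    exact h2.resolve_left (pow_ne_zero _ (by norm_num))
  rw [← C.inv_inv ω, h1, map_zero]

/-- Left invariance of the integral on forms of the top degree. -/
theorem rightSlice_integral (hθ : C.IsVolumeForm N θ) (hh : IsHaarIntegral h) {ω : Ω}
    (hω : ω ∈ C.grading N) :
    rightSlice (C.integral h N θ) (C.coaction ω) = C.integral h N θ ω • (1 : A) := by
  obtain ⟨a, rfl⟩ := hθ.exists_eq_ι_mul hω
  rw [C.coaction_ι_mul_invariant hθ.mem.2, rightSlice_lTensor, hθ.integral_ι_mul,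
    ← hh.rightSlice_comul]
  congr 2
  ext b
  exact hθ.integral_ι_mul b

/-- The integral is closed. For an invariant `(N - 1)`-form `P` the functional
`a ↦ ∫ d(a P) = ∫ (da) P` is left invariant, hence a multiple of `h`, and it vanishes at `1`. -/
theorem integral_d (hθ : C.IsVolumeForm N θ) (hh : IsHaarIntegral h) (ω : Ω) :
    C.integral h N θ (C.d ω) = 0 := by
  induction ω using C.homogeneous_induction with
  | hadd x y hx hy => simp [hx, hy]
  | hom k ω hω =>
    by_cases hk : k + 1 = N
    · have h1 := C.grading_le_span_invariantForms k hω
      clear hω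
      induction h1 using Submodule.span_induction with
      | zero => simp
      | add x y _ _ hx hy => simp [hx, hy]
      | smul c x _ hx => simp [hx]
      | mem x hx =>
        obtain ⟨a, P, hP, rfl⟩ := hx
        let f : A →ₗ[ℂ] Ω := C.d ∘ₗ C.ι.toLinearMap
        have hf : ∀ a, C.coaction (f a) = f.lTensor A (Coalgebra.comul (R := ℂ) a) := by
          intro a
          simp only [f, LinearMap.comp_apply, LinearMap.lTensor_comp]
          exact (C.coaction_d _).trans (congrArg _ (C.coaction_ι a))
        let g : A →ₗ[ℂ] ℂ := C.integral h N θ ∘ₗ LinearMap.mulRight ℂ P ∘ₗ f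
        have hg : ∀ a, C.integral h N θ (C.d (C.ι a) * P) = g a := fun a => rfl
        have hmem : ∀ a, f a * P ∈ C.grading N := fun a => by
          have := C.mul_mem (C.d_mem (C.ι_mem a)) hP.1
          rwa [zero_add, add_comm, hk] at this
        have hinv : ∀ a, rightSlice g (Coalgebra.comul (R := ℂ) a) = g a • (1 : A) := by
          intro a
          have h2 := hθ.rightSlice_integral hh (hmem a)
          rw [C.coaction_mul_invariant f hf hP.2, rightSlice_lTensor] at h2
          exact h2
        have hg1 : g 1 = 0 := by
          rw [← hg, map_one, C.d_one, zero_mul, map_zero]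
        rw [C.d_mul (C.ι_mem a), hθ.d_eq_zero k hk P hP, mul_zero, mul_zero, add_zero, hg,
          hh.eq_of_rightSlice_comul g hinv, hg1, zero_mul]
    · exact C.integral_of_mem hk (C.d_mem hω)

end IsVolumeForm

end Volume

end StarDifferentialCalculus

/-! ### The twist automorphism -/

namespace StarDifferentialCalculus

section Twist

variable {A : Type u} {Ω : Type v} [Ring A] [StarRing A] [HopfAlgebra ℂ A] [StarModule ℂ A]
  [HopfStarAlgebra A] [Ring Ω] [Algebra ℂ Ω]
  (C : StarDifferentialCalculus A Ω) {h : A →ₗ[ℂ] ℂ} {N : ℕ} {θ : Ω}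

/-- The graph, in degree `k`, of the twist automorphism of the functional `I`: pairs of `k`-forms
`(ω, η)` with `I (ω' ω) = (-1)^{kl} I (η ω')` for all `l`-forms `ω'`, `l + k = N`. -/
def TwistRel (I : Ω →ₗ[ℂ] ℂ) (N k : ℕ) (ω η : Ω) : Prop :=
  ω ∈ C.grading k ∧ η ∈ C.grading k ∧
    ∀ l, l + k = N → ∀ ω' ∈ C.grading l, I (ω' * ω) = (-1) ^ (l * k) * I (η * ω')

variable {C}

theorem TwistRel.zero (I : Ω →ₗ[ℂ] ℂ) (N k : ℕ) : C.TwistRel I N k 0 0 :=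
  ⟨Submodule.zero_mem _, Submodule.zero_mem _, by simp⟩

theorem TwistRel.add {I : Ω →ₗ[ℂ] ℂ} {k : ℕ} {ω η ω₁ η₁ : Ω} (h₀ : C.TwistRel I N k ω η)
    (h₁ : C.TwistRel I N k ω₁ η₁) : C.TwistRel I N k (ω + ω₁) (η + η₁) :=
  ⟨Submodule.add_mem _ h₀.1 h₁.1, Submodule.add_mem _ h₀.2.1 h₁.2.1, fun l hl ω' hω' => by
    rw [mul_add, add_mul, map_add, map_add, h₀.2.2 l hl ω' hω', h₁.2.2 l hl ω' hω', mul_add]⟩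

theorem TwistRel.smul {I : Ω →ₗ[ℂ] ℂ} {k : ℕ} {ω η : Ω} (h₀ : C.TwistRel I N k ω η) (c : ℂ) :
    C.TwistRel I N k (c • ω) (c • η) :=
  ⟨Submodule.smul_mem _ _ h₀.1, Submodule.smul_mem _ _ h₀.2.1, fun l hl ω' hω' => by
    rw [mul_smul_comm, smul_mul_assoc, map_smul, map_smul, h₀.2.2 l hl ω' hω', smul_eq_mul,
      smul_eq_mul, mul_left_comm]⟩

theorem TwistRel.mul {I : Ω →ₗ[ℂ] ℂ} {k m : ℕ} {ω η ω₁ η₁ : Ω} (h₀ : C.TwistRel I N k ω η)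
    (h₁ : C.TwistRel I N m ω₁ η₁) : C.TwistRel I N (k + m) (ω * ω₁) (η * η₁) := by
  refine ⟨C.mul_mem h₀.1 h₁.1, C.mul_mem h₀.2.1 h₁.2.1, fun l hl ω' hω' => ?_⟩
  rw [← mul_assoc, h₁.2.2 (l + k) (by omega) _ (C.mul_mem hω' h₀.1), ← mul_assoc,
    h₀.2.2 (m + l) (by omega) _ (C.mul_mem h₁.2.1 hω'), ← mul_assoc, ← mul_assoc, ← pow_add]
  congr 1
  have : (l + k) * m + (m + l) * k = l * (k + m) + 2 * (k * m) := by ring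
  rw [this, pow_add, pow_mul (-1 : ℂ) 2]
  simp

/-- The graph of the twist automorphism is compatible with the differential, since the integral is
closed. -/
theorem TwistRel.d {I : Ω →ₗ[ℂ] ℂ} (hI : ∀ ω, I (C.d ω) = 0) {k : ℕ} {ω η : Ω}
    (h₀ : C.TwistRel I N k ω η) : C.TwistRel I N (k + 1) (C.d ω) (C.d η) := by
  refine ⟨C.d_mem h₀.1, C.d_mem h₀.2.1, fun l hl ω' hω' => ?_⟩
  have h1 := hI (ω' * ω)
  rw [C.d_mul hω', map_add, neg_one_pow_mul_eq_smul, map_smul, smul_eq_mul,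
    h₀.2.2 (l + 1) (by omega) _ (C.d_mem hω')] at h1
  have h2 := hI (η * ω')
  rw [C.d_mul h₀.2.1, map_add, neg_one_pow_mul_eq_smul, map_smul, smul_eq_mul] at h2
  have hsq : ∀ j : ℕ, (-1 : ℂ) ^ j * (-1) ^ j = 1 := fun j => by
    rw [← mul_pow]; simp
  have h3 : I (C.d η * ω') = -((-1) ^ k * I (η * C.d ω')) := eq_neg_of_add_eq_zero_left h2
  have h4 : I (ω' * C.d ω) = -((-1) ^ l * ((-1) ^ ((l + 1) * k) * I (η * C.d ω'))) := by
    have h5 := congrArg (fun x => (-1 : ℂ) ^ l * x) (eq_neg_of_add_eq_zero_right h1)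
    rw [← mul_assoc, hsq, one_mul] at h5
    rw [h5]
    ring
  rw [h3, h4]
  ring

namespace IsVolumeForm

theorem twistRel_unique_right (hθ : C.IsVolumeForm N θ) (hh : IsHaarIntegral h) {k : ℕ}
    {ω η η' : Ω} (h₀ : C.TwistRel (C.integral h N θ) N k ω η)
    (h₁ : C.TwistRel (C.integral h N θ) N k ω η') : η = η' := by
  by_cases hk : k ≤ N
  · refine sub_eq_zero.1 (hθ.eq_zero_of_integral_mul' hh (Nat.sub_add_cancel hk)
      (Submodule.sub_mem _ h₀.2.1 h₁.2.1) fun ω' hω' => ?_)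
    have h2 := h₀.2.2 _ (Nat.sub_add_cancel hk) ω' hω'
    rw [h₁.2.2 _ (Nat.sub_add_cancel hk) ω' hω'] at h2
    rw [sub_mul, map_sub, sub_eq_zero]
    exact (mul_left_cancel₀ (pow_ne_zero _ (by norm_num)) h2).symm
  · have hbot := hθ.dimension.2 k (by omega)
    have h1 := h₀.2.1
    have h2 := h₁.2.1
    rw [hbot, Submodule.mem_bot] at h1 h2
    rw [h1, h2]

theorem twistRel_unique_left (hθ : C.IsVolumeForm N θ) (hh : IsHaarIntegral h) {k : ℕ}
    {ω ω₁ η : Ω} (h₀ : C.TwistRel (C.integral h N θ) N k ω η)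
    (h₁ : C.TwistRel (C.integral h N θ) N k ω₁ η) : ω = ω₁ := by
  by_cases hk : k ≤ N
  · refine sub_eq_zero.1 (hθ.eq_zero_of_integral_mul hh (Nat.sub_add_cancel hk)
      (Submodule.sub_mem _ h₀.1 h₁.1) fun ω' hω' => ?_)
    rw [mul_sub, map_sub, h₀.2.2 _ (Nat.sub_add_cancel hk) ω' hω',
      h₁.2.2 _ (Nat.sub_add_cancel hk) ω' hω', sub_self]
  · have hbot := hθ.dimension.2 k (by omega)
    have h1 := h₀.1
    have h2 := h₁.1
    rw [hbot, Submodule.mem_bot] at h1 h2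
    rw [h1, h2]

/-- On `A` the twist automorphism is the composition of the map `ρ` with `θ a = ρ(a) θ` and the
modular map of the Haar integral. -/
theorem twistRel_ι (hθ : C.IsVolumeForm N θ) {ρ s : A →ₗ[ℂ] A}
    (hρ : ∀ a, θ * C.ι a = C.ι (ρ a) * θ) (hs : ∀ a b, h (b * a) = h (s a * b)) (a : A) :
    C.TwistRel (C.integral h N θ) N 0 (C.ι a) (C.ι (s (ρ a))) := by
  refine ⟨C.ι_mem _, C.ι_mem _, fun l hl ω' hω' => ?_⟩
  obtain rfl : l = N := by omega
  obtain ⟨b, rfl⟩ := hθ.exists_eq_ι_mul hω'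
  rw [mul_assoc, hρ, ← mul_assoc, ← mul_assoc, ← map_mul C.ι, ← map_mul C.ι, hθ.integral_ι_mul,
    hθ.integral_ι_mul, hs, mul_zero, pow_zero, one_mul]

theorem exists_twistRel (hθ : C.IsVolumeForm N θ) (hh : IsHaarIntegral h) {k : ℕ} {ω : Ω}
    (hω : ω ∈ C.grading k) : ∃ η, C.TwistRel (C.integral h N θ) N k ω η := by
  obtain ⟨ρ, hρ, -, -, -⟩ := hθ.exists_mul_ι hh
  obtain ⟨s, -, hs⟩ := hh.exists_modular
  let M : ℕ → Submodule ℂ Ω := fun k =>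
    { carrier := {ω | ∃ η, C.TwistRel (C.integral h N θ) N k ω η}
      add_mem' := by
        rintro _ _ ⟨η, h₀⟩ ⟨η', h₁⟩
        exact ⟨_, h₀.add h₁⟩
      zero_mem' := ⟨0, TwistRel.zero _ _ _⟩
      smul_mem' := by
        rintro c _ ⟨η, h₀⟩
        exact ⟨_, h₀.smul c⟩ }
  refine C.grading_le M (fun a => ⟨_, hθ.twistRel_ι hρ hs a⟩) ?_ ?_ k hω
  · rintro k l x y ⟨η, h₀⟩ ⟨η', h₁⟩
    exact ⟨_, h₀.mul h₁⟩
  · rintro k x ⟨η, h₀⟩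
    exact ⟨_, h₀.d (hθ.integral_d hh)⟩

theorem exists_twistRel_left (hθ : C.IsVolumeForm N θ) (hh : IsHaarIntegral h) {k : ℕ} {η : Ω}
    (hη : η ∈ C.grading k) : ∃ ω, C.TwistRel (C.integral h N θ) N k ω η := by
  obtain ⟨ρ, hρ, hρs, -, -⟩ := hθ.exists_mul_ι hh
  obtain ⟨s, hss, hs⟩ := hh.exists_modular
  let M : ℕ → Submodule ℂ Ω := fun k =>
    { carrier := {η | ∃ ω, C.TwistRel (C.integral h N θ) N k ω η}
      add_mem' := by
        rintro _ _ ⟨η, h₀⟩ ⟨η', h₁⟩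
        exact ⟨_, h₀.add h₁⟩
      zero_mem' := ⟨0, TwistRel.zero _ _ _⟩
      smul_mem' := by
        rintro c _ ⟨η, h₀⟩
        exact ⟨_, h₀.smul c⟩ }
  refine C.grading_le M (fun a => ?_) ?_ ?_ k hη
  · obtain ⟨b, rfl⟩ := hss a
    obtain ⟨c, rfl⟩ := hρs b
    exact ⟨_, hθ.twistRel_ι hρ hs c⟩
  · rintro k l x y ⟨η, h₀⟩ ⟨η', h₁⟩
    exact ⟨_, h₀.mul h₁⟩
  · rintro k x ⟨η, h₀⟩
    exact ⟨_, h₀.d (hθ.integral_d hh)⟩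

end IsVolumeForm

theorem IsTwistAutomorphism.twistRel {I : Ω →ₗ[ℂ] ℂ} {σ : Ω ≃ₐ[ℂ] Ω}
    (hσ : C.IsTwistAutomorphism I σ) {k : ℕ} {ω : Ω} (hω : ω ∈ C.grading k) :
    C.TwistRel I N k ω (σ ω) :=
  ⟨hω, hσ.map_mem hω, fun l _ ω' hω' => by rw [hσ.twist hω hω', mul_comm k l]⟩

theorem IsTwistAutomorphism.integral_twist {σ : Ω ≃ₐ[ℂ] Ω}
    (hσ : C.IsTwistAutomorphism (C.integral h N θ) σ) (ω : Ω) :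
    C.integral h N θ (σ ω) = C.integral h N θ ω := by
  induction ω using C.homogeneous_induction with
  | hadd x y hx hy => simp only [map_add, hx, hy]
  | hom k ω hω =>
    have h1 : (1 : Ω) ∈ C.grading 0 := by simpa using C.ι_mem 1
    simpa using (hσ.twist hω h1).symm

namespace IsVolumeForm

/-- The components of `ω` and `η` in each degree lie in the graph of the twist automorphism. -/
theorem exists_twistRel_component (hθ : C.IsVolumeForm N θ) (hh : IsHaarIntegral h) (ω : Ω) :
    ∃ η, ∀ k, C.TwistRel (C.integral h N θ) N k (C.component k ω) (C.component k η) := by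
  induction ω using C.homogeneous_induction with
  | hadd x y hx hy =>
    obtain ⟨η, hη⟩ := hx
    obtain ⟨η', hη'⟩ := hy
    exact ⟨η + η', fun k => by rw [map_add, map_add]; exact (hη k).add (hη' k)⟩
  | hom k ω hω =>
    obtain ⟨η, hη⟩ := hθ.exists_twistRel hh hω
    refine ⟨η, fun l => ?_⟩
    rw [C.component_of_mem hω, C.component_of_mem hη.2.1]
    split_ifs with hkl
    · exact hkl ▸ hη
    · exact TwistRel.zero _ _ _

theorem exists_isTwistAutomorphism (hθ : C.IsVolumeForm N θ) (hh : IsHaarIntegral h) :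
    ∃ σ : Ω ≃ₐ[ℂ] Ω, C.IsTwistAutomorphism (C.integral h N θ) σ := by
  choose f hf using hθ.exists_twistRel_component hh
  have huniq : ∀ ω η, (∀ k, C.TwistRel (C.integral h N θ) N k (C.component k ω)
      (C.component k η)) → f ω = η := fun ω η hη =>
    sub_eq_zero.1 (C.eq_zero_of_component _ fun k => by
      rw [map_sub, hθ.twistRel_unique_right hh (hf ω k) (hη k), sub_self])
  let F : Ω →ₗ[ℂ] Ω :=
    { toFun := f
      map_add' := fun x y => huniq _ _ fun k => by
        rw [map_add, map_add]; exact (hf x k).add (hf y k)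
      map_smul' := fun c x => huniq _ _ fun k => by
        rw [RingHom.id_apply, map_smul, map_smul]; exact (hf x k).smul c }
  have hF : ∀ {k ω η}, C.TwistRel (C.integral h N θ) N k ω η → F ω = η := fun {k ω η} hη =>
    huniq _ _ fun l => by
      rw [C.component_of_mem hη.1, C.component_of_mem hη.2.1]
      split_ifs with hkl
      · exact hkl ▸ hη
      · exact TwistRel.zero _ _ _
  have hFrel : ∀ {k ω}, ω ∈ C.grading k → C.TwistRel (C.integral h N θ) N k ω (F ω) := by
    intro k ω hω
    obtain ⟨η, hη⟩ := hθ.exists_twistRel hh hω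
    rwa [hF hη]
  have hFmul : ∀ x y, F (x * y) = F x * F y := by
    intro x y
    induction x using C.homogeneous_induction with
    | hadd x x' hx hx' => simp only [add_mul, map_add, hx, hx']
    | hom k x hx =>
      induction y using C.homogeneous_induction with
      | hadd y y' hy hy' => simp only [mul_add, map_add, hy, hy']
      | hom l y hy => exact hF ((hFrel hx).mul (hFrel hy))
  have hFd : ∀ x, F (C.d x) = C.d (F x) := by
    intro x
    induction x using C.homogeneous_induction with
    | hadd x y hx hy => simp only [map_add, hx, hy]
    | hom k x hx => exact hF ((hFrel hx).d (hθ.integral_d hh))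
  have hFsurj : Function.Surjective F := by
    intro y
    induction y using C.homogeneous_induction with
    | hadd x y hx hy =>
      obtain ⟨a, rfl⟩ := hx
      obtain ⟨b, rfl⟩ := hy
      exact ⟨a + b, map_add _ _ _⟩
    | hom k y hy =>
      obtain ⟨x, hx⟩ := hθ.exists_twistRel_left hh hy
      exact ⟨x, hF hx⟩
  have hFinj : Function.Injective F := by
    rw [injective_iff_map_eq_zero]
    intro x hx
    refine C.eq_zero_of_component _ fun k => ?_
    have h1 : C.TwistRel (C.integral h N θ) N k (C.component k x) (C.component k (F x)) := hf x k
    rw [hx, map_zero] at h1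
    exact hθ.twistRel_unique_left hh h1 (TwistRel.zero _ _ _)
  have hF1 : F 1 = 1 := by
    obtain ⟨e, he⟩ := hFsurj 1
    have h1 := hFmul 1 e
    rw [one_mul, he, mul_one] at h1
    exact h1.symm
  let σ : Ω ≃ₐ[ℂ] Ω := AlgEquiv.ofBijective (AlgHom.ofLinearMap F hF1 hFmul) ⟨hFinj, hFsurj⟩
  have hσ : ∀ x, σ x = F x := fun x => rfl
  refine ⟨σ, ⟨fun {k ω} hω => (hFrel hω).2.1, hFd, fun {k l ω ω'} hω hω' => ?_⟩⟩
  rw [hσ]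
  by_cases hkl : l + k = N
  · rw [(hFrel hω).2.2 l hkl ω' hω', mul_comm k l]
  · rw [C.integral_of_mem hkl (C.mul_mem hω' hω),
      C.integral_of_mem (by omega) (C.mul_mem (hFrel hω).2.1 hω'), mul_zero]

theorem isTwistAutomorphism_unique (hθ : C.IsVolumeForm N θ) (hh : IsHaarIntegral h)
    {σ σ' : Ω ≃ₐ[ℂ] Ω} (hσ : C.IsTwistAutomorphism (C.integral h N θ) σ)
    (hσ' : C.IsTwistAutomorphism (C.integral h N θ) σ') : σ = σ' := by
  ext ω
  induction ω using C.homogeneous_induction with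
  | hadd x y hx hy => simp only [map_add, hx, hy]
  | hom k ω hω => exact hθ.twistRel_unique_right hh (hσ.twistRel hω) (hσ'.twistRel hω)

theorem twist_ι (hθ : C.IsVolumeForm N θ) (hh : IsHaarIntegral h) {σ : Ω ≃ₐ[ℂ] Ω}
    (hσ : C.IsTwistAutomorphism (C.integral h N θ) σ) {ρ s : A →ₗ[ℂ] A}
    (hρ : ∀ a, θ * C.ι a = C.ι (ρ a) * θ) (hs : ∀ a b, h (b * a) = h (s a * b)) (a : A) :
    σ (C.ι a) = C.ι (s (ρ a)) :=
  hθ.twistRel_unique_right hh (hσ.twistRel (C.ι_mem a)) (hθ.twistRel_ι hρ hs a)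

/-- The involution turns the twist automorphism into its inverse, because the integral is
hermitian. -/
theorem twist_inv_twist (hθ : C.IsVolumeForm N θ) (hh : IsHaarIntegral h) {σ : Ω ≃ₐ[ℂ] Ω}
    (hσ : C.IsTwistAutomorphism (C.integral h N θ) σ) (ω : Ω) :
    σ (C.inv (σ ω)) = C.inv ω := by
  induction ω using C.homogeneous_induction with
  | hadd x y hx hy => simp only [map_add, hx, hy]
  | hom k ω hω =>
    refine hθ.twistRel_unique_right hh (hσ.twistRel (C.inv_mem (hσ.map_mem hω)))
      ⟨C.inv_mem (hσ.map_mem hω), C.inv_mem hω, fun l hl ω' hω' => ?_⟩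
    have h1 := congrArg (starRingEnd ℂ) (hσ.twist hω (C.inv_mem hω'))
    rw [map_mul (starRingEnd ℂ), ← hθ.integral_inv hh, ← hθ.integral_inv hh,
      C.inv_mul (C.inv_mem hω') hω, C.inv_mul (hσ.map_mem hω) (C.inv_mem hω'),
      C.inv_inv, neg_one_pow_mul_eq_smul,
      neg_one_pow_mul_eq_smul, map_smul, map_smul, smul_eq_mul, smul_eq_mul, map_pow, map_neg,
      map_one, mul_comm k l, ← mul_assoc, ← mul_pow] at h1
    simpa using h1.symm

/-- On the entries of a diagonal representation the twist automorphism acts, up to the factors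
`q k⁻¹`, by a scalar matrix on the right. -/
theorem twist_diagonal (hθ : C.IsVolumeForm N θ) (hh : IsHaarIntegral h) {σ : Ω ≃ₐ[ℂ] Ω}
    (hσ : C.IsTwistAutomorphism (C.integral h N θ) σ) {n : ℕ} {U : Matrix (Fin n) (Fin n) A}
    {q : Fin n → ℝ} (hU : IsDiagonalRep U q) :
    ∃ m : Matrix (Fin n) (Fin n) ℂ, ∀ k j,
      σ (C.ι (U k j)) = C.ι (∑ i, ((q k : ℂ)⁻¹ * m i j) • U k i) := by
  obtain ⟨ρ, hρ, -, hρcomul, -⟩ := hθ.exists_mul_ι hh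
  obtain ⟨s, -, hs⟩ := hh.exists_modular
  obtain ⟨m, hm⟩ := hU.exists_modular hh
  have hsU : ∀ k j, s (U k j) = ∑ i, ((q k : ℂ)⁻¹ * m i j) • U k i := fun k j =>
    sub_eq_zero.1 (hh.eq_zero_of_mul_apply fun x => by
      rw [sub_mul, map_sub, ← hs, hm, sub_self])
  have hρU : ∀ k j, ρ (U k j) = ∑ r, Coalgebra.counit (R := ℂ) (ρ (U r j)) • U k r := by
    intro k j
    have h1 := rightSlice_counit (ρ (U k j))
    rw [hρcomul, hU.comul_apply] at h1
    simpa using h1.symm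
  refine ⟨m * Matrix.of fun r j => Coalgebra.counit (R := ℂ) (ρ (U r j)), fun k j => ?_⟩
  rw [hθ.twist_ι hh hσ hρ hs, hρU]
  congr 1
  simp only [map_sum, map_smul, hsU, Finset.smul_sum, smul_smul, Matrix.mul_apply, Matrix.of_apply,
    Finset.mul_sum, Finset.sum_smul]
  rw [Finset.sum_comm]
  refine Finset.sum_congr rfl fun i _ => Finset.sum_congr rfl fun r _ => ?_
  congr 1
  ring

/-- The coaction intertwines `σ` and `κ⁻² ⊗ σ`. -/
theorem coaction_twist (hθ : C.IsVolumeForm N θ) (hh : IsHaarIntegral h) {σ : Ω ≃ₐ[ℂ] Ω}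
    (hσ : C.IsTwistAutomorphism (C.integral h N θ) σ) {τ : ℂ → A ≃ₐ[ℂ] A} (hτ : IsScalingGroup τ)
    (ω : Ω) : C.coaction (σ ω) =
      TensorProduct.map (τ Complex.I).toLinearMap σ.toLinearMap (C.coaction ω) := by
  let T : A ⊗[ℂ] Ω →ₐ[ℂ] A ⊗[ℂ] Ω :=
    Algebra.TensorProduct.map (τ Complex.I : A →ₐ[ℂ] A) (σ : Ω →ₐ[ℂ] Ω)
  have hT : ∀ t, T t = TensorProduct.map (τ Complex.I).toLinearMap σ.toLinearMap t := fun t => rfl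
  let S : Submodule ℂ Ω :=
    LinearMap.eqLocus (C.coaction.toLinearMap ∘ₗ σ.toLinearMap)
      (T.toLinearMap ∘ₗ C.coaction.toLinearMap)
  have hS : ∀ x, x ∈ S ↔ C.coaction (σ x) = T (C.coaction x) := fun x => Iff.rfl
  have htop : S = ⊤ := by
    refine C.eq_top_of_generators S (fun a => ?_) (fun {x y} hx hy => ?_) (fun {x} hx => ?_)
    · have ha : a ∈ (⊤ : Submodule ℂ A) := trivial
      rw [← hh.span_diagonal] at ha
      induction ha using Submodule.span_induction with
      | zero => simp
      | add x y _ _ hx hy => simpa using Submodule.add_mem _ hx hy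
      | smul c x _ hx => simpa using Submodule.smul_mem _ c hx
      | mem x hx =>
        obtain ⟨n, U, q, hU, k, j, rfl⟩ := hx
        obtain ⟨m, hm⟩ := hθ.twist_diagonal hh hσ hU
        rw [hS, hm, C.coaction_ι, C.coaction_ι, hU.comul_apply]
        simp only [map_sum, map_smul, hU.comul_apply, LinearMap.lTensor_tmul, hT,
          TensorProduct.map_tmul, AlgEquiv.toLinearMap_apply, hτ.apply_I_diagonal hU,
          AlgHom.toLinearMap_apply, hm, TensorProduct.tmul_sum, TensorProduct.tmul_smul,
          TensorProduct.smul_tmul', Finset.smul_sum, smul_smul]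
        rw [Finset.sum_comm]
        refine Finset.sum_congr rfl fun r _ => Finset.sum_congr rfl fun i _ => ?_
        congr 2
        field_simp [hU.ne_zero r]
    · rw [hS] at *
      rw [map_mul, map_mul, hx, hy, map_mul, map_mul]
    · rw [hS] at *
      rw [hσ.map_d, C.coaction_d, hx, C.coaction_d]
      generalize C.coaction x = t
      induction t using TensorProduct.induction_on with
      | zero => simp
      | tmul x y => simp [hT, hσ.map_d]
      | add x y hx hy => simp only [map_add, hx, hy]
  have : ω ∈ S := htop ▸ Submodule.mem_top
  exact (hS ω).1 this

end IsVolumeForm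

end Twist

end StarDifferentialCalculus

/-! ### Orthonormal eigenbases -/

/-- A symmetric operator on an inner product space that is spanned by pairwise orthogonal
finite-dimensional invariant subspaces has an orthonormal basis of eigenvectors in these
subspaces. -/
theorem LinearMap.IsSymmetric.exists_orthonormal_eigenbasis {E : Type u} [NormedAddCommGroup E]
    [InnerProductSpace ℂ E] {T : E →ₗ[ℂ] E} (hT : T.IsSymmetric) (𝒲 : Set (Submodule ℂ E))
    (hfd : ∀ W ∈ 𝒲, FiniteDimensional ℂ W) (hinv : ∀ W ∈ 𝒲, ∀ x ∈ W, T x ∈ W)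
    (hort : ∀ W ∈ 𝒲, ∀ W' ∈ 𝒲, W ≠ W' → ∀ x ∈ W, ∀ y ∈ W', inner ℂ x y = 0)
    (htop : sSup 𝒲 = ⊤) :
    ∃ (J : Type u) (e : Module.Basis J ℂ E), Orthonormal ℂ e ∧
      ∀ j, (∃ W ∈ 𝒲, e j ∈ W) ∧ ∃ l : ℝ, T (e j) = (l : ℂ) • e j := by
  have hfd' : ∀ W : 𝒲, FiniteDimensional ℂ (W : Submodule ℂ E) := fun W => hfd W W.2
  let b : ∀ W : 𝒲, OrthonormalBasis (Fin (Module.finrank ℂ (W : Submodule ℂ E))) ℂ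
      (W : Submodule ℂ E) := fun W =>
    (hT.restrict_invariant (hinv W W.2)).eigenvectorBasis rfl
  let e : (Σ W : 𝒲, Fin (Module.finrank ℂ (W : Submodule ℂ E))) → E := fun p => (b p.1 p.2 : E)
  have he : Orthonormal ℂ e := by
    refine ⟨fun p => (b p.1).orthonormal.1 p.2, ?_⟩
    rintro ⟨W, i⟩ ⟨W', i'⟩ hne
    by_cases hW : W = W'
    · subst hW
      exact (b W).orthonormal.2 fun hi => hne (congrArg (Sigma.mk W) hi)
    · exact hort W W.2 W' W'.2 (fun h => hW (Subtype.ext h)) _ (b W i).2 _ (b W' i').2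
  have hspan : ⊤ ≤ Submodule.span ℂ (Set.range e) := by
    rw [← htop]
    refine sSup_le fun W hW x hx => ?_
    have h1 := congrArg Subtype.val ((b ⟨W, hW⟩).sum_repr' ⟨x, hx⟩)
    simp only [Submodule.coe_sum, Submodule.coe_smul] at h1
    rw [← h1]
    exact Submodule.sum_mem _ fun i _ => Submodule.smul_mem _ _
      (Submodule.subset_span ⟨⟨⟨W, hW⟩, i⟩, rfl⟩)
  refine ⟨_, Module.Basis.mk he.linearIndependent hspan, by simpa using he, fun p => ?_⟩
  rw [Module.Basis.mk_apply]
  refine ⟨⟨p.1, p.1.2, (b p.1 p.2).2⟩,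
    (hT.restrict_invariant (hinv p.1 p.1.2)).eigenvalues rfl p.2, ?_⟩
  exact congrArg Subtype.val
    ((hT.restrict_invariant (hinv p.1 p.1.2)).apply_eigenvectorBasis rfl p.2)

namespace StarDifferentialCalculus

section Positive

variable {A : Type u} {Ω : Type v} [Ring A] [StarRing A] [HopfAlgebra ℂ A] [StarModule ℂ A]
  [HopfStarAlgebra A] [Ring Ω] [Algebra ℂ Ω]
  {C : StarDifferentialCalculus A Ω} {h : A →ₗ[ℂ] ℂ} {N : ℕ} {θ : Ω}

namespace IsVolumeForm

/-- Under the positivity assumption the restriction of the twist automorphism to `A` is a positive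
symmetric operator. It preserves the coefficient spaces of the irreducible representations, so
that there is an orthonormal basis of homogeneous eigenvectors. -/
theorem exists_homogeneous_eigenbasis (hθ : C.IsVolumeForm N θ) (hh : IsHaarIntegral h)
    {σ : Ω ≃ₐ[ℂ] Ω} (hσ : C.IsTwistAutomorphism (C.integral h N θ) σ)
    (hpos : ∀ a b : A, C.ι b = σ (C.ι a) → 0 ≤ h (star a * b)) :
    ∃ (J : Type u) (e : Module.Basis J ℂ A) (l : J → ℝ), (∀ j, IsHomogeneous (e j)) ∧
      (∀ j, h (star (e j) * e j) = 1) ∧ (∀ j k, j ≠ k → h (star (e k) * e j) = 0) ∧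
      (∀ j, 0 < l j) ∧ ∀ j, σ (C.ι (e j)) = (l j : ℂ) • C.ι (e j) := by
  obtain ⟨ρ, hρ, -, -, -⟩ := hθ.exists_mul_ι hh
  obtain ⟨s, -, hs⟩ := hh.exists_modular
  let S : A →ₗ[ℂ] A := s ∘ₗ ρ
  have hS : ∀ a, σ (C.ι a) = C.ι (S a) := hθ.twist_ι hh hσ hρ hs
  have hSpos : ∀ a, 0 ≤ h (star a * S a) := fun a => hpos a (S a) (hS a).symm
  let _ : NormedAddCommGroup A := hh.innerCore.toNormedAddCommGroup
  let _ : InnerProductSpace ℂ A := InnerProductSpace.ofCore hh.innerCore.toCore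
  have hinner : ∀ x y : A, inner ℂ x y = h (star x * y) := fun x y => rfl
  have hsymm : S.IsSymmetric := fun x y => by
    rw [hinner, hinner, ← hh.star_mul_symm, ← hermitian_of_nonneg h S hSpos, Complex.conj_conj]
  let 𝒲 : Set (Submodule ℂ A) := {W | ∃ (n : ℕ) (U : Matrix (Fin n) (Fin n) A),
    IsIrreducibleUnitaryRep U ∧ W = coeffSpace U}
  obtain ⟨J, e, he, heW⟩ := hsymm.exists_orthonormal_eigenbasis 𝒲
    (by rintro _ ⟨n, U, -, rfl⟩; infer_instance)
    (by
      rintro _ ⟨n, U, hU, rfl⟩ x hx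
      obtain ⟨U', q, hU', heq⟩ := hU.toIsUnitaryRep.exists_isDiagonalRep hh
      obtain ⟨m, hm⟩ := hθ.twist_diagonal hh hσ hU'
      rw [← heq] at hx ⊢
      have hle : coeffSpace U' ≤ (coeffSpace U').comap S := coeffSpace_le fun k j => by
        have h1 : S (U' k j) = _ := C.ι_injective ((hS _).symm.trans (hm k j))
        rw [Submodule.mem_comap, h1]
        exact Submodule.sum_mem _ fun i _ => Submodule.smul_mem _ _ (mem_coeffSpace U' k i)
      exact hle hx)
    (by
      rintro _ ⟨n, U, hU, rfl⟩ _ ⟨m, V, hV, rfl⟩ hne x hx y hy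
      rw [hinner]
      exact ((hV.coeffSpace_eq_or_orthogonal hh hU).resolve_left (Ne.symm hne)) y hy x hx)
    (by
      rw [eq_top_iff, ← hh.span_irreducible, Submodule.span_le]
      rintro _ ⟨n, U, hU, i, j, rfl⟩
      exact (le_sSup (show coeffSpace U ∈ 𝒲 from ⟨n, U, hU, rfl⟩)) (mem_coeffSpace U i j))
  choose hW l hl using heW
  have hone : ∀ j, h (star (e j) * e j) = 1 := fun j => by
    classical
    have := (orthonormal_iff_ite.1 he) j j
    rwa [if_pos rfl] at this
  have hσe : ∀ j, σ (C.ι (e j)) = (l j : ℂ) • C.ι (e j) := fun j => by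
    rw [hS, hl, map_smul]
  refine ⟨J, e, l, fun j => ?_, hone, fun j k hjk => ?_, fun j => ?_, hσe⟩
  · obtain ⟨_, ⟨n, U, hU, rfl⟩, hj⟩ := hW j
    exact ⟨n, U, hU, hj⟩
  · exact he.2 hjk.symm
  · have h1 := hSpos (e j)
    rw [hl, mul_smul_comm, map_smul, hone, smul_eq_mul, mul_one] at h1
    refine lt_of_le_of_ne (by exact_mod_cast h1) fun h0 => ?_
    have h2 := hσe j
    rw [← h0, Complex.ofReal_zero, zero_smul] at h2
    have h3 : C.ι (e j) = 0 := σ.injective (h2.trans (map_zero σ).symm)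
    exact e.ne_zero j (C.ι_injective (h3.trans (map_zero C.ι).symm))

end IsVolumeForm

/-- Products and differentials of eigenvectors of the twist automorphism are eigenvectors, so that
the eigenvectors with positive eigenvalues span `Ω` as soon as they span `A`. -/
theorem IsTwistAutomorphism.positiveEigenspan_eq_top {I : Ω →ₗ[ℂ] ℂ} {σ : Ω ≃ₐ[ℂ] Ω}
    (hσ : C.IsTwistAutomorphism I σ) {J : Type*} (e : Module.Basis J ℂ A) {l : J → ℝ}
    (hl : ∀ j, 0 < l j) (he : ∀ j, σ (C.ι (e j)) = (l j : ℂ) • C.ι (e j)) :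
    positiveEigenspan σ = ⊤ := by
  refine C.eq_top_of_generators _ (fun a => ?_) (fun {x y} hx hy => ?_) (fun {x} hx => ?_)
  · induction e.mem_span a using Submodule.span_induction with
    | zero => simp
    | add x y _ _ hx hy => simpa using Submodule.add_mem _ hx hy
    | smul c x _ hx => simpa using Submodule.smul_mem _ c hx
    | mem x hx =>
      obtain ⟨j, rfl⟩ := hx
      exact Submodule.subset_span ⟨l j, hl j, he j⟩
  · unfold positiveEigenspan at hx hy ⊢
    induction hx using Submodule.span_induction with
    | zero => simp
    | add x z _ _ hx hz => rw [add_mul]; exact Submodule.add_mem _ hx hz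
    | smul c x _ hx => rw [smul_mul_assoc]; exact Submodule.smul_mem _ c hx
    | mem x hx =>
      induction hy using Submodule.span_induction with
      | zero => simp
      | add y z _ _ hy hz => rw [mul_add]; exact Submodule.add_mem _ hy hz
      | smul c y _ hy => rw [mul_smul_comm]; exact Submodule.smul_mem _ c hy
      | mem y hy =>
        obtain ⟨r, hr, hx⟩ := hx
        obtain ⟨r', hr', hy⟩ := hy
        refine Submodule.subset_span ⟨r * r', mul_pos hr hr', ?_⟩
        rw [map_mul, hx, hy, smul_mul_smul_comm, Complex.ofReal_mul]
  · unfold positiveEigenspan at hx ⊢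
    induction hx using Submodule.span_induction with
    | zero => simp
    | add x z _ _ hx hz => rw [map_add]; exact Submodule.add_mem _ hx hz
    | smul c x _ hx => rw [map_smul]; exact Submodule.smul_mem _ c hx
    | mem x hx =>
      obtain ⟨r, hr, hx⟩ := hx
      exact Submodule.subset_span ⟨r, hr, by rw [hσ.map_d, hx, map_smul]⟩

theorem IsTwistAutomorphism.component_comm {I : Ω →ₗ[ℂ] ℂ} {σ : Ω ≃ₐ[ℂ] Ω}
    (hσ : C.IsTwistAutomorphism I σ) (k : ℕ) (ω : Ω) :
    C.component k (σ ω) = σ (C.component k ω) := by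
  induction ω using C.homogeneous_induction with
  | hadd x y hx hy => simp only [map_add, hx, hy]
  | hom l ω hω =>
    rw [C.component_of_mem hω, C.component_of_mem (hσ.map_mem hω)]
    split_ifs <;> simp

theorem isFiniteExponentialType_map {τ : ℂ → A ≃ₐ[ℂ] A} {β : ℂ → Ω ≃ₐ[ℂ] Ω}
    (hτ : ∀ a, IsFiniteExponentialType fun z => τ z a)
    (hβ : ∀ ω, IsFiniteExponentialType fun z => β z ω) (t : A ⊗[ℂ] Ω) :
    IsFiniteExponentialType fun z =>
      TensorProduct.map (τ z).toLinearMap (β z).toLinearMap t := by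
  induction t using TensorProduct.induction_on with
  | zero => simpa using IsFiniteExponentialType.zero
  | tmul x y => exact (hτ x).map₂ (hβ y) (TensorProduct.mk ℂ A Ω)
  | add x y hx hy => simpa using hx.add hy

end Positive

end StarDifferentialCalculus

/-! ### The one-parameter group of the twist automorphism -/

theorem mainTheorem5 {A : Type u} {Ω : Type v} [Ring A] [StarRing A] [HopfAlgebra ℂ A]
    [StarModule ℂ A] [HopfStarAlgebra A] [Ring Ω] [Algebra ℂ Ω]
    (h : A →ₗ[ℂ] ℂ) (hh : IsHaarIntegral h)
    (C : StarDifferentialCalculus A Ω) (hfin : FiniteDimensional ℂ C.invariants)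
    (N : ℕ) (hN : C.IsDimension N) (hnd : C.IsNondegenerate N)
    (hone : Module.finrank ℂ (C.invariantForms N) = 1)
    (hd : ∀ k, k + 1 = N → ∀ ω ∈ C.invariantForms k, C.d ω = 0)
    (θ : Ω) (hθ : θ ∈ C.invariantForms N) (hθ_inv : C.inv θ = θ) (hθ_ne : θ ≠ 0) :
    (∃! τ : ℂ → A ≃ₐ[ℂ] A, IsScalingGroup τ) ∧
    (∃! σ : Ω ≃ₐ[ℂ] Ω, C.IsTwistAutomorphism (C.integral h N θ) σ) ∧
    ∀ (τ : ℂ → A ≃ₐ[ℂ] A) (σ : Ω ≃ₐ[ℂ] Ω), IsScalingGroup τ →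
      C.IsTwistAutomorphism (C.integral h N θ) σ →
      (∀ a b : A, C.ι b = σ (C.ι a) → 0 ≤ h (star a * b)) →
      (∃! β : ℂ → Ω ≃ₐ[ℂ] Ω, IsExponentialOneParameterGroup C.inv β ∧ β Complex.I = σ) ∧
      ∀ β : ℂ → Ω ≃ₐ[ℂ] Ω, IsExponentialOneParameterGroup C.inv β → β Complex.I = σ →
        (∃ (J : Type u) (e : Module.Basis J ℂ A) (l : J → ℝ),
          (∀ j, IsHomogeneous (e j)) ∧
          (∀ j, h (star (e j) * e j) = 1) ∧
          (∀ j k, j ≠ k → h (star (e k) * e j) = 0) ∧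
          (∀ j, 0 < l j) ∧
          ∀ j z, β z (C.ι (e j)) = ((l j : ℂ) ^ (-Complex.I * z)) • C.ι (e j)) ∧
        ∀ z : ℂ,
          (∀ k, ∀ ω ∈ C.grading k, β z ω ∈ C.grading k) ∧
          (∀ ω, C.d (β z ω) = β z (C.d ω)) ∧
          (∀ ω, C.integral h N θ (β z ω) = C.integral h N θ ω) ∧
          (∀ ω, TensorProduct.map (τ z).toLinearMap (β z).toLinearMap (C.coaction ω) =
            C.coaction (β z ω)) ∧
          C.invariants.map (β z).toLinearMap = C.invariants := by
  have hV : C.IsVolumeForm N θ := ⟨hN, hnd, hone, hd, hθ, hθ_inv, hθ_ne⟩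
  refine ⟨?_, ?_, fun τ σ hτ hσ hpos => ?_⟩
  · obtain ⟨τ, hτ⟩ := hh.exists_isScalingGroup
    exact ⟨τ, hτ, fun τ' hτ' => hτ'.eq hh hτ⟩
  · obtain ⟨σ, hσ⟩ := hV.exists_isTwistAutomorphism hh
    exact ⟨σ, hσ, fun σ' hσ' => hV.isTwistAutomorphism_unique hh hσ' hσ⟩
  obtain ⟨J, e, l, hhom, hnorm, horth, hl, he⟩ := hV.exists_homogeneous_eigenbasis hh hσ hpos
  have hspan : positiveEigenspan σ = ⊤ := hσ.positiveEigenspan_eq_top e hl he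
  refine ⟨?_, fun β hβ hI => ⟨⟨J, e, l, hhom, hnorm, horth, hl, fun j z => ?_⟩, fun z => ?_⟩⟩
  · obtain ⟨β, hβ, hI⟩ := exists_isExponentialOneParameterGroup (inv := C.inv)
      (σ : Ω →ₐ[ℂ] Ω) hspan (fun x y => map_add _ _ _) (fun c x => C.inv.map_smulₛₗ c x)
      (fun r b hr hb => by
        have hr0 : (r : ℂ) ≠ 0 := by exact_mod_cast hr.ne'
        have h1 := hV.twist_inv_twist hh hσ b
        have hb' : σ b = (r : ℂ) • b := hb
        rw [hb', C.inv.map_smulₛₗ, map_smul, Complex.conj_ofReal] at h1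
        show σ (C.inv b) = _
        conv_rhs => rw [← h1]
        rw [smul_smul, Complex.ofReal_inv, inv_mul_cancel₀ hr0, one_smul])
    have hI' : β Complex.I = σ := AlgEquiv.ext hI
    refine ⟨β, ⟨hβ, hI'⟩, fun β' hβ' => ?_⟩
    exact hβ'.1.eq_of_apply_I hβ (fun b => by rw [hβ'.2, hI']) (by rw [hβ'.2, hspan])
  · exact hβ.apply_of_eigenvector (hl j) (by rw [hI, he]) z
  · have hspan' : positiveEigenspan (β Complex.I) = ⊤ := by rw [hI, hspan]
    have hself : ∀ (f : Ω →ₗ[ℂ] Ω), (∀ ω, f (σ ω) = σ (f ω)) → ∀ z ω, f (β z ω) = β z (f ω) :=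
      fun f hf => hβ.intertwine hspan' (fun z => (β z).toLinearMap) hβ.map_add hβ.map_zero
        hβ.finiteExponentialType f (fun b => by rw [hI]; exact hf b)
    have hτ' := hτ.toIsExponentialOneParameterGroup
    have hco : ∀ z ω, C.coaction (β z ω) =
        TensorProduct.map (τ z).toLinearMap (β z).toLinearMap (C.coaction ω) := by
      refine hβ.intertwine hspan'
        (fun z => TensorProduct.map (τ z).toLinearMap (β z).toLinearMap) (fun y z t => ?_)
        (fun t => ?_)
        (StarDifferentialCalculus.isFiniteExponentialType_map hτ'.finiteExponentialType
          hβ.finiteExponentialType) C.coaction.toLinearMap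
        (fun ω => by rw [hI]; exact hV.coaction_twist hh hσ hτ ω)
      · induction t using TensorProduct.induction_on with
        | zero => simp
        | tmul a ω => simp [hτ'.map_add, hβ.map_add]
        | add s t hs ht => simp only [map_add, hs, ht]
      · induction t using TensorProduct.induction_on with
        | zero => simp
        | tmul a ω => simp [hτ'.map_zero, hβ.map_zero]
        | add s t hs ht => simp only [map_add, hs, ht]
    have hinvt : ∀ z, ∀ ω ∈ C.invariants, β z ω ∈ C.invariants := by
      intro z ω hω
      have h1 : C.coaction ω = 1 ⊗ₜ[ℂ] ω := hω
      show C.coaction (β z ω) = 1 ⊗ₜ[ℂ] β z ω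
      rw [hco, h1]
      simp
    refine ⟨fun k ω hω => ?_, fun ω => hself C.d (fun ω => (hσ.map_d ω).symm) z ω, fun ω => ?_,
      fun ω => (hco z ω).symm, ?_⟩
    · have h1 := hself (C.component k) (hσ.component_comm k) z ω
      rw [C.component_of_mem hω, if_pos rfl] at h1
      rw [← h1]
      exact C.component_mem k _
    · refine hβ.intertwine hspan' (fun _ => LinearMap.id) (fun _ _ _ => rfl) (fun _ => rfl)
        (fun v => ?_) (C.integral h N θ) (fun b => by rw [hI]; exact hσ.integral_twist b) z ω
      simpa using isFiniteExponentialType_of_fintype (fun _ : Unit => v)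
        (fun _ z => ((1 : ℝ) : ℂ) ^ (-Complex.I * z)) (fun _ => isExponentialType_cpow one_pos)
    · refine le_antisymm ?_ fun ω hω => ⟨β (-z) ω, hinvt _ ω hω, ?_⟩
      · rintro _ ⟨ω, hω, rfl⟩
        exact hinvt z ω hω
      · show β z (β (-z) ω) = ω
        rw [← hβ.map_add, add_neg_cancel, hβ.map_zero]
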